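/- **Setting.** Let $\mathcal V$ be a countably infinite set of variables and $\mathcal F$ a signature of function symbols with fixed arities. Terms are elements of $\mathcal T(\mathcal F,\mathcal V)$; contexts are terms over $\mathcal F\cup\{\square\}$ and $\mathcal V$, where $\square$ is a fresh constant (the hole), and $\mathcal C(\mathcal F,\mathcal V)$ is the set of contexts. Let $\sqsubseteq$ be the least reflexive, transitive relation on contexts that is monotone (closed under function symbols) and satisfies $\square\sqsubseteq C$ for all $C$; $C\sqcup D$ denotes the supremum of $C$ and $D$ when it exists. $\mathrm{Pos}_{\mathcal F}(C)$ and $\mathrm{Pos}_\square(C)$ are the sets of positions of $C$ that carry a function symbol from $\mathcal F$ and a hole, respectively; $C|_p$ is the subterm of $C$ at position $p$, and $C[D]_p$ results from replacing it by $D$. A TRS $\mathcal R$ is a set of rules $\ell\to r$ of terms in $\mathcal T(\mathcal F,\mathcal V)$ with $\ell\notin\mathcal V$ and $\mathrm{Var}(r)\subseteq\mathrm{Var}(\ell)$; $s\to_{p,\ell\to r}t$ is a rewrite step at position $p$ with the rule $\ell\to r$ (on contexts, $\square$ is treated as a constant), and $\to_{\mathcal R}$ is the induced rewrite relation. Let $\mathbb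 L\subseteq\mathcal C(\mathcal F,\mathcal V)$. A *top* of a context $C$ is an $L\in\mathbb L$ with $L\sqsubseteq C$; a *max-top* of $C$ is a $\sqsubseteq$-maximal top of $C$. The set $\mathbb L$ is a *variable-restricted layer system* if - (L1) each term in $\mathcal T(\mathcal F,\mathcal V)$ has a top different from $\square$; - (L2$'$) for every context $C$ and position $p$ of $C$: if $C[x]_p\in\mathbb L$ for some $x\in\mathcal V$ then $C[\square]_p\in\mathbb L$; and if $C[\square]_p\in\mathbb L$ then $\{x\in\mathcal V\mid C[x]_p\in\mathbb L\}$ is infinite; - (L3) if $L,N\in\mathbb L$, $p\in\mathrm{Pos}_{\mathcal F}(L)$ and $L|_p\sqcup N$ is defined, then $L[L|_p\sqcup N]_p\in\mathbb L$. A TRS $\mathcal R$ is *weakly layered* according to $\mathbb L$ if (W) holds for each rule $\ell\to r$ of $\mathcal R$, and *layered* according to $\mathbb L$ if (W), (C1) and (C2) hold: - (W) if $M$ is a max-top of a term $s$, $p\in\mathrm{Pos}_{\mathcal F}(M)$ and $s\to_{p,\ell\to r}t$, then $M\to_{p,\ell\to r}L$ for some $L\in\mathbb L$; - (C1) in (W),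 either $L$ is a max-top of $t$ or $L=\square$; - (C2) if $L,N\in\mathbb L$, $L\sqsubseteq N$ and $p\in\mathrm{Pos}_\square(L)$, then $L[N|_p]_p\in\mathbb L$. If $M$ is the max-top of a term $t$ and $t=M[t_1,\dots,t_n]$ (the holes of $M$ being filled from left to right), then $\mathrm{rank}(t)=1+\max\{\mathrm{rank}(t_i)\mid 1\le i\le n\}$, with $\max\varnothing=0$; the terms of rank one are those in $\mathbb L\cap\mathcal T(\mathcal F,\mathcal V)$. A relation $\to$ is *confluent* if $t\mathrel{{}^*{\leftarrow}}s\to^* u$ implies $t\to^* v\mathrel{{}^*{\leftarrow}}u$ for some $v$, and it is *confluent on* a set $S$ if $S$ is closed under $\to$ and ${\to}\cap(S\times S)$ is confluent. $\mathcal R$ is *left-linear* if in every left-hand side each variable occurs at most once. $\mathcal R$ is *bounded duplicating* if, for a fresh unary function symbol $\Diamond$, the relation $\to_{\mathcal R}^*\cdot\to_{\{\Diamond(x)\to x\}}\cdot\to_{\mathcal R}^*$ on $\mathcal T(\mathcal F\cup\{\Diamond\},\mathcal V)$ is terminating. **Statement.** Let $\mathbb L$ be a variable-restricted layer system over $\mathcal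 F$ and $\mathcal V$, and let $\mathcal R$ be a TRS over $\mathcal F$ and $\mathcal V$ that is confluent on the terms of rank one (with respect to $\mathbb L$). 1. If $\mathcal R$ is weakly layered according to $\mathbb L$ and left-linear, then $\mathcal R$ is confluent. 2. If $\mathcal R$ is weakly layered according to $\mathbb L$ and bounded duplicating, then $\mathcal R$ is confluent. 3. If $\mathcal R$ is layered according to $\mathbb L$, then $\mathcal R$ is confluent. -/

import Mathlib

/-!
Terms over a signature are Mathlib's first-order terms: a signature is a `FirstOrder.Language` `L`,
whose function symbols come with a fixed arity (its relation symbols play no role), and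
`L.Term X` is the set of terms over `L` with variables from `X`.
-/

open FirstOrder FirstOrder.Language

universe u v w x

namespace LayerSystems

variable {L : FirstOrder.Language.{u, v}} {V : Type w} {X : Type x}

/-! ### Positions -/

/-- The subterm of `t` at position `p`; `none` if `p` is not a position of `t`.
Arguments are numbered from `0`. -/
def subtermAt : L.Term X → List ℕ → Option (L.Term X)
  | t, [] => some t
  | Term.var _, _ :: _ => none
  | Term.func (l := n) _ ts, i :: p => if h : i < n then subtermAt (ts ⟨i, h⟩) p else none

/-- `replaceAt t p s` is `t[s]_p`, the result of replacing the subterm of `t` at the position `p`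
by `s` (and `t` itself if `p` is not a position of `t`). -/
def replaceAt : L.Term X → List ℕ → L.Term X → L.Term X
  | _, [], s => s
  | Term.var y, _ :: _, _ => Term.var y
  | Term.func f ts, i :: p, s =>
      Term.func f fun j => if (j : ℕ) = i then replaceAt (ts j) p s else ts j

/-- `p` is a position of `t`. -/
def IsPos (t : L.Term X) (p : List ℕ) : Prop := ∃ s, subtermAt t p = some s

/-- `p` is a position of `t` that carries a function symbol. -/
def IsFunPos (t : L.Term X) (p : List ℕ) : Prop :=
  ∃ (n : ℕ) (f : L.Functions n) (ts : Fin n → L.Term X), subtermAt t p = some (Term.func f ts)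

/-- `p` is a position of `t` that carries the variable `y`. -/
def IsVarPos (t : L.Term X) (y : X) (p : List ℕ) : Prop := subtermAt t p = some (Term.var y)

/-- The set of variables that occur in a term. -/
def vars (t : L.Term X) : Set X := {y | ∃ p, IsVarPos t y p}

/-- A term is linear if every variable occurs at most once in it. -/
def IsLinear (t : L.Term X) : Prop := ∀ y p q, IsVarPos t y p → IsVarPos t y q → p = q

/-! ### Term rewrite systems -/

/-- The rewrite step `s →_{p, ℓ → r} t`. The terms `s` and `t` may have variables from a set
other than that of the rule, so that the definition also covers rewriting of contexts. -/
def StepAt (ρ : L.Term V × L.Term V) (p : List ℕ) (s t : L.Term X) : Prop :=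
  ∃ σ : V → L.Term X, subtermAt s p = some (ρ.1.subst σ) ∧ t = replaceAt s p (ρ.2.subst σ)

/-- The rewrite relation induced by a set of rules. -/
def Step (S : Set (L.Term V × L.Term V)) (s t : L.Term X) : Prop :=
  ∃ ρ ∈ S, ∃ p, StepAt ρ p s t

/-- Term rewrite systems over the signature `L` and the variables `V`. -/
structure TRS (L : FirstOrder.Language.{u, v}) (V : Type w) where
  /-- the set of rewrite rules `ℓ → r` -/
  rules : Set (L.Term V × L.Term V)
  lhs_ne_var : ∀ ρ ∈ rules, ∀ y : V, ρ.1 ≠ Term.var y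
  vars_rhs_subset : ∀ ρ ∈ rules, vars ρ.2 ⊆ vars ρ.1

/-- The rewrite relation of a TRS on terms. -/
def TRS.Rel (R : TRS L V) : L.Term V → L.Term V → Prop := Step R.rules

/-- A TRS is left-linear if the left-hand sides of all its rules are linear. -/
def TRS.IsLeftLinear (R : TRS L V) : Prop := ∀ ρ ∈ R.rules, IsLinear ρ.1

/-- Confluence of a relation. -/
def Confluent {α : Type*} (r : α → α → Prop) : Prop :=
  ∀ s t u, Relation.ReflTransGen r s t → Relation.ReflTransGen r s u →
    ∃ v, Relation.ReflTransGen r t v ∧ Relation.ReflTransGen r u v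

/-- A relation is confluent on a set `S` if `S` is closed under the relation and the restriction of
the relation to `S` is confluent. -/
def ConfluentOn {α : Type*} (r : α → α → Prop) (S : Set α) : Prop :=
  (∀ s t, s ∈ S → r s t → t ∈ S) ∧ Confluent fun s t => s ∈ S ∧ t ∈ S ∧ r s t

/-- A relation `→` is terminating if its transitive closure is well-founded
(there is no infinite sequence `t₀ → t₁ → t₂ → ⋯`). -/
def Terminating {α : Type*} (r : α → α → Prop) : Prop :=
  WellFounded fun t s => Relation.TransGen r s t

/-- The relation `→_S^* · →_R · →_S^*` of `R` relative to `S`. -/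
def RelativeTo {α : Type*} (r s : α → α → Prop) : α → α → Prop :=
  Relation.Comp (Relation.ReflTransGen s) (Relation.Comp r (Relation.ReflTransGen s))

/-- The only function symbol of the signature `{◇}`: it is unary. -/
inductive DiamondFn : ℕ → Type
  | diamond : DiamondFn 1

/-- The signature `{◇}`. -/
def diamondLang : FirstOrder.Language.{0, 0} := ⟨DiamondFn, fun _ => Empty⟩

/-- The term `◇(t)` over the signature of `L` extended by the fresh symbol `◇`. -/
def diamond (t : (L.sum diamondLang).Term X) : (L.sum diamondLang).Term X :=
  Term.func (l := 1) (Sum.inr DiamondFn.diamond) fun _ => t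

/-- The rule `◇(y) → y` (for every name `y` of its variable, which does not affect the rewrite
relation). -/
def diamondRules (L : FirstOrder.Language.{u, v}) (V : Type w) :
    Set ((L.sum diamondLang).Term V × (L.sum diamondLang).Term V) :=
  {ρ | ∃ y : V, ρ = (diamond (Term.var y), Term.var y)}

/-- The rules of a TRS, viewed as rules over the signature extended by `◇`. -/
def TRS.rulesWithDiamond (R : TRS L V) :
    Set ((L.sum diamondLang).Term V × (L.sum diamondLang).Term V) :=
  Prod.map LHom.sumInl.onTerm LHom.sumInl.onTerm '' R.rules

/-- A TRS `R` is bounded duplicating if `{◇(y) → y} / R` is terminating, where `◇` is a fresh unary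
function symbol. -/
def TRS.IsBoundedDuplicating (R : TRS L V) : Prop :=
  Terminating (RelativeTo
    (Step (diamondRules L V) :
      (L.sum diamondLang).Term V → (L.sum diamondLang).Term V → Prop)
    (Step R.rulesWithDiamond))

/-! ### Contexts -/

/-- Contexts: terms that may contain the additional constant `□`. The leaves of a context that are
not constants of `L` are labelled by `V ∪ {□} = Option V`, and the hole `□` is `none`. Substitutions
`V → Ctx L V` leave holes alone, so that contexts are rewritten as terms with a constant `□`. -/
abbrev Ctx (L : FirstOrder.Language.{u, v}) (V : Type w) := L.Term (Option V)

/-- The hole `□`, also the empty context. -/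
def hole : Ctx L V := Term.var none

/-- A variable as a context. -/
def ctxVar (y : V) : Ctx L V := Term.var (some y)

/-- A term as a context without holes. -/
def toCtx (t : L.Term V) : Ctx L V := t.relabel some

/-- The order `⊑` on contexts, the least reflexive, transitive and monotone relation with `□ ⊑ C`
for all contexts `C`. -/
inductive Ctx.Le : Ctx L V → Ctx L V → Prop
  | hole (C : Ctx L V) : Ctx.Le LayerSystems.hole C
  | var (y : V) : Ctx.Le (ctxVar y) (ctxVar y)
  | func {n : ℕ} (f : L.Functions n) (Cs Ds : Fin n → Ctx L V) (h : ∀ i, Ctx.Le (Cs i) (Ds i)) :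
      Ctx.Le (Term.func f Cs) (Term.func f Ds)

theorem Ctx.Le.refl (C : Ctx L V) : Ctx.Le C C := by
  induction C with
  | var y =>
    cases y with
    | none => exact Ctx.Le.hole _
    | some y => exact Ctx.Le.var y
  | func f ts ih => exact Ctx.Le.func f ts ts ih

theorem Ctx.Le.trans {C D E : Ctx L V} (h : Ctx.Le C D) (h' : Ctx.Le D E) : Ctx.Le C E := by
  induction h generalizing E with
  | hole C => exact Ctx.Le.hole E
  | var y => exact h'
  | func f Cs Ds _ ih =>
    cases h' with
    | func _ _ Es hE => exact Ctx.Le.func f Cs Es fun i => ih i (hE i)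

theorem Ctx.Le.antisymm {C D : Ctx L V} (h : Ctx.Le C D) (h' : Ctx.Le D C) : C = D := by
  induction h with
  | hole C => cases h'; rfl
  | var y => rfl
  | func f Cs Ds _ ih =>
    cases h' with
    | func _ _ _ hE => exact congrArg _ (funext fun i => ih i (hE i))

instance : PartialOrder (Ctx L V) where
  le := Ctx.Le
  le_refl := Ctx.Le.refl
  le_trans _ _ _ := Ctx.Le.trans
  le_antisymm _ _ := Ctx.Le.antisymm

/-- `IsMerge C D E` says that the merge `C ⊔ D`, a partial operation, is defined and equal to `E`:
`E` is the supremum of `C` and `D` with respect to `⊑`. -/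
def IsMerge (C D E : Ctx L V) : Prop := IsLUB {C, D} E

/-! ### Layers -/

/-- `T` is a top of `C` according to `𝕃`. -/
def IsTop (𝕃 : Set (Ctx L V)) (C T : Ctx L V) : Prop := T ∈ 𝕃 ∧ T ≤ C

/-- `M` is a max-top of `C` according to `𝕃`: it is maximal among the tops of `C`. -/
def IsMaxTop (𝕃 : Set (Ctx L V)) (C M : Ctx L V) : Prop := Maximal (IsTop 𝕃 C) M

/-- `a` is the alien of the term `t` at the hole position `p` of the context `M`. -/
def IsAlienAt (M : Ctx L V) (t : L.Term V) (p : List ℕ) (a : L.Term V) : Prop :=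
  subtermAt M p = some hole ∧ subtermAt t p = some a

/-- `HasRank 𝕃 t k` says that `t` has rank `k`: if `t = M[t₁, …, tₙ]` for the max-top `M` of `t`
then `rank t = 1 + max {rank tᵢ | 1 ≤ i ≤ n}`, where the maximum of the empty set is `0`.
In the code, `d p` is the rank of the alien at the position `p`. -/
inductive HasRank (𝕃 : Set (Ctx L V)) : L.Term V → ℕ → Prop
  | intro (t : L.Term V) (M : Ctx L V) (hM : IsMaxTop 𝕃 (toCtx t) M) (d : List ℕ → ℕ)
      (hd : ∀ p a, IsAlienAt M t p a → HasRank 𝕃 a (d p)) :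
      HasRank 𝕃 t (1 + sSup {k | ∃ p a, IsAlienAt M t p a ∧ k = d p})

/-- Condition (L1). -/
def L1 (𝕃 : Set (Ctx L V)) : Prop := ∀ t : L.Term V, ∃ T, IsTop 𝕃 (toCtx t) T ∧ T ≠ hole

/-- Condition (L2'). -/
def L2' (𝕃 : Set (Ctx L V)) : Prop :=
  ∀ (C : Ctx L V) (p : List ℕ), IsPos C p →
    (∀ y : V, replaceAt C p (ctxVar y) ∈ 𝕃 → replaceAt C p hole ∈ 𝕃) ∧
    (replaceAt C p hole ∈ 𝕃 → {y : V | replaceAt C p (ctxVar y) ∈ 𝕃}.Infinite)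

/-- Condition (L3). -/
def L3 (𝕃 : Set (Ctx L V)) : Prop :=
  ∀ C ∈ 𝕃, ∀ N ∈ 𝕃, ∀ p, IsFunPos C p → ∀ D E, subtermAt C p = some D → IsMerge D N E →
    replaceAt C p E ∈ 𝕃

/-- Variable-restricted layer systems. -/
structure IsVarRestrictedLayerSystem (𝕃 : Set (Ctx L V)) : Prop where
  l1 : L1 𝕃
  l2' : L2' 𝕃
  l3 : L3 𝕃

/-- Condition (W) for all rules of `R`: `R` is weakly layered according to `𝕃`. -/
def WeaklyLayered (𝕃 : Set (Ctx L V)) (R : TRS L V) : Prop :=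
  ∀ ρ ∈ R.rules, ∀ (s t : L.Term V) (M : Ctx L V) (p : List ℕ),
    IsMaxTop 𝕃 (toCtx s) M → IsFunPos M p → StepAt ρ p s t → ∃ N ∈ 𝕃, StepAt ρ p M N

/-- Condition (C1) for all rules of `R`. -/
def C1 (𝕃 : Set (Ctx L V)) (R : TRS L V) : Prop :=
  ∀ ρ ∈ R.rules, ∀ (s t : L.Term V) (M : Ctx L V) (p : List ℕ),
    IsMaxTop 𝕃 (toCtx s) M → IsFunPos M p → StepAt ρ p s t →
      ∀ N ∈ 𝕃, StepAt ρ p M N → IsMaxTop 𝕃 (toCtx t) N ∨ N = hole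

/-- Condition (C2). -/
def C2 (𝕃 : Set (Ctx L V)) : Prop :=
  ∀ C ∈ 𝕃, ∀ N ∈ 𝕃, C ≤ N → ∀ p, subtermAt C p = some hole →
    ∀ D, subtermAt N p = some D → replaceAt C p D ∈ 𝕃

/-- `R` is layered according to `𝕃`. -/
structure Layered (𝕃 : Set (Ctx L V)) (R : TRS L V) : Prop where
  weaklyLayered : WeaklyLayered 𝕃 R
  c1 : C1 𝕃 R
  c2 : C2 𝕃

end LayerSystems

namespace LayerSystems

variable {L : FirstOrder.Language.{u, v}} {V : Type w} {X Y Z : Type*}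

/-! ### Positions -/

@[simp] theorem subtermAt_nil (t : L.Term X) : subtermAt t [] = some t := by
  cases t <;> rfl

@[simp] theorem subtermAt_var_cons (y : X) (i : ℕ) (p : List ℕ) :
    subtermAt (Term.var y : L.Term X) (i :: p) = none := rfl

theorem subtermAt_func_cons {n : ℕ} (f : L.Functions n) (ts : Fin n → L.Term X) (i : ℕ)
    (p : List ℕ) : subtermAt (Term.func f ts) (i :: p) =
      if h : i < n then subtermAt (ts ⟨i, h⟩) p else none := rfl

@[simp] theorem subtermAt_func_fin {n : ℕ} (f : L.Functions n) (ts : Fin n → L.Term X) (i : Fin n)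
    (p : List ℕ) : subtermAt (Term.func f ts) (i :: p) = subtermAt (ts i) p := by
  simp [subtermAt_func_cons]

theorem subtermAt_cons_eq_some {t u : L.Term X} {i : ℕ} {p : List ℕ} :
    subtermAt t (i :: p) = some u ↔ ∃ (n : ℕ) (f : L.Functions n) (ts : Fin n → L.Term X)
      (j : Fin n), t = Term.func f ts ∧ i = j ∧ subtermAt (ts j) p = some u := by
  constructor
  · intro h
    cases t with
    | var y => simp at h
    | func f ts =>
      rw [subtermAt_func_cons] at h
      split at h
      · exact ⟨_, f, ts, ⟨i, by assumption⟩, rfl, rfl, h⟩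
      · simp at h
  · rintro ⟨n, f, ts, j, rfl, rfl, h⟩
    simpa using h

theorem subtermAt_append (t : L.Term X) (p q : List ℕ) :
    subtermAt t (p ++ q) = (subtermAt t p).bind fun u => subtermAt u q := by
  induction p generalizing t with
  | nil => simp
  | cons i p ih =>
    cases t with
    | var y => simp
    | func f ts =>
      simp only [List.cons_append, subtermAt_func_cons]
      split
      · exact ih _
      · rfl

theorem subtermAt_append_of_eq {t u : L.Term X} {p : List ℕ} (h : subtermAt t p = some u)
    (q : List ℕ) : subtermAt t (p ++ q) = subtermAt u q := by
  rw [subtermAt_append, h]; rfl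

theorem subtermAt_append_eq_some {t u : L.Term X} {p q : List ℕ} :
    subtermAt t (p ++ q) = some u ↔ ∃ s, subtermAt t p = some s ∧ subtermAt s q = some u := by
  rw [subtermAt_append, Option.bind_eq_some_iff]

theorem subtermAt_var_eq_some {y : X} {p : List ℕ} {u : L.Term X} :
    subtermAt (Term.var y) p = some u ↔ p = [] ∧ u = Term.var y := by
  cases p <;> simp [eq_comm]

theorem isVarPos_var {y z : X} {p : List ℕ} :
    IsVarPos (Term.var y : L.Term X) z p ↔ p = [] ∧ y = z := by
  simp only [IsVarPos, subtermAt_var_eq_some, Term.var.injEq, eq_comm]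

@[simp] theorem isVarPos_func_fin {n : ℕ} (f : L.Functions n) (ts : Fin n → L.Term X) (i : Fin n)
    (p : List ℕ) (y : X) : IsVarPos (Term.func f ts) y (i :: p) ↔ IsVarPos (ts i) y p := by
  simp [IsVarPos]

@[simp] theorem not_isVarPos_func_nil {n : ℕ} (f : L.Functions n) (ts : Fin n → L.Term X) (y : X) :
    ¬ IsVarPos (Term.func f ts) y [] := by
  simp [IsVarPos]

@[simp] theorem isFunPos_func_fin {n : ℕ} (f : L.Functions n) (ts : Fin n → L.Term X) (i : Fin n)
    (p : List ℕ) : IsFunPos (Term.func f ts) (i :: p) ↔ IsFunPos (ts i) p := by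
  simp [IsFunPos]

@[simp] theorem isFunPos_func_nil {n : ℕ} (f : L.Functions n) (ts : Fin n → L.Term X) :
    IsFunPos (Term.func f ts) [] := ⟨n, f, ts, by simp⟩

@[simp] theorem not_isFunPos_var (y : X) (p : List ℕ) :
    ¬ IsFunPos (Term.var y : L.Term X) p := by
  rintro ⟨n, f, ts, h⟩
  rw [subtermAt_var_eq_some] at h
  simp at h

theorem isVarPos_append {t u : L.Term X} {p q : List ℕ} {y : X} (h : subtermAt t p = some u) :
    IsVarPos t y (p ++ q) ↔ IsVarPos u y q := by
  simp only [IsVarPos, subtermAt_append_of_eq h]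

theorem isFunPos_of_subtermAt_append {t s : L.Term X} {p q : List ℕ} (hq : q ≠ [])
    (h : subtermAt t (p ++ q) = some s) : IsFunPos t p := by
  obtain ⟨u, hu, hs⟩ := subtermAt_append_eq_some.1 h
  cases q with
  | nil => exact absurd rfl hq
  | cons i q =>
    obtain ⟨n, f, ts, j, rfl, -, -⟩ := subtermAt_cons_eq_some.1 hs
    exact ⟨n, f, ts, hu⟩

theorem IsFunPos.isPos {t : L.Term X} {p : List ℕ} (h : IsFunPos t p) : IsPos t p := by
  obtain ⟨n, f, ts, h⟩ := h
  exact ⟨_, h⟩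

theorem IsVarPos.not_isFunPos {t : L.Term X} {p : List ℕ} {y : X} (h : IsVarPos t y p) :
    ¬ IsFunPos t p := by
  rintro ⟨n, f, ts, h'⟩
  rw [IsVarPos, h'] at h
  simp at h

theorem IsVarPos.unique {t : L.Term X} {p : List ℕ} {y z : X} (h : IsVarPos t y p)
    (h' : IsVarPos t z p) : y = z := by
  rw [IsVarPos, h] at h'
  simpa using h'

theorem IsVarPos.eq_nil_of_append {t s : L.Term X} {p q : List ℕ} {y : X} (h : IsVarPos t y p)
    (h' : subtermAt t (p ++ q) = some s) : q = [] := by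
  by_contra hq
  exact h.not_isFunPos (isFunPos_of_subtermAt_append hq h')

theorem finite_positions (t : L.Term X) : {p | IsPos t p}.Finite := by
  induction t with
  | var y =>
    refine (Set.finite_singleton []).subset ?_
    rintro p ⟨s, h⟩
    exact (subtermAt_var_eq_some.1 h).1
  | @func n f ts ih =>
    refine ((Set.finite_singleton []).union
      (Set.finite_iUnion fun i : Fin n => (ih i).image fun p => (i : ℕ) :: p)).subset ?_
    rintro p ⟨s, h⟩
    cases p with
    | nil => exact Or.inl rfl
    | cons i p =>
      obtain ⟨m, g, us, j, hu, rfl, h⟩ := subtermAt_cons_eq_some.1 h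
      cases hu
      exact Or.inr (Set.mem_iUnion.2 ⟨j, p, ⟨s, h⟩, rfl⟩)

theorem vars_finite (t : L.Term X) : (vars t).Finite := by
  have h : (vars t).Finite := by
    refine Set.Finite.subset (((finite_positions t).image (subtermAt t)).preimage
      (f := fun y : X => some (Term.var y)) ?_) ?_
    · intro a _ b _ hab
      simpa using hab
    · rintro y ⟨p, hp⟩
      exact ⟨p, ⟨_, hp⟩, hp⟩
  exact h

theorem vars_subset_of_subtermAt {t u : L.Term X} {p : List ℕ} (h : subtermAt t p = some u) :
    vars u ⊆ vars t := by
  rintro y ⟨q, hq⟩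
  exact ⟨p ++ q, (isVarPos_append h).2 hq⟩

@[simp] theorem mem_vars_var {y z : X} : y ∈ vars (Term.var z : L.Term X) ↔ y = z := by
  simp [vars, isVarPos_var]

theorem mem_vars_func {n : ℕ} {f : L.Functions n} {ts : Fin n → L.Term X} {y : X} :
    y ∈ vars (Term.func f ts) ↔ ∃ i, y ∈ vars (ts i) := by
  constructor
  · rintro ⟨p, hp⟩
    cases p with
    | nil => simp at hp
    | cons i p =>
      obtain ⟨m, g, us, j, hu, rfl, h⟩ := subtermAt_cons_eq_some.1 hp
      cases hu
      exact ⟨j, p, h⟩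
  · rintro ⟨i, p, hp⟩
    exact ⟨i :: p, by simpa using hp⟩

/-! ### Replacement -/

@[simp] theorem replaceAt_nil (t s : L.Term X) : replaceAt t [] s = s := by
  cases t <;> rfl

theorem replaceAt_func_fin {n : ℕ} (f : L.Functions n) (ts : Fin n → L.Term X) (i : Fin n)
    (p : List ℕ) (s : L.Term X) : replaceAt (Term.func f ts) (i :: p) s =
      Term.func f (Function.update ts i (replaceAt (ts i) p s)) := by
  simp only [replaceAt]
  congr 1
  funext j
  by_cases h : j = i
  · subst h; simp
  · simp [h, Fin.val_inj]

theorem subtermAt_replaceAt_append {t : L.Term X} {p : List ℕ} (h : IsPos t p) (s : L.Term X)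
    (q : List ℕ) : subtermAt (replaceAt t p s) (p ++ q) = subtermAt s q := by
  obtain ⟨u, h⟩ := h
  induction p generalizing t with
  | nil => simp
  | cons i p ih =>
    obtain ⟨n, f, ts, j, rfl, rfl, h₁⟩ := subtermAt_cons_eq_some.1 h
    rw [replaceAt_func_fin, List.cons_append, subtermAt_func_fin, Function.update_self]
    exact ih h₁

theorem subtermAt_replaceAt {t : L.Term X} {p : List ℕ} (h : IsPos t p) (s : L.Term X) :
    subtermAt (replaceAt t p s) p = some s := by
  simpa using subtermAt_replaceAt_append h s []

theorem replaceAt_self {t u : L.Term X} {p : List ℕ} (h : subtermAt t p = some u) :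
    replaceAt t p u = t := by
  induction p generalizing t with
  | nil => simpa [eq_comm] using h
  | cons i p ih =>
    obtain ⟨n, f, ts, j, rfl, rfl, h₁⟩ := subtermAt_cons_eq_some.1 h
    rw [replaceAt_func_fin, ih h₁, Function.update_eq_self]

theorem replaceAt_replaceAt (t s s' : L.Term X) (p : List ℕ) :
    replaceAt (replaceAt t p s) p s' = replaceAt t p s' := by
  induction t generalizing p with
  | var y => cases p <;> simp [replaceAt]
  | @func n f ts ih =>
    cases p with
    | nil => simp
    | cons i p =>
      simp only [replaceAt]
      congr 1
      funext j
      split <;> simp [ih]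

theorem replaceAt_append {t u : L.Term X} {p : List ℕ} (h : subtermAt t p = some u)
    (q : List ℕ) (s : L.Term X) :
    replaceAt t (p ++ q) s = replaceAt t p (replaceAt u q s) := by
  induction p generalizing t with
  | nil => simp only [subtermAt_nil, Option.some.injEq] at h; simp [h]
  | cons i p ih =>
    obtain ⟨n, f, ts, j, rfl, rfl, h₁⟩ := subtermAt_cons_eq_some.1 h
    rw [List.cons_append, replaceAt_func_fin, replaceAt_func_fin, ih h₁]

/-- Replacing at `p` leaves the subterms at those positions alone that are not below `p`, provided
that they are leaves. -/
theorem subtermAt_replaceAt_of_var {t s : L.Term X} {p q : List ℕ} {y : X}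
    (hp : IsPos t p) (hq : IsVarPos (replaceAt t p s) y q) :
    (∃ r, q = p ++ r ∧ IsVarPos s y r) ∨
      (IsVarPos t y q ∧ ∀ t' s' : L.Term X, IsPos t' p →
        subtermAt (replaceAt t' p s') q = subtermAt t' q) := by
  obtain ⟨u, hp⟩ := hp
  induction p generalizing t q with
  | nil => exact Or.inl ⟨q, rfl, by simpa using hq⟩
  | cons i p ih =>
    obtain ⟨n, f, ts, j, rfl, rfl, h⟩ := subtermAt_cons_eq_some.1 hp
    rw [replaceAt_func_fin] at hq
    cases q with
    | nil => simp at hq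
    | cons k q =>
      obtain ⟨m, g, us, l, hu, rfl, hq⟩ := subtermAt_cons_eq_some.1 hq
      cases hu
      by_cases hl : l = j
      · subst hl
        rw [Function.update_self] at hq
        rcases ih hq h with ⟨r, rfl, hr⟩ | ⟨h1, h2⟩
        · exact Or.inl ⟨r, rfl, hr⟩
        · refine Or.inr ⟨by simpa using h1, ?_⟩
          rintro t' s' ⟨u', hu'⟩
          obtain ⟨m', f', ts', j', rfl, hj, h'⟩ := subtermAt_cons_eq_some.1 hu'
          rw [hj, replaceAt_func_fin, subtermAt_func_fin, subtermAt_func_fin, Function.update_self]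
          exact h2 _ _ ⟨_, h'⟩
      · rw [Function.update_of_ne hl] at hq
        refine Or.inr ⟨by simpa [IsVarPos] using hq, ?_⟩
        rintro t' s' ⟨u', hu'⟩
        obtain ⟨m', f', ts', j', rfl, hj, h'⟩ := subtermAt_cons_eq_some.1 hu'
        rw [hj, replaceAt_func_fin, subtermAt_func_cons, subtermAt_func_cons]
        split
        · rw [Function.update_of_ne]
          intro hc
          rw [← hc] at hj
          exact hl (Fin.ext hj.symm)
        · rfl

/-! ### Positional substitutions -/

/-- Replace every variable `y` at a position `p` by `φ p y`. -/
def psubst : L.Term X → (List ℕ → X → L.Term Y) → L.Term Y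
  | Term.var y, φ => φ [] y
  | Term.func f ts, φ => Term.func f fun i => psubst (ts i) fun p => φ (i :: p)

theorem psubst_congr {t : L.Term X} {φ ψ : List ℕ → X → L.Term Y}
    (h : ∀ p y, IsVarPos t y p → φ p y = ψ p y) : psubst t φ = psubst t ψ := by
  induction t generalizing φ ψ with
  | var y => exact h [] y (by simp [IsVarPos])
  | func f ts ih =>
    simp only [psubst]
    congr 1
    funext i
    exact ih i fun p y hp => h _ _ (by simpa using hp)

theorem subst_eq_psubst (t : L.Term X) (σ : X → L.Term Y) :
    t.subst σ = psubst t fun _ => σ := by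
  induction t with
  | var y => rfl
  | func f ts ih => simp only [Term.subst, psubst, ih]

theorem psubst_id (t : L.Term X) : (psubst t fun _ => Term.var) = t := by
  induction t with
  | var y => rfl
  | func f ts ih => simp only [psubst, ih]

theorem subst_psubst (t : L.Term X) (φ : List ℕ → X → L.Term Y) (σ : Y → L.Term Z) :
    (psubst t φ).subst σ = psubst t fun p y => (φ p y).subst σ := by
  induction t generalizing φ with
  | var y => rfl
  | func f ts ih => simp only [Term.subst, psubst, ih]

theorem psubst_psubst_subst (t : L.Term X) (σ : X → L.Term Y) (τ : Y → L.Term Z) :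
    (t.subst σ).subst τ = t.subst fun y => (σ y).subst τ := by
  rw [subst_eq_psubst t, subst_psubst, subst_eq_psubst]

theorem subst_congr {t : L.Term X} {σ τ : X → L.Term Y} (h : ∀ y ∈ vars t, σ y = τ y) :
    t.subst σ = t.subst τ := by
  rw [subst_eq_psubst, subst_eq_psubst]
  exact psubst_congr fun p y hp => h y ⟨p, hp⟩

theorem subst_eq_self {t : L.Term X} {σ : X → L.Term X} (h : ∀ y ∈ vars t, σ y = Term.var y) :
    t.subst σ = t := by
  conv_rhs => rw [← psubst_id t]
  rw [subst_eq_psubst]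
  exact psubst_congr fun p y hp => h y ⟨p, hp⟩

theorem relabel_eq_subst (t : L.Term X) (g : X → Y) :
    t.relabel g = t.subst fun y => Term.var (g y) := by
  induction t with
  | var y => rfl
  | func f ts ih => simp only [Term.relabel, Term.subst, ih]

theorem subtermAt_psubst {t u : L.Term X} {p : List ℕ} (h : subtermAt t p = some u)
    (φ : List ℕ → X → L.Term Y) :
    subtermAt (psubst t φ) p = some (psubst u fun q => φ (p ++ q)) := by
  induction p generalizing t φ with
  | nil =>
    simp only [subtermAt_nil, Option.some.injEq] at h
    simp [h]
  | cons i p ih =>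
    obtain ⟨n, f, ts, j, rfl, rfl, h₁⟩ := subtermAt_cons_eq_some.1 h
    simpa [psubst] using ih h₁ _

theorem subtermAt_psubst_var {t : L.Term X} {p : List ℕ} {y : X} (h : IsVarPos t y p)
    (φ : List ℕ → X → L.Term Y) : subtermAt (psubst t φ) p = some (φ p y) := by
  rw [subtermAt_psubst h]
  simp [psubst]

theorem subtermAt_subst {t u : L.Term X} {p : List ℕ} (h : subtermAt t p = some u)
    (σ : X → L.Term Y) : subtermAt (t.subst σ) p = some (u.subst σ) := by
  rw [subst_eq_psubst, subst_eq_psubst, subtermAt_psubst h]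

theorem subtermAt_psubst_eq_some {t : L.Term X} {p : List ℕ} {φ : List ℕ → X → L.Term Y}
    {u : L.Term Y} (h : subtermAt (psubst t φ) p = some u) :
    IsFunPos t p ∨ ∃ q r z, p = q ++ r ∧ IsVarPos t z q ∧ subtermAt (φ q z) r = some u := by
  induction t generalizing p φ with
  | var y => exact Or.inr ⟨[], p, y, rfl, by simp [IsVarPos], h⟩
  | func f ts ih =>
    cases p with
    | nil => exact Or.inl (by simp)
    | cons i p =>
      obtain ⟨m, g, us, l, hu, rfl, hq⟩ := subtermAt_cons_eq_some.1 h
      cases hu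
      rcases ih l hq with h | ⟨q, r, z, rfl, hz, h⟩
      · exact Or.inl (by simpa using h)
      · exact Or.inr ⟨l :: q, r, z, rfl, by simpa using hz, h⟩

theorem isVarPos_psubst {t : L.Term X} {p : List ℕ} {φ : List ℕ → X → L.Term Y} {y : Y} :
    IsVarPos (psubst t φ) y p ↔
      ∃ q r z, p = q ++ r ∧ IsVarPos t z q ∧ IsVarPos (φ q z) y r := by
  constructor
  · intro h
    rcases subtermAt_psubst_eq_some h with ⟨n, f, ts, h'⟩ | h'
    · rw [IsVarPos, subtermAt_psubst h'] at h
      simp [psubst] at h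
    · exact h'
  · rintro ⟨q, r, z, rfl, hz, h⟩
    exact (isVarPos_append (subtermAt_psubst_var hz φ)).2 h

theorem isVarPos_subst {t : L.Term X} {p : List ℕ} {σ : X → L.Term Y} {y : Y} :
    IsVarPos (t.subst σ) y p ↔ ∃ q r z, p = q ++ r ∧ IsVarPos t z q ∧ IsVarPos (σ z) y r := by
  rw [subst_eq_psubst, isVarPos_psubst]

theorem mem_vars_psubst {t : L.Term X} {φ : List ℕ → X → L.Term Y} {y : Y} :
    y ∈ vars (psubst t φ) ↔ ∃ q z, IsVarPos t z q ∧ y ∈ vars (φ q z) := by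
  simp only [vars, Set.mem_ofPred_eq, isVarPos_psubst]
  constructor
  · rintro ⟨p, q, r, z, rfl, hz, h⟩
    exact ⟨q, z, hz, r, h⟩
  · rintro ⟨q, z, hz, r, h⟩
    exact ⟨_, q, r, z, rfl, hz, h⟩

theorem mem_vars_subst {t : L.Term X} {σ : X → L.Term Y} {y : Y} :
    y ∈ vars (t.subst σ) ↔ ∃ z ∈ vars t, y ∈ vars (σ z) := by
  rw [subst_eq_psubst, mem_vars_psubst]
  constructor
  · rintro ⟨q, z, hz, h⟩
    exact ⟨z, ⟨q, hz⟩, h⟩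
  · rintro ⟨z, ⟨q, hz⟩, h⟩
    exact ⟨q, z, hz, h⟩

theorem psubst_inj {t : L.Term X} {φ ψ : List ℕ → X → L.Term Y} (h : psubst t φ = psubst t ψ)
    {p : List ℕ} {y : X} (hp : IsVarPos t y p) : φ p y = ψ p y := by
  have := subtermAt_psubst_var hp φ
  rw [h, subtermAt_psubst_var hp ψ] at this
  exact (Option.some.inj this).symm

theorem subst_inj_on_vars {t : L.Term X} {σ τ : X → L.Term Y} (h : t.subst σ = t.subst τ)
    {y : X} (hy : y ∈ vars t) : σ y = τ y := by
  rw [subst_eq_psubst, subst_eq_psubst] at h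
  obtain ⟨p, hp⟩ := hy
  exact psubst_inj h hp

theorem psubst_replaceAt {t : L.Term X} {p : List ℕ} (h : IsPos t p) (s : L.Term X)
    (φ : List ℕ → X → L.Term Y) :
    psubst (replaceAt t p s) φ =
      replaceAt (psubst t φ) p (psubst s fun q => φ (p ++ q)) := by
  obtain ⟨u, h⟩ := h
  induction p generalizing t φ with
  | nil => simp
  | cons i p ih =>
    obtain ⟨n, f, ts, j, rfl, rfl, h₁⟩ := subtermAt_cons_eq_some.1 h
    rw [replaceAt_func_fin, psubst, psubst, replaceAt_func_fin]
    congr 1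
    funext k
    by_cases hk : k = j
    · subst hk
      simpa using ih _ h₁
    · simp [Function.update_of_ne hk]

theorem subst_replaceAt {t : L.Term X} {p : List ℕ} (h : IsPos t p) (s : L.Term X)
    (σ : X → L.Term Y) :
    (replaceAt t p s).subst σ = replaceAt (t.subst σ) p (s.subst σ) := by
  simp only [subst_eq_psubst, psubst_replaceAt h]

/-- Replacing a variable at a single position, as a positional substitution. -/
theorem replaceAt_psubst_var {t : L.Term X} {p : List ℕ} {y : X} (hp : IsVarPos t y p)
    (φ : List ℕ → X → L.Term Y) (s : L.Term Y) :
    replaceAt (psubst t φ) p s = psubst t fun q z => if q = p then s else φ q z := by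
  induction p generalizing t φ with
  | nil =>
    cases t with
    | var z => simp [psubst]
    | func f ts => simp at hp
  | cons i p ih =>
    obtain ⟨n, f, ts, j, rfl, rfl, h₁⟩ := subtermAt_cons_eq_some.1 hp
    rw [psubst, replaceAt_func_fin, psubst]
    congr 1
    funext k
    by_cases hk : k = j
    · subst hk
      simpa using ih h₁ _
    · rw [Function.update_of_ne hk]
      refine psubst_congr fun q z _ => ?_
      simp [Fin.val_inj, hk]

/-! ### Rewrite steps -/

theorem StepAt.subst {ρ : L.Term V × L.Term V} {p : List ℕ} {s t : L.Term X}
    (h : StepAt ρ p s t) (τ : X → L.Term Y) : StepAt ρ p (s.subst τ) (t.subst τ) := by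
  obtain ⟨σ, h, rfl⟩ := h
  refine ⟨fun y => (σ y).subst τ, ?_, ?_⟩
  · rw [subtermAt_subst h, psubst_psubst_subst]
  · rw [subst_replaceAt ⟨_, h⟩, psubst_psubst_subst]

theorem StepAt.append {ρ : L.Term V × L.Term V} {p q : List ℕ} {s t a : L.Term X}
    (hs : subtermAt s p = some a) :
    StepAt ρ (p ++ q) s t ↔ ∃ a', StepAt ρ q a a' ∧ t = replaceAt s p a' := by
  constructor
  · rintro ⟨σ, h, rfl⟩
    rw [subtermAt_append_of_eq hs] at h
    exact ⟨_, ⟨σ, h, rfl⟩, replaceAt_append hs _ _⟩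
  · rintro ⟨a', ⟨σ, h, rfl⟩, rfl⟩
    exact ⟨σ, by rw [subtermAt_append_of_eq hs, h], (replaceAt_append hs _ _).symm⟩

theorem Step.subst {S : Set (L.Term V × L.Term V)} {s t : L.Term X} (h : Step S s t)
    (τ : X → L.Term Y) : Step S (s.subst τ) (t.subst τ) := by
  obtain ⟨ρ, hρ, p, h⟩ := h
  exact ⟨ρ, hρ, p, h.subst τ⟩

theorem Step.replaceAt {S : Set (L.Term V × L.Term V)} {s a a' : L.Term X} {p : List ℕ}
    (hs : subtermAt s p = some a) (h : Step S a a') : Step S s (replaceAt s p a') := by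
  obtain ⟨ρ, hρ, q, h⟩ := h
  exact ⟨ρ, hρ, p ++ q, (StepAt.append hs).2 ⟨a', h, rfl⟩⟩

open Relation in
theorem rtc_subst {S : Set (L.Term V × L.Term V)} {s t : L.Term X}
    (h : ReflTransGen (Step S) s t) (τ : X → L.Term Y) :
    ReflTransGen (Step S) (s.subst τ) (t.subst τ) := by
  induction h with
  | refl => exact .refl
  | tail _ h ih => exact ih.tail (h.subst τ)

open Relation in
theorem rtc_func {S : Set (L.Term V × L.Term V)} {n : ℕ} (f : L.Functions n)
    {ss ts : Fin n → L.Term X} (h : ∀ i, ReflTransGen (Step S) (ss i) (ts i)) :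
    ReflTransGen (Step S) (Term.func f ss) (Term.func f ts) := by
  have key : ∀ I : Finset (Fin n), ReflTransGen (Step S) (Term.func f ss)
      (Term.func f fun i => if i ∈ I then ts i else ss i) := by
    intro I
    induction I using Finset.induction with
    | empty => simpa using ReflTransGen.refl
    | insert a I ha ih =>
      refine ih.trans ?_
      have h1 : ∀ u, ReflTransGen (Step S) (ss a) u → ReflTransGen (Step S)
          (Term.func f fun i => if i ∈ I then ts i else ss i)
          (Term.func f (Function.update (fun i => if i ∈ I then ts i else ss i) a u)) := by
        intro u hu
        induction hu with
        | refl =>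
          rw [Function.update_eq_self_iff.2 (by simp [ha])]
        | tail _ h2 ih =>
          refine ih.tail ?_
          have := Step.replaceAt (s := Term.func f (Function.update
            (fun i => if i ∈ I then ts i else ss i) a _)) (p := [(a : ℕ)]) (by simp; rfl) h2
          rwa [replaceAt_func_fin, replaceAt_nil, Function.update_idem] at this
      convert h1 _ (h a) using 3 with i
      by_cases hi : i = a
      · subst hi; simp
      · simp [hi]
  simpa using key Finset.univ

open Relation in
theorem rtc_psubst {S : Set (L.Term V × L.Term V)} (t : L.Term X) {φ ψ : List ℕ → X → L.Term Y}
    (h : ∀ p y, IsVarPos t y p → ReflTransGen (Step S) (φ p y) (ψ p y)) :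
    ReflTransGen (Step S) (psubst t φ) (psubst t ψ) := by
  induction t generalizing φ ψ with
  | var y => exact h [] y (by simp [IsVarPos])
  | func f ts ih =>
    exact rtc_func f fun i => ih i fun p y hp => h _ _ (by simpa using hp)

open Relation in
theorem rtc_subst_right {S : Set (L.Term V × L.Term V)} (t : L.Term X) {σ τ : X → L.Term Y}
    (h : ∀ y ∈ vars t, ReflTransGen (Step S) (σ y) (τ y)) :
    ReflTransGen (Step S) (t.subst σ) (t.subst τ) := by
  rw [subst_eq_psubst, subst_eq_psubst]
  exact rtc_psubst t fun p y hp => h y ⟨p, hp⟩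

theorem TRS.vars_subset_of_rel {R : TRS L V} {s t : L.Term X} (h : Step R.rules s t) :
    vars t ⊆ vars s := by
  obtain ⟨ρ, hρ, p, σ, h, rfl⟩ := h
  rintro y ⟨q, hq⟩
  rcases subtermAt_replaceAt_of_var ⟨_, h⟩ hq with ⟨r, -, hr⟩ | ⟨hq', -⟩
  · obtain ⟨z, hz, hy⟩ := mem_vars_subst.1 ⟨r, hr⟩
    exact vars_subset_of_subtermAt h (mem_vars_subst.2 ⟨z, R.vars_rhs_subset ρ hρ hz, hy⟩)
  · exact ⟨q, hq'⟩

open Relation in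
theorem TRS.vars_subset_of_rtc {R : TRS L V} {s t : L.Term X}
    (h : ReflTransGen (Step R.rules) s t) : vars t ⊆ vars s := by
  induction h with
  | refl => exact subset_rfl
  | tail _ h ih => exact (TRS.vars_subset_of_rel h).trans ih

theorem TRS.isFunPos_lhs {R : TRS L V} {ρ : L.Term V × L.Term V} (hρ : ρ ∈ R.rules) :
    ∃ (n : ℕ) (f : L.Functions n) (ts : Fin n → L.Term V), ρ.1 = Term.func f ts := by
  cases h : ρ.1 with
  | var y => exact absurd h (R.lhs_ne_var ρ hρ y)
  | func f ts => exact ⟨_, f, ts, rfl⟩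

theorem TRS.isFunPos_of_stepAt {R : TRS L V} {ρ : L.Term V × L.Term V} (hρ : ρ ∈ R.rules)
    {p : List ℕ} {s t : L.Term X} (h : StepAt ρ p s t) : IsFunPos s p := by
  obtain ⟨σ, h, -⟩ := h
  obtain ⟨n, f, ts, hl⟩ := TRS.isFunPos_lhs hρ
  rw [hl] at h
  exact ⟨n, f, _, h⟩

end LayerSystems

namespace LayerSystems

variable {L : FirstOrder.Language.{u, v}} {V : Type w} {X Y Z : Type*}

/-! ### The order on contexts -/

theorem hole_le (C : Ctx L V) : (hole : Ctx L V) ≤ C := Ctx.Le.hole C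

theorem func_le_iff {n : ℕ} {f : L.Functions n} {Cs : Fin n → Ctx L V} {D : Ctx L V} :
    (Term.func f Cs : Ctx L V) ≤ D ↔ ∃ Ds : Fin n → Ctx L V, D = Term.func f Ds ∧ ∀ i, Cs i ≤ Ds i := by
  constructor
  · intro h
    cases h with
    | func _ _ Ds h => exact ⟨Ds, rfl, h⟩
  · rintro ⟨Ds, rfl, h⟩
    exact Ctx.Le.func f Cs Ds h

theorem le_func_iff {n : ℕ} {f : L.Functions n} {Ds : Fin n → Ctx L V} {C : Ctx L V} :
    C ≤ (Term.func f Ds : Ctx L V) ↔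
      C = hole ∨ ∃ Cs : Fin n → Ctx L V, C = Term.func f Cs ∧ ∀ i, Cs i ≤ Ds i := by
  constructor
  · intro h
    cases h with
    | hole => exact Or.inl rfl
    | func _ Cs _ h => exact Or.inr ⟨Cs, rfl, h⟩
  · rintro (rfl | ⟨Cs, rfl, h⟩)
    · exact hole_le _
    · exact Ctx.Le.func f Cs Ds h

theorem func_le_func_iff {n : ℕ} {f : L.Functions n} {Cs Ds : Fin n → Ctx L V} :
    (Term.func f Cs : Ctx L V) ≤ Term.func f Ds ↔ ∀ i, Cs i ≤ Ds i := by
  rw [func_le_iff]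
  constructor
  · rintro ⟨Es, h, h'⟩
    cases h
    exact h'
  · exact fun h => ⟨Ds, rfl, h⟩

theorem le_hole_iff {C : Ctx L V} : C ≤ hole ↔ C = hole := by
  constructor
  · intro h
    exact le_antisymm h (hole_le C)
  · rintro rfl
    exact le_rfl

theorem le_ctxVar_iff {C : Ctx L V} {y : V} : C ≤ ctxVar y ↔ C = hole ∨ C = ctxVar y := by
  constructor
  · intro h
    cases h with
    | hole => exact Or.inl rfl
    | var => exact Or.inr rfl
  · rintro (rfl | rfl)
    · exact hole_le _
    · exact le_rfl

theorem ctxVar_le_iff {C : Ctx L V} {y : V} : ctxVar y ≤ C ↔ C = ctxVar y := by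
  constructor
  · intro h
    cases h with
    | var => rfl
  · rintro rfl
    exact le_rfl

theorem ctxVar_ne_hole (y : V) : (ctxVar y : Ctx L V) ≠ hole := by
  simp [ctxVar, hole]

theorem func_ne_hole {n : ℕ} (f : L.Functions n) (Cs : Fin n → Ctx L V) :
    (Term.func f Cs : Ctx L V) ≠ hole := by
  simp [hole]

theorem ctx_cases (C : Ctx L V) : C = hole ∨ (∃ y, C = ctxVar y) ∨
    ∃ (n : ℕ) (f : L.Functions n) (Cs : Fin n → Ctx L V), C = Term.func f Cs := by
  cases C with
  | var y =>
    cases y with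
    | none => exact Or.inl rfl
    | some y => exact Or.inr (Or.inl ⟨y, rfl⟩)
  | func f Cs => exact Or.inr (Or.inr ⟨_, f, Cs, rfl⟩)

theorem subtermAt_mono {C D C' : Ctx L V} {p : List ℕ} (h : C ≤ D)
    (hC : subtermAt C p = some C') : ∃ D', subtermAt D p = some D' ∧ C' ≤ D' := by
  induction p generalizing C D with
  | nil =>
    simp only [subtermAt_nil, Option.some.injEq] at hC
    subst hC
    exact ⟨D, by simp, h⟩
  | cons i p ih =>
    obtain ⟨n, f, ts, j, rfl, rfl, h₁⟩ := subtermAt_cons_eq_some.1 hC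
    obtain ⟨Ds, rfl, hD⟩ := func_le_iff.1 h
    simpa using ih (hD j) h₁

theorem subtermAt_le_subtermAt {C D C' D' : Ctx L V} {p : List ℕ} (h : C ≤ D)
    (hC : subtermAt C p = some C') (hD : subtermAt D p = some D') : C' ≤ D' := by
  obtain ⟨E, hE, hle⟩ := subtermAt_mono h hC
  rw [hD] at hE
  cases hE
  exact hle

theorem IsFunPos.mono {C D : Ctx L V} {p : List ℕ} (h : C ≤ D) (hC : IsFunPos C p) :
    IsFunPos D p := by
  obtain ⟨n, f, Cs, hC⟩ := hC
  obtain ⟨D', hD, hle⟩ := subtermAt_mono h hC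
  obtain ⟨Ds, rfl, -⟩ := func_le_iff.1 hle
  exact ⟨n, f, Ds, hD⟩

theorem IsPos.mono {C D : Ctx L V} {p : List ℕ} (h : C ≤ D) (hC : IsPos C p) : IsPos D p := by
  obtain ⟨C', hC⟩ := hC
  obtain ⟨D', hD, -⟩ := subtermAt_mono h hC
  exact ⟨D', hD⟩

theorem replaceAt_mono {C D E F : Ctx L V} {p : List ℕ} (h : C ≤ D) (hp : IsPos C p)
    (hEF : E ≤ F) : replaceAt C p E ≤ replaceAt D p F := by
  obtain ⟨C', hC⟩ := hp
  induction p generalizing C D with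
  | nil => simpa using hEF
  | cons i p ih =>
    obtain ⟨n, f, ts, j, rfl, rfl, h₁⟩ := subtermAt_cons_eq_some.1 hC
    obtain ⟨Ds, rfl, hD⟩ := func_le_iff.1 h
    rw [replaceAt_func_fin, replaceAt_func_fin, func_le_func_iff]
    intro k
    by_cases hk : k = j
    · subst hk
      simpa using ih (hD k) h₁
    · simpa [Function.update_of_ne hk] using hD k

theorem replaceAt_le {C D D' E : Ctx L V} {p : List ℕ} (hp : IsPos C p)
    (h : replaceAt C p hole ≤ D) (hD : subtermAt D p = some D') (hE : E ≤ D') :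
    replaceAt C p E ≤ D := by
  rw [← replaceAt_replaceAt C hole E p, ← replaceAt_self hD]
  exact replaceAt_mono h ⟨_, subtermAt_replaceAt hp _⟩ hE

theorem replaceAt_hole_le {C : Ctx L V} {p : List ℕ} (hp : IsPos C p) :
    replaceAt C p hole ≤ C := by
  obtain ⟨C', hC⟩ := hp
  conv_rhs => rw [← replaceAt_self hC]
  exact replaceAt_mono le_rfl ⟨_, hC⟩ (hole_le _)

theorem le_replaceAt_of_hole {C D : Ctx L V} {p : List ℕ} (h : C ≤ D)
    (hp : subtermAt C p = some hole) (E : Ctx L V) : C ≤ replaceAt D p E := by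
  conv_lhs => rw [← replaceAt_self hp]
  exact replaceAt_mono h ⟨_, hp⟩ (hole_le _)

/-- A position of a larger context is a position of the smaller one, or it lies below a hole. -/
theorem hole_above {C D D' : Ctx L V} {p : List ℕ} (h : C ≤ D)
    (hD : subtermAt D p = some D') : IsFunPos C p ∨
      (∃ y, D' = ctxVar y ∧ subtermAt C p = some (ctxVar y)) ∨
      ∃ q r, p = q ++ r ∧ subtermAt C q = some hole := by
  induction p generalizing C D with
  | nil =>
    simp only [subtermAt_nil, Option.some.injEq] at hD
    subst hD
    rcases ctx_cases C with rfl | ⟨y, rfl⟩ | ⟨n, f, Cs, rfl⟩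
    · exact Or.inr (Or.inr ⟨[], [], rfl, by simp⟩)
    · exact Or.inr (Or.inl ⟨y, ctxVar_le_iff.1 h, by simp⟩)
    · exact Or.inl (by simp)
  | cons i p ih =>
    obtain ⟨n, f, ts, j, rfl, rfl, h₁⟩ := subtermAt_cons_eq_some.1 hD
    rcases le_func_iff.1 h with rfl | ⟨Cs, rfl, hC⟩
    · exact Or.inr (Or.inr ⟨[], _, rfl, by simp⟩)
    · rcases ih (hC j) h₁ with h | ⟨y, hy, h⟩ | ⟨q, r, rfl, h⟩
      · exact Or.inl (by simpa using h)
      · exact Or.inr (Or.inl ⟨y, hy, by simpa using h⟩)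
      · exact Or.inr (Or.inr ⟨j :: q, r, rfl, by simpa using h⟩)

theorem hole_above_of_hole {C D : Ctx L V} {p : List ℕ} (h : C ≤ D)
    (hD : subtermAt D p = some hole) : ∃ q r, p = q ++ r ∧ subtermAt C q = some hole := by
  rcases hole_above h hD with h' | ⟨y, hy, -⟩ | h'
  · obtain ⟨n, f, ts, hf⟩ := h'.mono h
    rw [hD] at hf
    simp [hole] at hf
  · exact absurd hy.symm (ctxVar_ne_hole y)
  · exact h'

/-- Used for the existence of maximal tops: a context below `D` arises by cutting `D` at some
positions. -/
theorem finite_le (D : Ctx L V) : {C | C ≤ D}.Finite := by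
  induction D with
  | var y =>
    refine (Set.toFinite {hole, Term.var y}).subset ?_
    intro C hC
    cases y with
    | none => exact Or.inl (le_hole_iff.1 hC)
    | some y => exact le_ctxVar_iff.1 hC
  | func f Ds ih =>
    refine ((Set.finite_singleton hole).union
      ((Set.Finite.pi fun i => ih i).image (Term.func f))).subset ?_
    intro C hC
    rcases le_func_iff.1 hC with rfl | ⟨Cs, rfl, hCs⟩
    · exact Or.inl rfl
    · exact Or.inr ⟨Cs, fun i _ => hCs i, rfl⟩

/-! ### Terms as contexts -/

theorem toCtx_eq_subst (t : L.Term V) : toCtx t = t.subst ctxVar := relabel_eq_subst t some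

@[simp] theorem toCtx_var (y : V) : toCtx (Term.var y : L.Term V) = ctxVar y := rfl

@[simp] theorem toCtx_func {n : ℕ} (f : L.Functions n) (ts : Fin n → L.Term V) :
    toCtx (Term.func f ts) = Term.func f fun i => toCtx (ts i) := rfl

theorem toCtx_ne_hole (t : L.Term V) : toCtx t ≠ hole := by
  cases t with
  | var y => exact ctxVar_ne_hole y
  | func f ts => exact func_ne_hole _ _

theorem toCtx_injective : Function.Injective (toCtx : L.Term V → Ctx L V) := by
  intro s t h
  induction s generalizing t with
  | var y =>
    cases t with
    | var z => simpa [ctxVar] using h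
    | func f ts => simp [ctxVar] at h
  | func f ss ih =>
    cases t with
    | var z => simp [ctxVar] at h
    | func g ts =>
      simp only [toCtx_func, Term.func.injEq] at h
      obtain ⟨rfl, h1, h2⟩ := h
      cases h1
      congr 1
      funext i
      exact ih i (congrFun (eq_of_heq h2) i)

theorem subtermAt_toCtx {t u : L.Term V} {p : List ℕ} (h : subtermAt t p = some u) :
    subtermAt (toCtx t) p = some (toCtx u) := by
  rw [toCtx_eq_subst, toCtx_eq_subst, subtermAt_subst h]

theorem subtermAt_toCtx_eq_some {t : L.Term V} {p : List ℕ} {C : Ctx L V} :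
    subtermAt (toCtx t) p = some C ↔ ∃ u, subtermAt t p = some u ∧ C = toCtx u := by
  constructor
  · intro h
    have h' := h
    rw [toCtx_eq_subst, subst_eq_psubst] at h'
    rcases subtermAt_psubst_eq_some h' with ⟨n, f, ts, h'⟩ | ⟨q, r, z, rfl, hz, h'⟩
    · rw [subtermAt_toCtx h'] at h
      exact ⟨_, h', (Option.some.inj h).symm⟩
    · obtain ⟨rfl, rfl⟩ := subtermAt_var_eq_some.1 h'
      exact ⟨_, by simpa [IsVarPos] using hz, rfl⟩
  · rintro ⟨u, h, rfl⟩
    exact subtermAt_toCtx h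

theorem isPos_toCtx {t : L.Term V} {p : List ℕ} : IsPos (toCtx t) p ↔ IsPos t p := by
  constructor
  · rintro ⟨C, h⟩
    obtain ⟨u, h, -⟩ := subtermAt_toCtx_eq_some.1 h
    exact ⟨u, h⟩
  · rintro ⟨u, h⟩
    exact ⟨_, subtermAt_toCtx h⟩

theorem isVarPos_toCtx {t : L.Term V} {p : List ℕ} {y : V} :
    IsVarPos (toCtx t) (some y) p ↔ IsVarPos t y p := by
  constructor
  · intro h
    obtain ⟨u, h, hu⟩ := subtermAt_toCtx_eq_some.1 h
    rw [IsVarPos, h, toCtx_injective (a₁ := u) (a₂ := Term.var y) hu.symm]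
  · exact fun h => subtermAt_toCtx h

theorem toCtx_subst (t : L.Term V) (σ : V → L.Term V) :
    toCtx (t.subst σ) = t.subst fun y => toCtx (σ y) := by
  simp only [toCtx_eq_subst, psubst_psubst_subst]

theorem toCtx_replaceAt {t : L.Term V} {p : List ℕ} (h : IsPos t p) (s : L.Term V) :
    toCtx (replaceAt t p s) = replaceAt (toCtx t) p (toCtx s) := by
  simp only [toCtx_eq_subst, subst_replaceAt h]

/-! ### Contexts that fit onto a term -/

/-- `Fits P M t` says that `M` is a context below `t`, and that all aliens of `t` with respect
to `M` belong to `P`. -/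
inductive Fits (P : Set (L.Term V)) : Ctx L V → L.Term V → Prop
  | hole (t : L.Term V) (h : t ∈ P) : Fits P hole t
  | var (y : V) : Fits P (ctxVar y) (Term.var y)
  | func {n : ℕ} (f : L.Functions n) (Ms : Fin n → Ctx L V) (ts : Fin n → L.Term V)
      (h : ∀ i, Fits P (Ms i) (ts i)) : Fits P (Term.func f Ms) (Term.func f ts)

theorem fits_func_iff {P : Set (L.Term V)} {n : ℕ} {f : L.Functions n} {Ms : Fin n → Ctx L V}
    {t : L.Term V} : Fits P (Term.func f Ms) t ↔
      ∃ ts : Fin n → L.Term V, t = Term.func f ts ∧ ∀ i, Fits P (Ms i) (ts i) := by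
  constructor
  · intro h
    cases h with
    | func _ _ ts h => exact ⟨ts, rfl, h⟩
  · rintro ⟨ts, rfl, h⟩
    exact Fits.func f Ms ts h

theorem fits_hole_iff {P : Set (L.Term V)} {t : L.Term V} : Fits P hole t ↔ t ∈ P := by
  constructor
  · intro h
    cases h with
    | hole _ h => exact h
  · exact fun h => Fits.hole t h

theorem fits_ctxVar_iff {P : Set (L.Term V)} {t : L.Term V} {y : V} :
    Fits P (ctxVar y) t ↔ t = Term.var y := by
  constructor
  · intro h
    cases h with
    | var => rfl
  · rintro rfl
    exact Fits.var y

theorem Fits.le {P : Set (L.Term V)} {M : Ctx L V} {t : L.Term V} (h : Fits P M t) :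
    M ≤ toCtx t := by
  induction h with
  | hole t _ => exact hole_le _
  | var y => exact le_rfl
  | func f Ms ts _ ih => exact Ctx.Le.func f Ms _ ih

theorem Fits.mono {P Q : Set (L.Term V)} {M : Ctx L V} {t : L.Term V} (hPQ : P ⊆ Q)
    (h : Fits P M t) : Fits Q M t := by
  induction h with
  | hole t h => exact Fits.hole t (hPQ h)
  | var y => exact Fits.var y
  | func f Ms ts _ ih => exact Fits.func f Ms ts ih

theorem Fits.subtermAt {P : Set (L.Term V)} {M D : Ctx L V} {t : L.Term V} {p : List ℕ}
    (h : Fits P M t) (hM : subtermAt M p = some D) :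
    ∃ u, subtermAt t p = some u ∧ Fits P D u := by
  induction p generalizing M t with
  | nil =>
    simp only [subtermAt_nil, Option.some.injEq] at hM
    subst hM
    exact ⟨t, by simp, h⟩
  | cons i p ih =>
    obtain ⟨n, f, Ms, j, rfl, rfl, h₁⟩ := subtermAt_cons_eq_some.1 hM
    obtain ⟨ts, rfl, hts⟩ := fits_func_iff.1 h
    simpa using ih (hts j) h₁

theorem fits_iff {P : Set (L.Term V)} {M : Ctx L V} {t : L.Term V} :
    Fits P M t ↔ M ≤ toCtx t ∧ ∀ p a, IsAlienAt M t p a → a ∈ P := by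
  constructor
  · refine fun h => ⟨h.le, fun p a ⟨hM, ht⟩ => ?_⟩
    obtain ⟨u, hu, hf⟩ := h.subtermAt hM
    rw [ht] at hu
    cases hu
    exact fits_hole_iff.1 hf
  · rintro ⟨hle, h⟩
    induction t generalizing M with
    | var y =>
      rcases le_ctxVar_iff.1 hle with rfl | rfl
      · exact Fits.hole _ (h [] _ ⟨by simp, by simp⟩)
      · exact Fits.var y
    | func f ts ih =>
      rcases le_func_iff.1 hle with rfl | ⟨Ms, rfl, hM⟩
      · exact Fits.hole _ (h [] _ ⟨by simp, by simp⟩)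
      · refine Fits.func f Ms ts fun i => ih i (hM i) ?_
        rintro p a ⟨h1, h2⟩
        exact h (i :: p) a ⟨by simpa using h1, by simpa using h2⟩

theorem Fits.replaceAt {P : Set (L.Term V)} {M D : Ctx L V} {t u : L.Term V} {p : List ℕ}
    (h : Fits P M t) (hp : IsPos M p) (hD : Fits P D u) :
    Fits P (replaceAt M p D) (replaceAt t p u) := by
  obtain ⟨M', hM⟩ := hp
  induction p generalizing M t with
  | nil => simpa using hD
  | cons i p ih =>
    obtain ⟨n, f, Ms, j, rfl, rfl, h₁⟩ := subtermAt_cons_eq_some.1 hM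
    obtain ⟨ts, rfl, hts⟩ := fits_func_iff.1 h
    rw [replaceAt_func_fin, replaceAt_func_fin]
    refine Fits.func f _ _ fun k => ?_
    by_cases hk : k = j
    · subst hk
      simpa using ih (hts k) h₁
    · simpa [Function.update_of_ne hk] using hts k

theorem Fits.replaceAt_hole {P : Set (L.Term V)} {M : Ctx L V} {t u : L.Term V} {p : List ℕ}
    (h : Fits P M t) (hp : LayerSystems.subtermAt M p = some LayerSystems.hole) (hu : u ∈ P) :
    Fits P M (LayerSystems.replaceAt t p u) := by
  have := h.replaceAt ⟨_, hp⟩ (Fits.hole u hu)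
  rwa [replaceAt_self hp] at this

/-- The pattern of a rule is common to a context and to the term that it fits, so only the
substitutions matter. This is how a step of a layer is transferred to a term. -/
theorem fits_subst_iff {P : Set (L.Term V)} {l : L.Term V} {θ' : V → Ctx L V}
    {θ : V → L.Term V} :
    Fits P (l.subst θ') (l.subst θ) ↔ ∀ z ∈ vars l, Fits P (θ' z) (θ z) := by
  induction l with
  | var y => simp [Term.subst]
  | func f ts ih =>
    simp only [Term.subst, mem_vars_func]
    constructor
    · rintro h z ⟨i, hz⟩
      obtain ⟨us, hu, h⟩ := fits_func_iff.1 h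
      cases hu
      exact (ih i).1 (h i) z hz
    · intro h
      exact Fits.func f _ _ fun i => (ih i).2 fun z hz => h z ⟨i, hz⟩

/-! ### Merging contexts -/

/-- The merge of two contexts, explicitly. -/
inductive Merge : Ctx L V → Ctx L V → Ctx L V → Prop
  | hole_left (D : Ctx L V) : Merge hole D D
  | hole_right (C : Ctx L V) : Merge C hole C
  | var (y : V) : Merge (ctxVar y) (ctxVar y) (ctxVar y)
  | func {n : ℕ} (f : L.Functions n) (Cs Ds Es : Fin n → Ctx L V)
      (h : ∀ i, Merge (Cs i) (Ds i) (Es i)) :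
      Merge (Term.func f Cs) (Term.func f Ds) (Term.func f Es)

theorem Merge.isMerge {C D E : Ctx L V} (h : Merge C D E) : IsMerge C D E := by
  have key : C ≤ E ∧ D ≤ E ∧ ∀ F, C ≤ F → D ≤ F → E ≤ F := by
    induction h with
    | hole_left D => exact ⟨hole_le _, le_rfl, fun F _ h => h⟩
    | hole_right C => exact ⟨le_rfl, hole_le _, fun F h _ => h⟩
    | var y => exact ⟨le_rfl, le_rfl, fun F h _ => h⟩
    | func f Cs Ds Es _ ih =>
      refine ⟨Ctx.Le.func f _ _ fun i => (ih i).1, Ctx.Le.func f _ _ fun i => (ih i).2.1, ?_⟩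
      intro F hC hD
      obtain ⟨Fs, rfl, hC'⟩ := func_le_iff.1 hC
      obtain ⟨Fs', h, hD'⟩ := func_le_iff.1 hD
      cases h
      exact Ctx.Le.func f _ _ fun i => (ih i).2.2 _ (hC' i) (hD' i)
  refine ⟨?_, ?_⟩
  · rintro F (rfl | rfl)
    · exact key.1
    · exact key.2.1
  · intro F hF
    exact key.2.2 F (hF (Or.inl rfl)) (hF (Or.inr rfl))

/-- Below a common bound two contexts can differ only where one of them has a hole. Every
application of (L3) takes place below a fixed term, so the merge that it asks for always exists. -/
theorem exists_merge {C D E : Ctx L V} (hC : C ≤ E) (hD : D ≤ E) : ∃ F, Merge C D F ∧ F ≤ E := by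
  induction E generalizing C D with
  | var y =>
    cases y with
    | none =>
      obtain rfl := le_hole_iff.1 hC
      exact ⟨D, Merge.hole_left D, hD⟩
    | some y =>
      rcases le_ctxVar_iff.1 hC with rfl | rfl
      · exact ⟨D, Merge.hole_left D, hD⟩
      · rcases le_ctxVar_iff.1 hD with rfl | rfl
        · exact ⟨_, Merge.hole_right _, hC⟩
        · exact ⟨_, Merge.var y, hC⟩
  | func f Es ih =>
    rcases le_func_iff.1 hC with rfl | ⟨Cs, rfl, hC'⟩
    · exact ⟨D, Merge.hole_left D, hD⟩
    · rcases le_func_iff.1 hD with rfl | ⟨Ds, rfl, hD'⟩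
      · exact ⟨_, Merge.hole_right _, hC⟩
      · choose Fs hF hF' using fun i => ih i (hC' i) (hD' i)
        exact ⟨_, Merge.func f _ _ _ hF, Ctx.Le.func f _ _ hF'⟩

theorem IsMerge.left {C D E : Ctx L V} (h : IsMerge C D E) : C ≤ E := h.1 (Or.inl rfl)

theorem IsMerge.right {C D E : Ctx L V} (h : IsMerge C D E) : D ≤ E := h.1 (Or.inr rfl)

theorem IsMerge.merge {C D E : Ctx L V} (h : IsMerge C D E) : Merge C D E := by
  obtain ⟨F, hF, -⟩ := exists_merge h.left h.right
  rwa [h.unique hF.isMerge]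

/-! ### The max-top -/

variable {𝕃 : Set (Ctx L V)}

/-- (L1) supplies a top other than `□`, and by finiteness a maximal one `M` above it. Unless the
term is a variable, `M` has a function symbol at the root, so (L3) applies there, and the merge of
`M` with any other top is a top; maximality then makes `M` greatest. -/
theorem exists_greatest_top (h1 : L1 𝕃) (h3 : L3 𝕃) (t : L.Term V) :
    ∃ M, IsTop 𝕃 (toCtx t) M ∧ ∀ T, IsTop 𝕃 (toCtx t) T → T ≤ M := by
  have hfin : {T | IsTop 𝕃 (toCtx t) T}.Finite := (finite_le (toCtx t)).subset fun T hT => hT.2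
  obtain ⟨T₀, hT₀, hne⟩ := h1 t
  obtain ⟨M, hle, hM⟩ := hfin.exists_le_maximal hT₀
  refine ⟨M, hM.1, fun T hT => ?_⟩
  have hMne : M ≠ hole := by
    rintro rfl
    exact hne (le_hole_iff.1 hle)
  cases t with
  | var y =>
    rcases le_ctxVar_iff.1 hM.1.2 with rfl | rfl
    · exact absurd rfl hMne
    · exact hT.2
  | func f ts =>
    rcases le_func_iff.1 hM.1.2 with rfl | ⟨Ms, rfl, -⟩
    · exact absurd rfl hMne
    · obtain ⟨F, hF, hFle⟩ := exists_merge hM.1.2 hT.2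
      have hF𝕃 : F ∈ 𝕃 := by
        simpa using h3 _ hM.1.1 T hT.1 [] (by simp) _ F (by simp) hF.isMerge
      exact hF.isMerge.right.trans (hM.2 ⟨hF𝕃, hFle⟩ hF.isMerge.left)

open Classical in
/-- The max-top of a term. -/
noncomputable def maxTop (𝕃 : Set (Ctx L V)) (t : L.Term V) : Ctx L V :=
  if h : ∃ M, IsTop 𝕃 (toCtx t) M ∧ ∀ T, IsTop 𝕃 (toCtx t) T → T ≤ M then h.choose else hole

theorem isTop_maxTop (h𝕃 : IsVarRestrictedLayerSystem 𝕃) (t : L.Term V) :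
    IsTop 𝕃 (toCtx t) (maxTop 𝕃 t) := by
  have h := exists_greatest_top h𝕃.l1 h𝕃.l3 t
  rw [maxTop, dif_pos h]
  exact h.choose_spec.1

theorem maxTop_mem (h𝕃 : IsVarRestrictedLayerSystem 𝕃) (t : L.Term V) : maxTop 𝕃 t ∈ 𝕃 :=
  (isTop_maxTop h𝕃 t).1

theorem maxTop_le (h𝕃 : IsVarRestrictedLayerSystem 𝕃) (t : L.Term V) :
    maxTop 𝕃 t ≤ toCtx t := (isTop_maxTop h𝕃 t).2

theorem le_maxTop (h𝕃 : IsVarRestrictedLayerSystem 𝕃) {t : L.Term V} {T : Ctx L V} (hT : T ∈ 𝕃)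
    (hle : T ≤ toCtx t) : T ≤ maxTop 𝕃 t := by
  have h := exists_greatest_top h𝕃.l1 h𝕃.l3 t
  rw [maxTop, dif_pos h]
  exact h.choose_spec.2 T ⟨hT, hle⟩

theorem isMaxTop_maxTop (h𝕃 : IsVarRestrictedLayerSystem 𝕃) (t : L.Term V) :
    IsMaxTop 𝕃 (toCtx t) (maxTop 𝕃 t) :=
  ⟨isTop_maxTop h𝕃 t, fun _ hT _ => le_maxTop h𝕃 hT.1 hT.2⟩

theorem eq_maxTop (h𝕃 : IsVarRestrictedLayerSystem 𝕃) {t : L.Term V} {M : Ctx L V}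
    (h : IsMaxTop 𝕃 (toCtx t) M) : M = maxTop 𝕃 t :=
  le_antisymm (le_maxTop h𝕃 h.1.1 h.1.2)
    (h.2 (isTop_maxTop h𝕃 t) (le_maxTop h𝕃 h.1.1 h.1.2))

theorem maxTop_ne_hole (h𝕃 : IsVarRestrictedLayerSystem 𝕃) (t : L.Term V) :
    maxTop 𝕃 t ≠ hole := by
  obtain ⟨T, hT, hne⟩ := h𝕃.l1 t
  intro h
  have := le_maxTop h𝕃 hT.1 hT.2
  rw [h] at this
  exact hne (le_hole_iff.1 this)

theorem isFunPos_maxTop_nil (h𝕃 : IsVarRestrictedLayerSystem 𝕃) {t : L.Term V}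
    (h : IsFunPos t []) : IsFunPos (maxTop 𝕃 t) [] := by
  obtain ⟨n, f, ts, h⟩ := h
  simp only [subtermAt_nil, Option.some.injEq] at h
  subst h
  rcases le_func_iff.1 (maxTop_le h𝕃 (Term.func f ts)) with h | ⟨Ms, h, -⟩
  · exact absurd h (maxTop_ne_hole h𝕃 _)
  · rw [h]; simp

theorem maxTop_var (h𝕃 : IsVarRestrictedLayerSystem 𝕃) (y : V) :
    maxTop 𝕃 (Term.var y) = ctxVar y := by
  rcases le_ctxVar_iff.1 (maxTop_le h𝕃 (Term.var y)) with h | h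
  · exact absurd h (maxTop_ne_hole h𝕃 _)
  · exact h

/-- A variable has no tops except `□` and itself, so (L1) leaves no choice. -/
theorem ctxVar_mem (h𝕃 : IsVarRestrictedLayerSystem 𝕃) (y : V) : ctxVar y ∈ 𝕃 := by
  rw [← maxTop_var h𝕃 y]
  exact maxTop_mem h𝕃 _

theorem hole_mem [Nonempty V] (h𝕃 : IsVarRestrictedLayerSystem 𝕃) : hole ∈ 𝕃 := by
  obtain ⟨y⟩ := ‹Nonempty V›
  have := (h𝕃.l2' hole [] ⟨_, subtermAt_nil _⟩).1 y
  simp only [replaceAt_nil] at this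
  exact this (ctxVar_mem h𝕃 y)

theorem maxTop_eq_toCtx (h𝕃 : IsVarRestrictedLayerSystem 𝕃) {t : L.Term V} (h : toCtx t ∈ 𝕃) :
    maxTop 𝕃 t = toCtx t := le_antisymm (maxTop_le h𝕃 t) (le_maxTop h𝕃 h le_rfl)

end LayerSystems

namespace LayerSystems

variable {L : FirstOrder.Language.{u, v}} {V : Type w} {X Y Z : Type*}

variable {𝕃 : Set (Ctx L V)} {R : TRS L V} {A : Set (L.Term V)}

/-! ### Erasing variables -/

theorem psubst_mono {C : L.Term X} {φ ψ : List ℕ → X → Ctx L V}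
    (h : ∀ p y, IsVarPos C y p → φ p y ≤ ψ p y) : psubst C φ ≤ psubst C ψ := by
  induction C generalizing φ ψ with
  | var y => exact h [] y (by simp [IsVarPos])
  | func f ts ih =>
    exact Ctx.Le.func f _ _ fun i => ih i fun p y hp => h _ _ (by simpa using hp)

-- The first half of (L2') erases one variable occurrence at a time; iterating it over the finite
-- set of erased positions gives arbitrary simultaneous erasure, which may treat occurrences of the
-- same variable differently.
open Classical in
theorem psubst_erase_mem (h𝕃 : IsVarRestrictedLayerSystem 𝕃) {C : Ctx L V} (hC : C ∈ 𝕃)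
    {φ : List ℕ → Option V → Ctx L V}
    (h : ∀ p o, IsVarPos C o p → φ p o = hole ∨ φ p o = Term.var o) : psubst C φ ∈ 𝕃 := by
  have key : ∀ F : Finset (List ℕ),
      psubst C (fun p o => if p ∈ F then hole else Term.var o) ∈ 𝕃 := by
    intro F
    induction F using Finset.induction with
    | empty => simpa [psubst_id] using hC
    | insert p F hp ih =>
      by_cases hv : ∃ o, IsVarPos C o p
      · obtain ⟨o, ho⟩ := hv
        have e : (psubst C fun q z => if q ∈ insert p F then hole else Term.var z) =
            replaceAt (psubst C fun q z => if q ∈ F then hole else Term.var z) p hole := by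
          rw [replaceAt_psubst_var ho]
          refine psubst_congr fun q z _ => ?_
          by_cases hq : q = p <;> simp [hq]
        rw [e]
        have hs := subtermAt_psubst_var ho fun q z => if q ∈ F then (hole : Ctx L V) else Term.var z
        simp only [hp, if_false] at hs
        cases o with
        | none =>
          have hs' := replaceAt_self hs
          rw [← hole] at hs'
          rw [hs']
          exact ih
        | some y =>
          refine (h𝕃.l2' _ p ⟨_, hs⟩).1 y ?_
          rw [ctxVar, replaceAt_self hs]
          exact ih
      · rw [psubst_congr (ψ := fun q z => if q ∈ F then hole else Term.var z)]
        · exact ih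
        · intro q z hq
          have : q ≠ p := by
            rintro rfl
            exact hv ⟨z, hq⟩
          simp [this]
  have hfin : {p | IsPos C p ∧ ∀ o, IsVarPos C o p → φ p o = hole}.Finite :=
    (finite_positions C).subset fun p hp => hp.1
  have e : psubst C φ =
      psubst C fun p o => if p ∈ hfin.toFinset then hole else Term.var o := by
    refine psubst_congr fun p o hp => ?_
    have hpos : IsPos C p := ⟨_, hp⟩
    simp only [Set.Finite.mem_toFinset, Set.mem_ofPred_eq]
    split_ifs with h1
    · exact h1.2 o hp
    · refine (h p o hp).resolve_left fun h2 => h1 ⟨hpos, fun o' ho' => ?_⟩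
      rwa [ho'.unique hp]
  rw [e]
  exact key _

/-! ### Sets of terms built from layers -/

/-- The terms that have a top all of whose aliens belong to `A`. -/
def Grow (𝕃 : Set (Ctx L V)) (A : Set (L.Term V)) : Set (L.Term V) :=
  {t | ∃ M ∈ 𝕃, Fits A M t}

/-- A set of terms is good if it is closed under rewriting and contains, for each of its members
that occurs in a term below a function symbol of the max-top, the aliens therein. -/
structure Good (𝕃 : Set (Ctx L V)) (R : TRS L V) (A : Set (L.Term V)) : Prop where
  closed : ∀ s t, s ∈ A → R.Rel s t → t ∈ A
  aliens : ∀ w p a q c, IsFunPos (maxTop 𝕃 w) p → subtermAt w p = some a → a ∈ A →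
    IsAlienAt (maxTop 𝕃 w) w (p ++ q) c → c ∈ A

theorem subset_grow [Nonempty V] (h𝕃 : IsVarRestrictedLayerSystem 𝕃) (A : Set (L.Term V)) :
    A ⊆ Grow 𝕃 A := fun t ht => ⟨hole, hole_mem h𝕃, Fits.hole t ht⟩

theorem grow_mono {B : Set (L.Term V)} (h : A ⊆ B) : Grow 𝕃 A ⊆ Grow 𝕃 B :=
  fun _ ⟨M, hM, hf⟩ => ⟨M, hM, hf.mono h⟩

/-- Merging the top `N` of `a` into the max-top of `w` at `p` is allowed by (L3) and stays below
`w`, so by maximality the max-top already contains `N` there. The holes of the max-top below `p`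
therefore lie at or below holes of `N`, that is, inside aliens from `A`, and there the corresponding
property of `A` takes over. -/
theorem Good.mem_of_isAlienAt (h𝕃 : IsVarRestrictedLayerSystem 𝕃) (hA : Good 𝕃 R A)
    {w a c : L.Term V} {p q : List ℕ} (hp : IsFunPos (maxTop 𝕃 w) p)
    (ha : subtermAt w p = some a) (haA : a ∈ Grow 𝕃 A)
    (hc : IsAlienAt (maxTop 𝕃 w) w (p ++ q) c) : c ∈ A := by
  obtain ⟨N, hN, hf⟩ := haA
  obtain ⟨D, hD⟩ := hp.isPos
  have hDa : D ≤ toCtx a := subtermAt_le_subtermAt (maxTop_le h𝕃 w) hD (subtermAt_toCtx ha)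
  obtain ⟨E, hE, hEa⟩ := exists_merge hDa hf.le
  have h1 : replaceAt (maxTop 𝕃 w) p E ∈ 𝕃 :=
    h𝕃.l3 _ (maxTop_mem h𝕃 w) N hN p hp D E hD hE.isMerge
  have h2 : replaceAt (maxTop 𝕃 w) p E ≤ toCtx w := by
    have := replaceAt_mono (maxTop_le h𝕃 w) hp.isPos hEa
    rwa [replaceAt_self (subtermAt_toCtx ha)] at this
  have h3 : E ≤ D :=
    subtermAt_le_subtermAt (le_maxTop h𝕃 h1 h2) (subtermAt_replaceAt hp.isPos E) hD
  have hND : N ≤ D := hE.isMerge.right.trans h3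
  have hDq : subtermAt D q = some hole := by
    rw [← subtermAt_append_of_eq hD]
    exact hc.1
  obtain ⟨q', r, rfl, hq'⟩ := hole_above_of_hole hND hDq
  obtain ⟨b, hb, hbA⟩ := hf.subtermAt hq'
  rw [fits_hole_iff] at hbA
  by_cases hr : r = []
  · subst hr
    have h4 := hc.2
    rw [List.append_nil, subtermAt_append_of_eq ha, hb] at h4
    cases h4
    exact hbA
  · have hc' := hc
    rw [← List.append_assoc] at hc'
    refine hA.aliens w (p ++ q') b r c ?_ ?_ hbA hc'
    · exact isFunPos_of_subtermAt_append hr hc'.1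
    · rw [subtermAt_append_of_eq ha, hb]

theorem Good.fits_maxTop (h𝕃 : IsVarRestrictedLayerSystem 𝕃) (hA : Good 𝕃 R A)
    {t : L.Term V} (ht : t ∈ Grow 𝕃 A) : Fits A (maxTop 𝕃 t) t := by
  cases t with
  | var y =>
    rw [maxTop_var h𝕃]
    exact Fits.var y
  | func f ts =>
    refine fits_iff.2 ⟨maxTop_le h𝕃 _, fun p a ha => ?_⟩
    exact hA.mem_of_isAlienAt h𝕃 (p := []) (q := p) (isFunPos_maxTop_nil h𝕃 (by simp)) (by simp)
      ht ha

/-- A step that does not take place inside a context takes place inside an alien. -/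
theorem exists_alien_step {M : Ctx L V} {s t : L.Term V} {ρ : L.Term V × L.Term V}
    {p : List ℕ} (hρ : ρ ∈ R.rules) (hM : M ≤ toCtx s) (hp : ¬ IsFunPos M p)
    (h : StepAt ρ p s t) : ∃ q r a a', p = q ++ r ∧ IsAlienAt M s q a ∧ StepAt ρ r a a' ∧
      t = replaceAt s q a' := by
  obtain ⟨n, f, ts, hs⟩ := TRS.isFunPos_of_stepAt hρ h
  rcases hole_above hM (subtermAt_toCtx hs) with h' | ⟨y, hy, -⟩ | ⟨q, r, rfl, hq⟩
  · exact absurd h' hp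
  · simp [ctxVar] at hy
  · obtain ⟨a, ha, -⟩ := subtermAt_append_eq_some.1 hs
    obtain ⟨a', h1, h2⟩ := (StepAt.append ha).1 h
    exact ⟨q, r, a, a', rfl, ⟨hq, ha⟩, h1, h2⟩

/-- Steps in a context carry over to the terms onto which it fits. -/
theorem Fits.step {M N : Ctx L V} {s t : L.Term V} {ρ : L.Term V × L.Term V} {p : List ℕ}
    (hρ : ρ ∈ R.rules) (hf : Fits A M s) (h : StepAt ρ p s t) (h' : StepAt ρ p M N) :
    Fits A N t := by
  obtain ⟨θ, h1, rfl⟩ := h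
  obtain ⟨θ', h2, rfl⟩ := h'
  obtain ⟨u, hu, hfu⟩ := hf.subtermAt h2
  rw [h1] at hu
  cases hu
  exact hf.replaceAt ⟨_, h2⟩ (fits_subst_iff.2 fun z hz =>
    fits_subst_iff.1 hfu z (R.vars_rhs_subset ρ hρ hz))

/-- A step at a function position of the max-top is mirrored in the layer by (W), and its aliens are
merely moved, copied or deleted. Any other step happens inside an alien, and `A` is closed under
rewriting. -/
theorem Good.grow_closed (h𝕃 : IsVarRestrictedLayerSystem 𝕃) (hW : WeaklyLayered 𝕃 R)
    (hA : Good 𝕃 R A) {s t : L.Term V} (hs : s ∈ Grow 𝕃 A) (h : R.Rel s t) : t ∈ Grow 𝕃 A := by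
  obtain ⟨ρ, hρ, p, h⟩ := h
  have hf := hA.fits_maxTop h𝕃 hs
  by_cases hp : IsFunPos (maxTop 𝕃 s) p
  · obtain ⟨N, hN, hMN⟩ := hW ρ hρ s t _ p (isMaxTop_maxTop h𝕃 s) hp h
    exact ⟨N, hN, hf.step hρ h hMN⟩
  · obtain ⟨q, r, a, a', rfl, ha, haa', rfl⟩ := exists_alien_step hρ hf.le hp h
    refine ⟨_, maxTop_mem h𝕃 s, hf.replaceAt_hole ha.1 ?_⟩
    exact hA.closed a a' ((fits_iff.1 hf).2 q a ha) ⟨ρ, hρ, r, haa'⟩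

theorem Good.grow [Nonempty V] (h𝕃 : IsVarRestrictedLayerSystem 𝕃) (hW : WeaklyLayered 𝕃 R)
    (hA : Good 𝕃 R A) : Good 𝕃 R (Grow 𝕃 A) where
  closed _ _ hs h := hA.grow_closed h𝕃 hW hs h
  aliens _ _ _ _ _ hp ha haA hc :=
    subset_grow h𝕃 A (hA.mem_of_isAlienAt h𝕃 hp ha haA hc)

/-- The members of `A` in which no variable from `X` occurs. -/
def avoiding (A : Set (L.Term V)) (X : Set V) : Set (L.Term V) :=
  {t | t ∈ A ∧ ∀ y ∈ X, y ∉ vars t}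

/-- Rewriting introduces no variables and aliens are subterms. Applied to the set of marking
variables, this keeps them out of the aliens throughout a rewrite sequence. -/
theorem Good.avoiding (hA : Good 𝕃 R A) (X : Set V) : Good 𝕃 R (avoiding A X) where
  closed s t hs h := ⟨hA.closed s t hs.1 h,
    fun y hy hyt => hs.2 y hy (TRS.vars_subset_of_rel h hyt)⟩
  aliens w p a q c hp ha haA hc := by
    refine ⟨hA.aliens w p a q c hp ha haA.1 hc, fun y hy hyc => haA.2 y hy ?_⟩
    have h := hc.2
    rw [subtermAt_append_of_eq ha] at h
    exact vars_subset_of_subtermAt h hyc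

theorem Good.closed_rtc (hA : Good 𝕃 R A) {s t : L.Term V} (hs : s ∈ A)
    (h : Relation.ReflTransGen R.Rel s t) : t ∈ A := by
  induction h with
  | refl => exact hs
  | tail _ h ih => exact hA.closed _ _ ih h

/-! ### Ranks -/

/-- The terms of rank at most `n`. -/
def rankLE (𝕃 : Set (Ctx L V)) : ℕ → Set (L.Term V)
  | 0 => ∅
  | n + 1 => Grow 𝕃 (rankLE 𝕃 n)

theorem good_rankLE [Nonempty V] (h𝕃 : IsVarRestrictedLayerSystem 𝕃) (hW : WeaklyLayered 𝕃 R)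
    (n : ℕ) : Good 𝕃 R (rankLE 𝕃 n) := by
  induction n with
  | zero => exact ⟨fun _ _ h => h.elim, fun _ _ _ _ _ _ _ h => h.elim⟩
  | succ n ih => exact ih.grow h𝕃 hW

theorem rankLE_mono [Nonempty V] (h𝕃 : IsVarRestrictedLayerSystem 𝕃) {m n : ℕ} (h : m ≤ n) :
    rankLE 𝕃 m ⊆ rankLE 𝕃 n := by
  induction h with
  | refl => exact subset_rfl
  | step _ ih => exact ih.trans (subset_grow h𝕃 _)

theorem exists_mem_rankLE [Nonempty V] (h𝕃 : IsVarRestrictedLayerSystem 𝕃) (t : L.Term V) :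
    ∃ n, t ∈ rankLE 𝕃 n := by
  -- Strengthened to all subterms, because the aliens are proper subterms of `t` but need not be its
  -- arguments.
  have key : ∀ p u, subtermAt t p = some u → ∃ n, u ∈ rankLE 𝕃 n := by
    induction t with
    | var y =>
      intro p u h
      obtain ⟨-, rfl⟩ := subtermAt_var_eq_some.1 h
      exact ⟨1, ctxVar y, ctxVar_mem h𝕃 y, Fits.var y⟩
    | func f ts ih =>
      intro p u h
      cases p with
      | cons i p =>
        obtain ⟨m, g, us, j, hu, rfl, h⟩ := subtermAt_cons_eq_some.1 h
        cases hu
        exact ih j p u h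
      | nil =>
        simp only [subtermAt_nil, Option.some.injEq] at h
        subst h
        have h1 : ∀ p : List ℕ, ∃ n, ∀ a, IsAlienAt (maxTop 𝕃 (Term.func f ts))
            (Term.func f ts) p a → a ∈ rankLE 𝕃 n := by
          intro p
          by_cases ha : ∃ a, IsAlienAt (maxTop 𝕃 (Term.func f ts)) (Term.func f ts) p a
          · obtain ⟨a, ha⟩ := ha
            have h2 : ∃ n, a ∈ rankLE 𝕃 n := by
              cases p with
              | nil =>
                exact absurd (Option.some.inj ((subtermAt_nil _).symm.trans ha.1))
                  (maxTop_ne_hole h𝕃 _)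
              | cons i p =>
                obtain ⟨m, g, us, j, hu, rfl, h⟩ := subtermAt_cons_eq_some.1 ha.2
                cases hu
                exact ih j p a h
            obtain ⟨n, hn⟩ := h2
            refine ⟨n, fun b hb => ?_⟩
            have h3 := hb.2
            rw [ha.2] at h3
            cases h3
            exact hn
          · exact ⟨0, fun a h => absurd ⟨a, h⟩ ha⟩
        choose d hd using h1
        obtain ⟨n, hn⟩ := ((finite_positions (Term.func f ts)).image d).bddAbove
        refine ⟨n + 1, _, maxTop_mem h𝕃 (Term.func f ts),
          fits_iff.2 ⟨maxTop_le h𝕃 _, fun p a ha => ?_⟩⟩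
        exact rankLE_mono h𝕃 (hn ⟨p, ⟨_, ha.2⟩, rfl⟩) (hd p a ha)
  exact key [] t (by simp)

/-- Aliens would have to belong to `rankLE 𝕃 0 = ∅`, so the top is the whole term. -/
theorem mem_rankLE_one {t : L.Term V} : t ∈ rankLE 𝕃 1 ↔ toCtx t ∈ 𝕃 := by
  constructor
  · rintro ⟨M, hM, hf⟩
    have : M = toCtx t := by
      clear hM
      induction hf with
      | hole _ h => exact h.elim
      | var y => rfl
      | func f Ms ts _ ih => exact congrArg _ (funext ih)
    rwa [← this]
  · refine fun h => ⟨_, h, fits_iff.2 ⟨le_rfl, fun p a ha => ?_⟩⟩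
    obtain ⟨u, -, hu⟩ := subtermAt_toCtx_eq_some.1 ha.1
    exact absurd hu.symm (toCtx_ne_hole u)

theorem hasRank_one_of_mem (h𝕃 : IsVarRestrictedLayerSystem 𝕃) {t : L.Term V}
    (h : toCtx t ∈ 𝕃) : HasRank 𝕃 t 1 := by
  have hno : ∀ p a, ¬ IsAlienAt (toCtx t) t p a := by
    intro p a ha
    obtain ⟨u, -, hu⟩ := subtermAt_toCtx_eq_some.1 ha.1
    exact toCtx_ne_hole u hu.symm
  -- There are no aliens, so the supremum is that of the empty set, which is `0`, and the choice of
  -- ranks for the aliens is immaterial.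
  have := HasRank.intro (𝕃 := 𝕃) t (toCtx t)
    (by simpa only [maxTop_eq_toCtx h𝕃 h] using isMaxTop_maxTop h𝕃 t) (fun _ => 0)
    fun p a ha => absurd ha (hno p a)
  simpa [hno] using this

/-- All members of `S` are confluent. -/
def CROn {α : Type*} (r : α → α → Prop) (S : Set α) : Prop :=
  ∀ s ∈ S, ∀ t u, Relation.ReflTransGen r s t → Relation.ReflTransGen r s u →
    ∃ v, Relation.ReflTransGen r t v ∧ Relation.ReflTransGen r u v

-- Closure of `S` under the relation keeps a sequence that starts in `S` inside `S`, so it is a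
-- sequence of the restricted relation.
open Relation in
theorem ConfluentOn.crOn {α : Type*} {r : α → α → Prop} {S T : Set α} (h : ConfluentOn r S)
    (hTS : T ⊆ S) : CROn r T := by
  have lift : ∀ s t, s ∈ S → ReflTransGen r s t →
      ReflTransGen (fun s t => s ∈ S ∧ t ∈ S ∧ r s t) s t ∧ t ∈ S := by
    intro s t hs hst
    induction hst with
    | refl => exact ⟨.refl, hs⟩
    | tail _ h1 ih => exact ⟨ih.1.tail ⟨ih.2, h.1 _ _ ih.2 h1, h1⟩, h.1 _ _ ih.2 h1⟩
  have unlift : ∀ s t, ReflTransGen (fun s t => s ∈ S ∧ t ∈ S ∧ r s t) s t →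
      ReflTransGen r s t := fun s t h => ReflTransGen.mono (fun _ _ h => h.2.2) _ _ h
  intro s hs t u ht hu
  obtain ⟨v, h1, h2⟩ := h.2 s t u (lift s t (hTS hs) ht).1 (lift s u (hTS hs) hu).1
  exact ⟨v, unlift _ _ h1, unlift _ _ h2⟩

end LayerSystems

namespace LayerSystems

/-! ### Abstract rewriting -/

section Abstract

open Relation

variable {α Λ : Type*}

theorem Confluent.of_diamond {r : α → α → Prop}
    (h : ∀ s t u, r s t → r s u → ∃ v, r t v ∧ r u v) : Confluent r := by
  intro s t u ht hu
  obtain ⟨v, h1, h2⟩ := Relation.church_rosser (r := r)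
    (fun a b c hab hac => by
      obtain ⟨d, h1, h2⟩ := h a b c hab hac
      exact ⟨d, .single h1, .single h2⟩) ht hu
  exact ⟨v, h1, h2⟩

variable [LinearOrder Λ]

/-- Steps with a label below `a`. -/
def StepLT (r : Λ → α → α → Prop) (a : Λ) (s t : α) : Prop := ∃ b < a, r b s t

/-- At most one step with a label that is at most `a`, followed by steps with labels below `a`. -/
def StepThenLT (r : Λ → α → α → Prop) (a : Λ) (s t : α) : Prop :=
  ∃ s', (s = s' ∨ ∃ b ≤ a, r b s s') ∧ ReflTransGen (StepLT r a) s' t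

theorem StepThenLT.refl (r : Λ → α → α → Prop) (a : Λ) (s : α) : StepThenLT r a s s :=
  ⟨s, Or.inl rfl, .refl⟩

theorem StepThenLT.trans {r : Λ → α → α → Prop} {a : Λ} {s t u : α} (h : StepThenLT r a s t)
    (h' : ReflTransGen (StepLT r a) t u) : StepThenLT r a s u := by
  obtain ⟨s', h1, h2⟩ := h
  exact ⟨s', h1, h2.trans h'⟩

theorem StepThenLT.of_rtc {r : Λ → α → α → Prop} {a : Λ} {s t : α}
    (h : ReflTransGen (StepLT r a) s t) : StepThenLT r a s t := ⟨s, Or.inl rfl, h⟩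

/-- Confluence by decreasing diagrams, for a linear order on the labels and diagrams of a special
shape. -/
theorem confluent_of_decreasing [WellFoundedLT Λ] (r : Λ → α → α → Prop)
    (hlt : ∀ a b s x y, b < a → r a s x → r b s y →
      ∃ z, ReflTransGen (StepLT r a) x z ∧ StepThenLT r a y z)
    (heq : ∀ a s x y, r a s x → r a s y → ∃ z, StepThenLT r a x z ∧ StepThenLT r a y z) :
    Confluent fun s t => ∃ a, r a s t := by
  -- As the order is linear, the labels of a finite nonempty sequence are bounded by one of them.
  have collect : ∀ (P : Λ → Prop) (s t : α), ReflTransGen (fun s t => ∃ b, P b ∧ r b s t) s t →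
      s = t ∨ ∃ b, P b ∧ ReflTransGen (fun s t => ∃ c ≤ b, r c s t) s t := by
    intro P s t h
    induction h with
    | refl => exact Or.inl rfl
    | tail _ h ih =>
      right
      obtain ⟨b, hb, h⟩ := h
      rcases ih with rfl | ⟨c, hc, ih⟩
      · exact ⟨b, hb, .single ⟨b, le_rfl, h⟩⟩
      · rcases le_total b c with hbc | hcb
        · exact ⟨c, hc, ih.tail ⟨b, hbc, h⟩⟩
        · refine ⟨b, hb, ReflTransGen.tail (ReflTransGen.mono ?_ _ _ ih) ⟨b, le_rfl, h⟩⟩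
          rintro _ _ ⟨d, hd, h⟩
          exact ⟨d, hd.trans hcb, h⟩
  -- Two finite sequences use labels below a single bound, so confluence below each bound suffices
  -- for the union.
  have union : ∀ P : Λ → Prop, (∀ b, P b → Confluent fun s t => ∃ c ≤ b, r c s t) →
      (∀ b c, P b → c ≤ b → P c) → Confluent fun s t => ∃ b, P b ∧ r b s t := by
    intro P hP hd s t u ht hu
    have up : ∀ b, P b → ∀ x y, ReflTransGen (fun s t => ∃ c ≤ b, r c s t) x y →
        ReflTransGen (fun s t => ∃ b, P b ∧ r b s t) x y := by
      intro b hb x y h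
      refine ReflTransGen.mono ?_ _ _ h
      rintro _ _ ⟨c, hc, h⟩
      exact ⟨c, hd b c hb hc, h⟩
    have up' : ∀ b c, c ≤ b → ∀ x y, ReflTransGen (fun s t => ∃ d ≤ c, r d s t) x y →
        ReflTransGen (fun s t => ∃ d ≤ b, r d s t) x y := by
      intro b c hbc x y h
      refine ReflTransGen.mono ?_ _ _ h
      rintro _ _ ⟨d, hd, h⟩
      exact ⟨d, hd.trans hbc, h⟩
    rcases collect P s t ht with rfl | ⟨b, hb, ht'⟩
    · exact ⟨u, hu, .refl⟩
    rcases collect P s u hu with rfl | ⟨c, hc, hu'⟩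
    · exact ⟨t, .refl, ht⟩
    rcases le_total b c with hbc | hcb
    · obtain ⟨v, h1, h2⟩ := hP c hc s t u (up' c b hbc _ _ ht') hu'
      exact ⟨v, up c hc _ _ h1, up c hc _ _ h2⟩
    · obtain ⟨v, h1, h2⟩ := hP b hb s t u ht' (up' b c hcb _ _ hu')
      exact ⟨v, up b hb _ _ h1, up b hb _ _ h2⟩
  have main : ∀ a, Confluent fun s t => ∃ b ≤ a, r b s t := by
    intro a
    induction a using WellFoundedLT.induction with
    | ind a IH =>
      have hb : Confluent (StepLT r a) :=
        union (fun b => b < a) IH fun b c hb hc => hc.trans_lt hb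
      -- A step labelled at most `a` is pushed across a sequence of smaller steps, using `hlt` for
      -- each square and the induction hypothesis `hb` for the sequences of smaller steps that
      -- result.
      have strip : ∀ s y, ReflTransGen (StepLT r a) s y → ∀ x,
          (s = x ∨ ∃ b ≤ a, r b s x) →
          ∃ z, ReflTransGen (StepLT r a) x z ∧ StepThenLT r a y z := by
        intro s y hsy
        induction hsy using ReflTransGen.head_induction_on with
        | refl =>
          intro x hx
          exact ⟨x, .refl, x, hx, .refl⟩
        | head h1 h2 ih =>
          rename_i s y₁
          intro x hx
          have low : ReflTransGen (StepLT r a) s x →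
              ∃ z, ReflTransGen (StepLT r a) x z ∧ StepThenLT r a y z := by
            intro h
            obtain ⟨z, hz, hz'⟩ := hb s x y h (.head h1 h2)
            exact ⟨z, hz, .of_rtc hz'⟩
          rcases hx with rfl | ⟨b, hba, hx⟩
          · exact low .refl
          rcases hba.lt_or_eq with hba | rfl
          · exact low (.single ⟨b, hba, hx⟩)
          obtain ⟨c, hc, h1⟩ := h1
          obtain ⟨z, hz, w, hw, hwz⟩ := hlt b c s x y₁ hc hx h1
          obtain ⟨z', hz', hyz'⟩ := ih w hw
          obtain ⟨z'', h3, h4⟩ := hb w z z' hwz hz'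
          exact ⟨z'', hz.trans h3, hyz'.trans h4⟩
      have extend : ∀ x z, StepThenLT r a x z → ∀ x', ReflTransGen (StepLT r a) x x' →
          ∃ z', ReflTransGen (StepLT r a) z z' ∧ StepThenLT r a x' z' := by
        rintro x z ⟨w, hw, hwz⟩ x' hx'
        obtain ⟨v, h1, h2⟩ := strip x x' hx' w hw
        obtain ⟨z', h3, h4⟩ := hb w z v hwz h1
        exact ⟨z', h3, h2.trans h4⟩
      have base : ∀ s x y, (s = x ∨ ∃ b ≤ a, r b s x) → (s = y ∨ ∃ b ≤ a, r b s y) →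
          ∃ z, StepThenLT r a x z ∧ StepThenLT r a y z := by
        intro s x y hx hy
        rcases hx with rfl | ⟨b, hba, hx⟩
        · exact ⟨y, ⟨y, hy, .refl⟩, .refl r a y⟩
        rcases hba.lt_or_eq with hba | rfl
        · obtain ⟨z, h1, h2⟩ := strip s x (.single ⟨b, hba, hx⟩) y hy
          exact ⟨z, h2, .of_rtc h1⟩
        rcases hy with rfl | ⟨c, hca, hy⟩
        · exact ⟨x, .refl r b x, ⟨x, Or.inr ⟨b, le_rfl, hx⟩, .refl⟩⟩
        rcases hca.lt_or_eq with hca | rfl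
        · obtain ⟨z, h1, h2⟩ := hlt b c s x y hca hx hy
          exact ⟨z, .of_rtc h1, h2⟩
        · exact heq c s x y hx hy
      -- Steps of the form "one large step, then small ones" have the diamond property, and they
      -- generate the same reachability as the steps labelled at most `a`.
      have diamond : ∀ s x y, StepThenLT r a s x → StepThenLT r a s y →
          ∃ z, StepThenLT r a x z ∧ StepThenLT r a y z := by
        rintro s x y ⟨x₀, hx₀, hx⟩ ⟨y₀, hy₀, hy⟩
        obtain ⟨z, h1, h2⟩ := base s x₀ y₀ hx₀ hy₀
        obtain ⟨z₁, h3, h4⟩ := extend x₀ z h1 x hx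
        obtain ⟨z₂, h5, h6⟩ := extend y₀ z h2 y hy
        obtain ⟨z₃, h7, h8⟩ := hb z z₁ z₂ h3 h5
        exact ⟨z₃, h4.trans h7, h6.trans h8⟩
      intro s t u ht hu
      have up : ∀ x y, ReflTransGen (fun s t => ∃ b ≤ a, r b s t) x y →
          ReflTransGen (StepThenLT r a) x y := fun x y h =>
        ReflTransGen.mono (fun x y h => ⟨y, Or.inr h, .refl⟩) _ _ h
      have down : ∀ x y, ReflTransGen (StepThenLT r a) x y →
          ReflTransGen (fun s t => ∃ b ≤ a, r b s t) x y := by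
        intro x y h
        induction h with
        | refl => exact .refl
        | tail _ h ih =>
          refine ih.trans ?_
          obtain ⟨w, hw, h⟩ := h
          have h' := ReflTransGen.mono (p := fun s t => ∃ b ≤ a, r b s t)
            (fun x y ⟨b, hb, h⟩ => ⟨b, hb.le, h⟩) _ _ h
          rcases hw with rfl | hw
          · exact h'
          · exact .head hw h'
      obtain ⟨v, h1, h2⟩ := Confluent.of_diamond diamond s t u (up _ _ ht) (up _ _ hu)
      exact ⟨v, down _ _ h1, down _ _ h2⟩
  have := union (fun _ => True) (fun b _ => main b) fun _ _ _ _ => trivial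
  simpa using this

/-- Finitely many confluent elements have reducts that are equal for joinable elements. -/
theorem exists_common_reducts {r : α → α → Prop} {S : Set α} (hcr : CROn r S) (F : Finset α)
    (hF : ↑F ⊆ S) : ∃ v : α → α, (∀ t ∈ F, ReflTransGen r t (v t)) ∧
      ∀ t ∈ F, ∀ u ∈ F, Join (ReflTransGen r) t u → v t = v u := by
  classical
  have trans : ∀ t u w, u ∈ S → Join (ReflTransGen r) t u → Join (ReflTransGen r) u w →
      Join (ReflTransGen r) t w := by
    rintro t u w hu ⟨c, h1, h2⟩ ⟨d, h3, h4⟩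
    obtain ⟨e, h5, h6⟩ := hcr u hu c d h2 h3
    exact ⟨e, h1.trans h5, h4.trans h6⟩
  have symm : ∀ t u, Join (ReflTransGen r) t u → Join (ReflTransGen r) u t := by
    rintro t u ⟨c, h1, h2⟩
    exact ⟨c, h2, h1⟩
  induction F using Finset.induction with
  | empty => exact ⟨id, by simp, by simp⟩
  | insert a F ha ih =>
    have haS : a ∈ S := hF (by simp)
    have hFS : ↑F ⊆ S := fun t ht => hF (by simp [Finset.mem_coe.1 ht])
    obtain ⟨v, hv, hv'⟩ := ih hFS
    have hw : ∃ w, ReflTransGen r a w ∧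
        ∀ t ∈ F, Join (ReflTransGen r) t a → ReflTransGen r t w := by
      by_cases h : ∃ t ∈ F, Join (ReflTransGen r) t a
      · obtain ⟨t₀, ht₀, c, h1, h2⟩ := h
        obtain ⟨w, h3, h4⟩ := hcr t₀ (hFS ht₀) _ _ (hv t₀ ht₀) h1
        refine ⟨w, h2.trans h4, fun t ht hta => (hv t ht).trans ?_⟩
        rwa [hv' t ht t₀ ht₀ (trans t a t₀ haS hta ⟨c, h2, h1⟩)]
      · exact ⟨a, .refl, fun t ht hta => absurd ⟨t, ht, hta⟩ h⟩
    obtain ⟨w, haw, hw⟩ := hw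
    refine ⟨fun t => if Join (ReflTransGen r) t a then w else v t, ?_, ?_⟩
    · intro t ht
      dsimp only
      rcases Finset.mem_insert.1 ht with rfl | ht
      · rwa [if_pos ⟨t, .refl, .refl⟩]
      · split_ifs with h
        · exact hw t ht h
        · exact hv t ht
    · intro t ht u hu htu
      dsimp only
      have hiff : Join (ReflTransGen r) t a ↔ Join (ReflTransGen r) u a :=
        ⟨fun h => trans u t a (hF ht) (symm _ _ htu) h, fun h => trans t u a (hF hu) htu h⟩
      by_cases h : Join (ReflTransGen r) t a
      · rw [if_pos h, if_pos (hiff.1 h)]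
      · have h' := fun h' => h (hiff.2 h')
        rw [if_neg h, if_neg h']
        refine hv' t ?_ u ?_ htu
        · refine (Finset.mem_insert.1 ht).resolve_left ?_
          rintro rfl
          exact h ⟨t, .refl, .refl⟩
        · refine (Finset.mem_insert.1 hu).resolve_left ?_
          rintro rfl
          exact h' ⟨u, .refl, .refl⟩

end Abstract

/-- Distinct fresh representatives of finitely many infinite sets. -/
theorem exists_injOn_choice {ι V : Type*} [Nonempty V] {F : Set ι} (hF : F.Finite)
    (S : ι → Set V) (hS : ∀ i ∈ F, (S i).Infinite) {B : Set V} (hB : B.Finite) :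
    ∃ ν : ι → V, (∀ i ∈ F, ν i ∈ S i ∧ ν i ∉ B) ∧ Set.InjOn ν F := by
  classical
  induction F, hF using Set.Finite.induction_on with
  | empty => exact ⟨fun _ => Classical.arbitrary V, by simp, by simp⟩
  | @insert a F ha hF ih =>
    obtain ⟨ν, h1, h2⟩ := ih fun i hi => hS i (Set.mem_insert_of_mem a hi)
    obtain ⟨x, hx, hx'⟩ := ((hS a (Set.mem_insert a F)).sdiff (hB.union (hF.image ν))).nonempty
    have hne : ∀ i ∈ F, i ≠ a := fun i hi h => ha (h ▸ hi)
    refine ⟨Function.update ν a x, ?_, ?_⟩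
    · rintro i (rfl | hi)
      · simpa using ⟨hx, fun h => hx' (Or.inl h)⟩
      · simpa [Function.update_of_ne (hne i hi)] using h1 i hi
    · rw [Set.injOn_insert ha]
      refine ⟨?_, ?_⟩
      · intro i hi j hj
        simpa [Function.update_of_ne (hne i hi), Function.update_of_ne (hne j hj)] using h2 hi hj
      · rw [Function.update_self, Set.image_congr (fun i hi => Function.update_of_ne (hne i hi) _ _)]
        exact fun h => hx' (Or.inr h)

end LayerSystems

namespace LayerSystems

variable {L : FirstOrder.Language.{u, v}} {V : Type w} {X Y Z : Type*}

variable {𝕃 : Set (Ctx L V)} {R : TRS L V} {A : Set (L.Term V)}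

open Relation

/-! ### Marking subterms by variables -/

/-- Replace the outermost subterms at positions `p` for which `χ p` is a variable by that
variable. -/
def mark : L.Term V → (List ℕ → Option V) → L.Term V
  | Term.var y, χ => Term.var ((χ []).getD y)
  | Term.func f ts, χ => ((χ []).map Term.var).getD
      (Term.func f fun i => mark (ts i) fun p => χ (i :: p))

theorem mark_of_some {t : L.Term V} {χ : List ℕ → Option V} {x : V} (h : χ [] = some x) :
    mark t χ = Term.var x := by
  cases t <;> simp [mark, h]

theorem mark_func_of_none {n : ℕ} (f : L.Functions n) (ts : Fin n → L.Term V)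
    {χ : List ℕ → Option V} (h : χ [] = none) : mark (Term.func f ts) χ =
      Term.func f fun i => mark (ts i) fun p => χ (i :: p) := by
  simp [mark, h]

theorem mark_of_none (t : L.Term V) {χ : List ℕ → Option V} (h : ∀ p, χ p = none) :
    mark t χ = t := by
  induction t generalizing χ with
  | var y => simp [mark, h]
  | func f ts ih =>
    rw [mark_func_of_none f ts (h _)]
    congr 1
    funext i
    exact ih i fun p => h _

theorem mark_psubst (b : L.Term X) (φ : List ℕ → X → L.Term V) {χ : List ℕ → Option V}
    (h : ∀ p, IsFunPos b p → χ p = none) :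
    mark (psubst b φ) χ = psubst b fun p y => mark (φ p y) fun q => χ (p ++ q) := by
  induction b generalizing φ χ with
  | var y => rfl
  | func f ts ih =>
    rw [psubst, mark_func_of_none _ _ (h [] (by simp)), psubst]
    congr 1
    funext i
    exact ih i _ fun p hp => h _ (by simpa using hp)

theorem subtermAt_mark {t u : L.Term V} {p : List ℕ} {χ : List ℕ → Option V}
    (ht : subtermAt t p = some u) (h : ∀ q r, p = q ++ r → r ≠ [] → χ q = none) :
    subtermAt (mark t χ) p = some (mark u fun q => χ (p ++ q)) := by
  induction p generalizing t χ with
  | nil =>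
    simp only [subtermAt_nil, Option.some.injEq] at ht
    subst ht
    simp
  | cons i p ih =>
    obtain ⟨n, f, ts, j, rfl, rfl, h₁⟩ := subtermAt_cons_eq_some.1 ht
    rw [mark_func_of_none f ts (h [] _ rfl (by simp)), subtermAt_func_fin, ih h₁]
    · rfl
    · rintro q r rfl hr
      exact h (j :: q) r rfl hr

theorem subst_mark {t : L.Term V} {χ : List ℕ → Option V} {σ : V → L.Term V}
    (h : ∀ p x u, subtermAt t p = some u → χ p = some x → σ x = u)
    (h' : ∀ y ∈ vars t, σ y = Term.var y) : (mark t χ).subst σ = t := by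
  induction t generalizing χ with
  | var y =>
    cases hx : χ [] with
    | none => simpa [mark, hx, Term.subst] using h' y (by simp)
    | some x => simpa [mark, hx, Term.subst] using h [] x _ (by simp) hx
  | func f ts ih =>
    cases hx : χ [] with
    | none =>
      rw [mark_func_of_none f ts hx, Term.subst]
      congr 1
      funext i
      exact ih i (fun p x u hu hx => h (i :: p) x u (by simpa using hu) hx)
        fun y hy => h' y (mem_vars_func.2 ⟨i, hy⟩)
    | some x =>
      rw [mark_of_some hx, Term.subst]
      exact h [] x _ (by simp) hx

theorem isVarPos_mark {t : L.Term V} {χ : List ℕ → Option V} {p : List ℕ} {y : V}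
    (h : IsVarPos (mark t χ) y p) : χ p = some y ∨ IsVarPos t y p := by
  induction t generalizing χ p with
  | var z =>
    cases hx : χ [] with
    | none => exact Or.inr (by simpa [mark, hx] using h)
    | some x =>
      rw [mark_of_some hx, isVarPos_var] at h
      obtain ⟨rfl, rfl⟩ := h
      exact Or.inl hx
  | func f ts ih =>
    cases hx : χ [] with
    | none =>
      rw [mark_func_of_none f ts hx] at h
      cases p with
      | nil => simp at h
      | cons i p =>
        obtain ⟨m, g, us, j, hu, rfl, h⟩ := subtermAt_cons_eq_some.1 h
        cases hu
        simpa using ih j h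
    | some x =>
      rw [mark_of_some hx, isVarPos_var] at h
      obtain ⟨rfl, rfl⟩ := h
      exact Or.inl hx

theorem le_toCtx_mark {M : Ctx L V} {t : L.Term V} {χ : List ℕ → Option V} (h : M ≤ toCtx t)
    (hχ : ∀ p, χ p ≠ none → subtermAt M p = some hole) : M ≤ toCtx (mark t χ) := by
  induction t generalizing M χ with
  | var y =>
    cases hx : χ [] with
    | none => simpa [mark, hx] using h
    | some x =>
      have := hχ [] (by simp [hx])
      simp only [subtermAt_nil, Option.some.injEq] at this
      rw [this]
      exact hole_le _
  | func f ts ih =>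
    cases hx : χ [] with
    | none =>
      rw [mark_func_of_none f ts hx]
      rcases le_func_iff.1 h with rfl | ⟨Ms, rfl, hM⟩
      · exact hole_le _
      · exact Ctx.Le.func f _ _ fun i => ih i (hM i) fun p hp => by simpa using hχ (i :: p) hp
    | some x =>
      have := hχ [] (by simp [hx])
      simp only [subtermAt_nil, Option.some.injEq] at this
      rw [this]
      exact hole_le _

/-- Holes are not nested. -/
theorem hole_append {M D : Ctx L V} {p q : List ℕ} (h : subtermAt M p = some hole)
    (h' : subtermAt M (p ++ q) = some D) : q = [] :=
  IsVarPos.eq_nil_of_append (y := none) h h'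

/-! ### Representing a term by its marked tall aliens -/

/-- `a` is a tall alien of `s`: an alien that does not belong to `A`. -/
def IsTallAt (𝕃 : Set (Ctx L V)) (A : Set (L.Term V)) (s : L.Term V) (p : List ℕ)
    (a : L.Term V) : Prop := IsAlienAt (maxTop 𝕃 s) s p a ∧ a ∉ A

/-- The variables that are used by `χ`. -/
def marked (χ : List ℕ → Option V) : Set V := {x | ∃ p, χ p = some x}

/-- `χ` marks the tall aliens of `s` by fresh variables, and `σ` maps these variables to the
aliens. -/
structure IsRep (𝕃 : Set (Ctx L V)) (A : Set (L.Term V)) (s : L.Term V)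
    (χ : List ℕ → Option V) (σ : V → L.Term V) : Prop where
  dom : ∀ p, χ p ≠ none ↔ ∃ a, IsTallAt 𝕃 A s p a
  subst_eq : ∀ p x a, χ p = some x → subtermAt s p = some a → σ x = a
  subst_id : ∀ y, y ∉ marked χ → σ y = Term.var y
  fresh : ∀ x ∈ marked χ, x ∉ vars s
  -- Since the aliens of the marked term avoid the marks, the marks are variables of its layer. In
  -- particular the marked term is in `Grow 𝕃 A`, where confluence is already known.
  mem : mark s χ ∈ Grow 𝕃 (avoiding A (marked χ))

/-- One fresh variable is chosen for each pair of a tall alien and a key, from the infinite set that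
the key allows. The key thus decides which equal aliens share a variable: it will be the position,
the set of fusing terms, or a constant. -/
theorem exists_isRep [Nonempty V] (h𝕃 : IsVarRestrictedLayerSystem 𝕃) (hA : Good 𝕃 R A)
    (s : L.Term V) {K : Type*} (key : List ℕ → K) (allowed : K → Set V)
    (hkey : ∀ p a, IsTallAt 𝕃 A s p a → (allowed (key p)).Infinite ∧
      ∀ x ∈ allowed (key p), replaceAt (maxTop 𝕃 s) p (ctxVar x) ∈ 𝕃) :
    ∃ χ σ, IsRep 𝕃 A s χ σ ∧ ∀ p q a b, IsTallAt 𝕃 A s p a → IsTallAt 𝕃 A s q b →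
      (χ p = χ q ↔ a = b ∧ key p = key q) := by
  classical
  let F : Set (L.Term V × K) := {i | ∃ p, IsTallAt 𝕃 A s p i.1 ∧ key p = i.2}
  have hF : F.Finite := by
    refine ((finite_positions s).image fun p => ((subtermAt s p).getD s, key p)).subset ?_
    rintro ⟨a, k⟩ ⟨p, hp, rfl⟩
    have hsp : subtermAt s p = some a := hp.1.2
    exact ⟨p, ⟨a, hsp⟩, by simp [hsp]⟩
  obtain ⟨ν, hν, hinj⟩ := exists_injOn_choice hF (fun i => allowed i.2)
    (by rintro ⟨a, k⟩ ⟨p, hp, rfl⟩; exact (hkey p a hp).1) (vars_finite s)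
  let χ : List ℕ → Option V := fun p =>
    if h : ∃ a, IsTallAt 𝕃 A s p a then some (ν (h.choose, key p)) else none
  let σ : V → L.Term V := fun x => if h : ∃ i ∈ F, ν i = x then h.choose.1 else Term.var x
  have tall_unique : ∀ p a b, IsTallAt 𝕃 A s p a → subtermAt s p = some b → a = b := by
    intro p a b ha hb
    exact Option.some.inj (ha.1.2.symm.trans hb)
  have hχ : ∀ p a, IsTallAt 𝕃 A s p a → χ p = some (ν (a, key p)) := by
    intro p a ha
    have h : ∃ a, IsTallAt 𝕃 A s p a := ⟨a, ha⟩
    simp only [χ, dif_pos h]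
    rw [tall_unique p _ a h.choose_spec ha.1.2]
  have hχ' : ∀ p x, χ p = some x → ∃ a, IsTallAt 𝕃 A s p a ∧ x = ν (a, key p) := by
    intro p x hx
    by_cases h : ∃ a, IsTallAt 𝕃 A s p a
    · obtain ⟨a, ha⟩ := h
      rw [hχ p a ha] at hx
      exact ⟨a, ha, (Option.some.inj hx).symm⟩
    · simp [χ, dif_neg h] at hx
  have hσ : ∀ i ∈ F, σ (ν i) = i.1 := by
    intro i hi
    have h : ∃ j ∈ F, ν j = ν i := ⟨i, hi, rfl⟩
    simp only [σ, dif_pos h]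
    rw [hinj h.choose_spec.1 hi h.choose_spec.2]
  have hdom : ∀ p, χ p ≠ none ↔ ∃ a, IsTallAt 𝕃 A s p a := by
    intro p
    constructor
    · intro h
      obtain ⟨x, hx⟩ := Option.ne_none_iff_exists'.1 h
      obtain ⟨a, ha, -⟩ := hχ' p x hx
      exact ⟨a, ha⟩
    · rintro ⟨a, ha⟩
      simp [hχ p a ha]
  have hfresh : ∀ x ∈ marked χ, x ∉ vars s := by
    rintro x ⟨p, hx⟩
    obtain ⟨a, ha, rfl⟩ := hχ' p x hx
    exact (hν (a, key p) ⟨p, ha, rfl⟩).2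
  have hhole : ∀ p, χ p ≠ none → subtermAt (maxTop 𝕃 s) p = some hole := by
    intro p hp
    obtain ⟨a, ha⟩ := (hdom p).1 hp
    exact ha.1.1
  refine ⟨χ, σ, ⟨hdom, ?_, ?_, hfresh, ?_⟩, ?_⟩
  · intro p x a hx ha
    obtain ⟨a', ha', rfl⟩ := hχ' p x hx
    rw [hσ (a', key p) ⟨p, ha', rfl⟩]
    exact tall_unique p a' a ha' ha
  · intro y hy
    refine dif_neg ?_
    rintro ⟨⟨a, k⟩, ⟨p, hp, rfl⟩, rfl⟩
    exact hy ⟨p, hχ p a hp⟩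
  · have hMb : maxTop 𝕃 s ≤ toCtx (mark s χ) := le_toCtx_mark (maxTop_le h𝕃 s) hhole
    have hMM : maxTop 𝕃 s ≤ maxTop 𝕃 (mark s χ) := le_maxTop h𝕃 (maxTop_mem h𝕃 s) hMb
    have hsub : ∀ p u D, subtermAt s p = some u → subtermAt (maxTop 𝕃 s) p = some D →
        subtermAt (mark s χ) p = some (mark u fun q => χ (p ++ q)) := by
      intro p u D hu hD
      refine subtermAt_mark hu ?_
      rintro q r rfl hr
      by_contra hq
      exact hr (hole_append (hhole q hq) hD)
    -- Each mark is admissible by itself in the hole that it fills. Maximality of the max-top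
    -- combines these one-variable extensions, although they need not be admissible simultaneously
    -- by (L2') alone.
    have hvar : ∀ p x, χ p = some x → subtermAt (maxTop 𝕃 (mark s χ)) p = some (ctxVar x) := by
      intro p x hx
      have hp := hhole p (by simp [hx])
      obtain ⟨a, ha, rfl⟩ := hχ' p x hx
      have hb : subtermAt (mark s χ) p = some (Term.var (ν (a, key p))) := by
        rw [hsub p a hole ha.1.2 hp, mark_of_some (by simpa using hx)]
      have h1 : replaceAt (maxTop 𝕃 s) p (ctxVar (ν (a, key p))) ≤ toCtx (mark s χ) := by
        refine replaceAt_le ⟨_, hp⟩ ?_ (subtermAt_toCtx hb) le_rfl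
        rwa [replaceAt_self hp]
      have h2 := le_maxTop h𝕃 ((hkey p a ha).2 _ (hν (a, key p) ⟨p, ha, rfl⟩).1) h1
      obtain ⟨D, hD, hle⟩ := subtermAt_mono h2 (subtermAt_replaceAt ⟨_, hp⟩ _)
      rw [hD, ctxVar_le_iff.1 hle]
    refine ⟨_, maxTop_mem h𝕃 (mark s χ), fits_iff.2 ⟨maxTop_le h𝕃 _, ?_⟩⟩
    intro p c hc
    obtain ⟨q, r, rfl, hq⟩ := hole_above_of_hole hMM hc.1
    have hqx : χ q = none := by
      by_contra hq'
      obtain ⟨x, hx⟩ := Option.ne_none_iff_exists'.1 hq'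
      have h := hvar q x hx
      obtain rfl : r = [] := IsVarPos.eq_nil_of_append (y := some x) h hc.1
      rw [List.append_nil] at hc
      have h' := hc.1
      rw [h] at h'
      exact ctxVar_ne_hole x (Option.some.inj h')
    obtain ⟨C, hC, -⟩ := subtermAt_mono (maxTop_le h𝕃 s) hq
    obtain ⟨a, ha, -⟩ := subtermAt_toCtx_eq_some.1 hC
    have hb : subtermAt (mark s χ) q = some a := by
      rw [hsub q a hole ha hq, mark_of_none]
      intro r'
      by_contra hr'
      have h := hole_append hq (hhole _ hr')
      subst h
      simp [hqx] at hr'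
    have haA : a ∈ A := by
      by_contra haA
      exact (hdom q).2 ⟨a, ⟨hq, ha⟩, haA⟩ hqx
    have hca : subtermAt a r = some c := by
      rw [← subtermAt_append_of_eq hb]
      exact hc.2
    constructor
    · by_cases hr : r = []
      · subst hr
        simp only [subtermAt_nil, Option.some.injEq] at hca
        rwa [← hca]
      · exact hA.aliens _ q a r c (isFunPos_of_subtermAt_append hr hc.1) hb haA hc
    · intro y hy hyc
      exact hfresh y hy (vars_subset_of_subtermAt ha (vars_subset_of_subtermAt hca hyc))
  · intro p q a b ha hb
    rw [hχ p a ha, hχ q b hb, Option.some.injEq]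
    constructor
    · intro h
      have := hinj (show (a, key p) ∈ F from ⟨p, ha, rfl⟩) (show (b, key q) ∈ F from ⟨q, hb, rfl⟩) h
      simpa using this
    · rintro ⟨rfl, h⟩
      rw [h]

/-! ### Elementary properties of representations -/

section Rep

variable {s : L.Term V} {χ : List ℕ → Option V} {σ : V → L.Term V}

theorem IsRep.hole (h : IsRep 𝕃 A s χ σ) {p : List ℕ} (hp : χ p ≠ none) :
    subtermAt (maxTop 𝕃 s) p = some hole := by
  obtain ⟨a, ha⟩ := (h.dom p).1 hp
  exact ha.1.1

theorem IsRep.subst_mark (h : IsRep 𝕃 A s χ σ) : (mark s χ).subst σ = s :=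
  LayerSystems.subst_mark (fun p x u hu hx => h.subst_eq p x u hx hu)
    fun y hy => h.subst_id y fun hy' => h.fresh y hy' hy

theorem IsRep.le_toCtx_mark (h𝕃 : IsVarRestrictedLayerSystem 𝕃) (h : IsRep 𝕃 A s χ σ) :
    maxTop 𝕃 s ≤ toCtx (mark s χ) :=
  LayerSystems.le_toCtx_mark (maxTop_le h𝕃 s) fun _ hp => h.hole hp

theorem IsRep.isVarPos_mark_iff (h : IsRep 𝕃 A s χ σ) {x : V} (hx : x ∈ marked χ)
    {p : List ℕ} : IsVarPos (mark s χ) x p ↔ χ p = some x := by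
  constructor
  · intro hp
    exact (isVarPos_mark hp).resolve_right fun h' => h.fresh x hx ⟨p, h'⟩
  · intro hp
    obtain ⟨a, ha⟩ := (h.dom p).1 (by simp [hp])
    have := subtermAt_mark (χ := χ) ha.1.2 (by
      rintro q r rfl hr
      by_contra hq
      exact hr (hole_append (h.hole hq) ha.1.1))
    rw [mark_of_some (t := a) (χ := fun q => χ (p ++ q)) (x := x) (by simpa using hp)] at this
    exact this

/-- A step whose redex pattern is not affected by the marks. -/
theorem IsRep.step_mark (h : IsRep 𝕃 A s χ σ) {t : L.Term V} {ρ : L.Term V × L.Term V}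
    {p : List ℕ} (hρ : ρ ∈ R.rules) (hst : StepAt ρ p s t)
    (hpre : ∀ q r, p = q ++ r → r ≠ [] → χ q = none)
    (hfun : ∀ q, IsFunPos ρ.1 q → χ (p ++ q) = none)
    (hcons : ∀ z q₁ q₂ r, IsVarPos ρ.1 z q₁ → IsVarPos ρ.1 z q₂ →
      χ (p ++ (q₁ ++ r)) = χ (p ++ (q₂ ++ r))) :
    ∃ b', StepAt ρ p (mark s χ) b' ∧ b'.subst σ = t := by
  classical
  obtain ⟨θ, hs, rfl⟩ := hst
  let τ : V → L.Term V := fun z => if hz : ∃ q, IsVarPos ρ.1 z q then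
    mark (θ z) fun r => χ (p ++ (hz.choose ++ r)) else Term.var z
  have h1 : subtermAt (mark s χ) p = some (ρ.1.subst τ) := by
    rw [subtermAt_mark hs hpre, subst_eq_psubst, mark_psubst _ _ hfun, subst_eq_psubst]
    congr 1
    refine psubst_congr fun q z hq => ?_
    have hz : ∃ q, IsVarPos ρ.1 z q := ⟨q, hq⟩
    simp only [τ, dif_pos hz]
    congr 1
    funext r
    exact hcons z _ _ r hq hz.choose_spec
  have h2 : (ρ.1.subst τ).subst σ = ρ.1.subst θ := by
    have := subtermAt_subst h1 σ
    rw [h.subst_mark, hs] at this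
    exact (Option.some.inj this).symm
  refine ⟨_, ⟨τ, h1, rfl⟩, ?_⟩
  rw [subst_replaceAt ⟨_, h1⟩, h.subst_mark]
  congr 1
  rw [psubst_psubst_subst] at h2 ⊢
  exact subst_congr fun y hy => subst_inj_on_vars h2 (R.vars_rhs_subset ρ hρ hy)

end Rep

/-! ### Filling in marked variables -/

open Classical in
/-- The positional substitution that fills `φ p` in for the variables from `X`. -/
noncomputable def fill (X : Set V) (φ : List ℕ → L.Term V) (p : List ℕ) (y : V) : L.Term V :=
  if y ∈ X then φ p else Term.var y

theorem fill_of_mem {X : Set V} {φ : List ℕ → L.Term V} {p : List ℕ} {y : V} (h : y ∈ X) :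
    fill X φ p y = φ p := if_pos h

theorem fill_of_notMem {X : Set V} {φ : List ℕ → L.Term V} {p : List ℕ} {y : V} (h : y ∉ X) :
    fill X φ p y = Term.var y := if_neg h

theorem psubst_fill_eq_self {X : Set V} (φ : List ℕ → L.Term V) {t : L.Term V} {ψ : List ℕ → List ℕ}
    (h : ∀ y ∈ vars t, y ∉ X) : (psubst t fun p => fill X φ (ψ p)) = t := by
  conv_rhs => rw [← psubst_id t]
  exact psubst_congr fun p y hp => fill_of_notMem (h y ⟨p, hp⟩)

theorem psubst_fill_congr {X : Set V} {φ ψ : List ℕ → L.Term V} {t : L.Term V}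
    (h : ∀ p, ∀ x ∈ X, IsVarPos t x p → φ p = ψ p) :
    psubst t (fill X φ) = psubst t (fill X ψ) := by
  refine psubst_congr fun p y hp => ?_
  by_cases hy : y ∈ X
  · rw [fill_of_mem hy, fill_of_mem hy, h p y hy hp]
  · rw [fill_of_notMem hy, fill_of_notMem hy]

theorem rtc_psubst_fill {S : Set (L.Term V × L.Term V)} {X : Set V} {φ ψ : List ℕ → L.Term V}
    {t : L.Term V} (h : ∀ p, ∀ x ∈ X, IsVarPos t x p → ReflTransGen (Step S) (φ p) (ψ p)) :
    ReflTransGen (Step S) (psubst t (fill X φ)) (psubst t (fill X ψ)) := by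
  refine rtc_psubst t fun p y hp => ?_
  by_cases hy : y ∈ X
  · rw [fill_of_mem hy, fill_of_mem hy]
    exact h p y hy hp
  · rw [fill_of_notMem hy, fill_of_notMem hy]

theorem psubst_psubst (t : L.Term X) (φ : List ℕ → X → L.Term Y) (ψ : List ℕ → Y → L.Term Z) :
    psubst (psubst t φ) ψ = psubst t fun p y => psubst (φ p y) fun q => ψ (p ++ q) := by
  induction t generalizing φ ψ with
  | var y => rfl
  | func f ts ih => simp only [psubst, ih]; rfl

open Classical in
/-- Replace the variables from `X` by holes. -/
noncomputable def eraseVars (X : Set V) (C : Ctx L V) : Ctx L V :=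
  C.subst fun o => if ∃ x ∈ X, o = some x then hole else Term.var o

@[simp] theorem eraseVars_hole (X : Set V) : eraseVars X (hole : Ctx L V) = hole := by
  simp [eraseVars, hole, Term.subst]

theorem eraseVars_ctxVar_of_mem {X : Set V} {x : V} (h : x ∈ X) :
    eraseVars X (ctxVar x : Ctx L V) = hole := by
  simp [eraseVars, ctxVar, Term.subst, h]

theorem eraseVars_ctxVar_of_notMem {X : Set V} {x : V} (h : x ∉ X) :
    eraseVars X (ctxVar x : Ctx L V) = ctxVar x := by
  simp [eraseVars, ctxVar, Term.subst, h]

theorem eraseVars_mem (h𝕃 : IsVarRestrictedLayerSystem 𝕃) (X : Set V) {C : Ctx L V}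
    (hC : C ∈ 𝕃) : eraseVars X C ∈ 𝕃 := by
  classical
  rw [eraseVars, subst_eq_psubst]
  refine psubst_erase_mem h𝕃 hC fun p o _ => ?_
  by_cases h : ∃ x ∈ X, o = some x
  · exact Or.inl (if_pos h)
  · exact Or.inr (if_neg h)

theorem subtermAt_eraseVars {X : Set V} {C D : Ctx L V} {p : List ℕ}
    (h : subtermAt C p = some D) : subtermAt (eraseVars X C) p = some (eraseVars X D) :=
  subtermAt_subst h _

theorem subtermAt_eraseVars_eq_hole {X : Set V} {C : Ctx L V} {p : List ℕ}
    (h : subtermAt (eraseVars X C) p = some hole) :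
    subtermAt C p = some hole ∨ ∃ x ∈ X, subtermAt C p = some (ctxVar x) := by
  classical
  obtain ⟨q, r, o, rfl, ho, h⟩ := isVarPos_subst.1 (show IsVarPos _ none p from h)
  obtain rfl : r = [] := by
    split_ifs at h
    · exact (isVarPos_var.1 h).1
    · exact (isVarPos_var.1 h).1
  rw [List.append_nil]
  split_ifs at h with h'
  · obtain ⟨x, hx, rfl⟩ := h'
    exact Or.inr ⟨x, hx, ho⟩
  · obtain ⟨-, rfl⟩ := isVarPos_var.1 h
    exact Or.inl ho

/-- Erasing the marks turns their positions into holes, which accept any filling; the old aliens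
contain no marks and are left unchanged. -/
theorem Fits.psubst_fill {B : Set (L.Term V)} {X : Set V} {M : Ctx L V} {b : L.Term V}
    {φ : List ℕ → L.Term V} (hf : Fits (avoiding A X) M b) (hAB : A ⊆ B)
    (hφ : ∀ p, ∀ x ∈ X, IsVarPos b x p → φ p ∈ B) :
    Fits B (eraseVars X M) (psubst b (fill X φ)) := by
  suffices h : ∀ φ' : List ℕ → V → L.Term V, (∀ p, ∀ x ∈ X, IsVarPos b x p → φ' p x ∈ B) →
      (∀ p y, y ∉ X → φ' p y = Term.var y) → Fits B (eraseVars X M) (psubst b φ') by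
    refine h _ (fun p x hx hp => ?_) fun p y hy => fill_of_notMem hy
    rw [fill_of_mem hx]
    exact hφ p x hx hp
  clear hφ φ
  intro φ h1 h2
  induction hf generalizing φ with
  | hole t h =>
    rw [eraseVars_hole]
    refine Fits.hole _ ?_
    rw [psubst_congr (ψ := fun _ => Term.var), psubst_id]
    · exact hAB h.1
    · exact fun p y hp => h2 p y fun hy => h.2 y hy ⟨p, hp⟩
  | var y =>
    by_cases hy : y ∈ X
    · rw [eraseVars_ctxVar_of_mem hy]
      exact Fits.hole _ (h1 [] y hy (by simp [IsVarPos]))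
    · rw [eraseVars_ctxVar_of_notMem hy, psubst, h2 _ _ hy]
      exact Fits.var y
  | func f Ms ts _ ih =>
    exact Fits.func f _ _ fun i => ih i _
      (fun p x hx hp => h1 _ x hx (by simpa using hp)) fun p y hy => h2 _ y hy

theorem isVarPos_of_fits_avoiding {X : Set V} {M : Ctx L V} {b : L.Term V}
    (hf : Fits (avoiding A X) M b) {x : V} (hx : x ∈ X) {p : List ℕ} (hp : IsVarPos b x p) :
    subtermAt M p = some (ctxVar x) := by
  rcases hole_above hf.le (subtermAt_toCtx hp) with h | ⟨y, hy, h⟩ | ⟨q, r, rfl, hq⟩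
  · obtain ⟨n, f, ts, h⟩ := h.mono hf.le
    rw [subtermAt_toCtx hp] at h
    simp [ctxVar] at h
  · rw [h, ← hy]
    rfl
  · obtain ⟨u, hu, h⟩ := hf.subtermAt hq
    exact absurd ⟨r, (isVarPos_append hu).1 hp⟩ ((fits_hole_iff.1 h).2 x hx)

/-! ### Tall aliens after rewriting a representation -/

section Fill

variable {X : Set V} {b : L.Term V} {φ : List ℕ → L.Term V}

theorem fill_mem_grow [Nonempty V] (h𝕃 : IsVarRestrictedLayerSystem 𝕃)
    (hb : b ∈ Grow 𝕃 (avoiding A X))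
    (hφ : ∀ p, ∀ x ∈ X, IsVarPos b x p → φ p ∈ Grow 𝕃 A) :
    psubst b (fill X φ) ∈ Grow 𝕃 (Grow 𝕃 A) := by
  obtain ⟨M, hM, hf⟩ := hb
  exact ⟨_, eraseVars_mem h𝕃 X hM, hf.psubst_fill (subset_grow h𝕃 A) hφ⟩

/-- Filling `b` creates no tall aliens except at the filled positions themselves. The max-top
contains the layer of `b` with its marks erased, so an alien lies at or below an old hole or a
filled position. Below an old hole it is in `A` as `A` is good; strictly below a filled position it
is in `A` because the filling is in `Grow 𝕃 A`. -/
theorem exists_isVarPos_of_isTallAt [Nonempty V] (h𝕃 : IsVarRestrictedLayerSystem 𝕃)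
    (hA : Good 𝕃 R A) (hb : b ∈ Grow 𝕃 (avoiding A X))
    (hφ : ∀ p, ∀ x ∈ X, IsVarPos b x p → φ p ∈ Grow 𝕃 A) {p : List ℕ} {a : L.Term V}
    (ha : IsTallAt 𝕃 A (psubst b (fill X φ)) p a) : ∃ x ∈ X, IsVarPos b x p := by
  obtain ⟨M, hM, hf⟩ := hb
  have hle := le_maxTop h𝕃 (eraseVars_mem h𝕃 X hM)
    (hf.psubst_fill (subset_grow h𝕃 A) hφ).le
  obtain ⟨q, r, rfl, hq⟩ := hole_above_of_hole hle ha.1.1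
  rcases subtermAt_eraseVars_eq_hole hq with hq | ⟨x, hx, hq⟩
  · exfalso
    obtain ⟨c, hc, hcA⟩ := hf.subtermAt hq
    rw [fits_hole_iff] at hcA
    have hZ : subtermAt (psubst b (fill X φ)) q = some c := by
      rw [subtermAt_psubst hc, psubst_fill_eq_self φ fun y hy hyX => hcA.2 y hyX hy]
    by_cases hr : r = []
    · subst hr
      have h := ha.1.2
      rw [List.append_nil, hZ] at h
      cases h
      exact ha.2 hcA.1
    · exact ha.2 (hA.aliens _ q c r a (isFunPos_of_subtermAt_append hr ha.1.1) hZ hcA.1 ha.1)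
  · obtain ⟨c, hc, hcx⟩ := hf.subtermAt hq
    rw [fits_ctxVar_iff] at hcx
    subst hcx
    have hZ : subtermAt (psubst b (fill X φ)) q = some (φ q) := by
      rw [subtermAt_psubst_var hc, fill_of_mem hx]
    by_cases hr : r = []
    · subst hr
      exact ⟨x, hx, by simpa [IsVarPos] using hc⟩
    · exact absurd (hA.mem_of_isAlienAt h𝕃 (isFunPos_of_subtermAt_append hr ha.1.1) hZ
        (hφ q x hx hc) ha.1) ha.2

/-- Since the tall aliens of the filled term occupy filled positions, its marked form is again a
filling of the same `b`: at each position either the filling stays or a variable takes its place. -/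
theorem IsRep.mark_fill [Nonempty V] (h𝕃 : IsVarRestrictedLayerSystem 𝕃)
    (hA : Good 𝕃 R A) (hb : b ∈ Grow 𝕃 (avoiding A X))
    (hφ : ∀ p, ∀ x ∈ X, IsVarPos b x p → φ p ∈ Grow 𝕃 A) {χ : List ℕ → Option V}
    {σ : V → L.Term V} (h : IsRep 𝕃 A (psubst b (fill X φ)) χ σ) :
    mark (psubst b (fill X φ)) χ =
      psubst b (fill X fun p => ((χ p).map Term.var).getD (φ p)) := by
  have htall : ∀ p, χ p ≠ none → ∃ x ∈ X, IsVarPos b x p := by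
    intro p hp
    obtain ⟨a, ha⟩ := (h.dom p).1 hp
    exact exists_isVarPos_of_isTallAt h𝕃 hA hb hφ ha
  rw [mark_psubst]
  · refine psubst_congr fun p y hp => ?_
    have hsub : ∀ q, χ (p ++ q) ≠ none → q = [] := by
      intro q hq
      obtain ⟨x, -, hx⟩ := htall _ hq
      exact hp.eq_nil_of_append hx
    cases hχ : χ p with
    | some x' =>
      obtain ⟨x, hx, hxp⟩ := htall p (by simp [hχ])
      obtain rfl := hp.unique hxp
      rw [mark_of_some (x := x') (by simpa using hχ), fill_of_mem hx]
      simp [hχ]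
    | none =>
      rw [mark_of_none]
      · by_cases hy : y ∈ X
        · rw [fill_of_mem hy, fill_of_mem hy]
          simp [hχ]
        · rw [fill_of_notMem hy, fill_of_notMem hy]
      · intro q
        by_contra hq
        obtain rfl := hsub q hq
        exact hq (by simpa using hχ)
  · intro p hp
    by_contra hχ
    obtain ⟨x, -, hx⟩ := htall p hχ
    exact hx.not_isFunPos hp

theorem le_toCtx_psubst_fill {M : Ctx L V} (hM : M ≤ toCtx b)
    (h : ∀ p, ∀ x ∈ X, IsVarPos b x p → subtermAt M p = some hole) :
    M ≤ toCtx (psubst b (fill X φ)) := by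
  suffices H : ∀ φ' : List ℕ → V → L.Term V, (∀ p y, y ∉ X → φ' p y = Term.var y) →
      M ≤ toCtx (psubst b φ') from H _ fun p y hy => fill_of_notMem hy
  intro ψ hψ
  induction b generalizing M ψ with
  | var y =>
    by_cases hy : y ∈ X
    · have := h [] y hy (by simp [IsVarPos])
      simp only [subtermAt_nil, Option.some.injEq] at this
      rw [this]
      exact hole_le _
    · rwa [psubst, hψ _ _ hy]
  | func f ts ih =>
    rcases le_func_iff.1 hM with rfl | ⟨Ms, rfl, hMs⟩
    · exact hole_le _
    · exact Ctx.Le.func f _ _ fun i => ih i (hMs i)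
        (fun p x hx hp => by simpa using h (i :: p) x hx (by simpa using hp)) _
        fun p y hy => hψ _ y hy

end Fill

/-- The value of the variable at a position under a substitution. -/
def valAt (b : L.Term V) (τ : V → L.Term V) (p : List ℕ) : L.Term V :=
  ((subtermAt b p).getD b).subst τ

theorem valAt_of_isVarPos {b : L.Term V} {x : V} {p : List ℕ} (h : IsVarPos b x p)
    (τ : V → L.Term V) : valAt b τ p = τ x := by
  rw [IsVarPos] at h
  simp [valAt, h, Term.subst]

theorem subst_eq_fill {X : Set V} (b : L.Term V) {τ : V → L.Term V}
    (hτ : ∀ y, y ∉ X → τ y = Term.var y) : b.subst τ = psubst b (fill X (valAt b τ)) := by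
  rw [subst_eq_psubst]
  refine psubst_congr fun p y hp => ?_
  by_cases hy : y ∈ X
  · rw [fill_of_mem hy, valAt_of_isVarPos hp]
  · rw [fill_of_notMem hy, hτ y hy]

/-! ### Short and tall steps -/

section Main

variable (R) in
/-- A short step rewrites the representation of a term. -/
def Short (χ : L.Term V → List ℕ → Option V) (σ : L.Term V → V → L.Term V)
    (s t : L.Term V) : Prop :=
  ∃ b, ReflTransGen R.Rel (mark s (χ s)) b ∧ b.subst (σ s) = t

variable (R) in
/-- A tall step rewrites the tall aliens of a term, to `n` different terms. -/
def Tall (χ : L.Term V → List ℕ → Option V) (σ : L.Term V → V → L.Term V) (n : ℕ)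
    (s t : L.Term V) : Prop :=
  ∃ φ : List ℕ → L.Term V, (∀ p x, χ s p = some x → ReflTransGen R.Rel (σ s x) (φ p)) ∧
    t = psubst (mark s (χ s)) (fill (marked (χ s)) φ) ∧
    n = (φ '' {p | χ s p ≠ none}).ncard

/-- A choice of representations, with a measure, that makes the diagrams for short and tall steps
decreasing. -/
structure RepSystem {Λ : Type*} [LinearOrder Λ] (𝕃 : Set (Ctx L V)) (R : TRS L V)
    (A : Set (L.Term V)) (χ : L.Term V → List ℕ → Option V) (σ : L.Term V → V → L.Term V)
    (μ : L.Term V → Λ) : Prop where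
  rep : ∀ s ∈ Grow 𝕃 (Grow 𝕃 A), IsRep 𝕃 A s (χ s) (σ s)
  -- This keeps redexes of non-linear rules intact when the tall aliens are marked.
  cons : ∀ s ∈ Grow 𝕃 (Grow 𝕃 A), ∀ ρ ∈ R.rules, ∀ p t, StepAt ρ p s t →
    IsFunPos (maxTop 𝕃 s) p → ∀ z q₁ q₂ r, IsVarPos ρ.1 z q₁ → IsVarPos ρ.1 z q₂ →
      χ s (p ++ (q₁ ++ r)) = χ s (p ++ (q₂ ++ r))
  mono : ∀ s ∈ Grow 𝕃 (Grow 𝕃 A), ∀ b ζ, ReflTransGen R.Rel (mark s (χ s)) b →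
    (∀ p, ∀ x ∈ marked (χ s), IsVarPos b x p → ReflTransGen R.Rel (σ s x) (ζ p)) →
      μ (psubst b (fill (marked (χ s)) ζ)) ≤ μ s
  -- Either the measure drops, after which any rewriting is below the current label, or what could
  -- be done with the old marked term can be done with the new one. This disjunction is the only
  -- place where the three cases of the theorem differ essentially.
  lift : ∀ s ∈ Grow 𝕃 (Grow 𝕃 A), ∀ b τ, ReflTransGen R.Rel (mark s (χ s)) b →
    (∀ x ∈ marked (χ s), ReflTransGen R.Rel (σ s x) (τ x)) →
    (∀ y, y ∉ marked (χ s) → τ y = Term.var y) →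
    μ (b.subst τ) < μ s ∨ ∀ c, ReflTransGen R.Rel b c → Short R χ σ (b.subst τ) (c.subst τ)

variable {Λ : Type*} [LinearOrder Λ] {χ : L.Term V → List ℕ → Option V}
  {σ : L.Term V → V → L.Term V} {μ : L.Term V → Λ}

theorem IsRep.marked_alien_mem [Nonempty V] (h𝕃 : IsVarRestrictedLayerSystem 𝕃)
    (hW : WeaklyLayered 𝕃 R) (hA : Good 𝕃 R A) {s : L.Term V} (hs : s ∈ Grow 𝕃 (Grow 𝕃 A))
    {χ : List ℕ → Option V} {σ : V → L.Term V} (h : IsRep 𝕃 A s χ σ) {x : V}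
    (hx : x ∈ marked χ) : σ x ∈ Grow 𝕃 A := by
  obtain ⟨p, hp⟩ := hx
  obtain ⟨a, ha⟩ := (h.dom p).1 (by simp [hp])
  rw [h.subst_eq p x a hp ha.1.2]
  exact (fits_iff.1 ((hA.grow h𝕃 hW).fits_maxTop h𝕃 hs)).2 p a ha.1

theorem IsRep.finite_dom {s : L.Term V} {χ : List ℕ → Option V} {σ : V → L.Term V}
    (h : IsRep 𝕃 A s χ σ) : {p | χ p ≠ none}.Finite := by
  refine (finite_positions s).subset fun p hp => ?_
  obtain ⟨a, ha⟩ := (h.dom p).1 hp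
  exact ⟨a, ha.1.2⟩

theorem IsRep.eq_fill {s : L.Term V} {χ : List ℕ → Option V} {σ : V → L.Term V}
    (h : IsRep 𝕃 A s χ σ) :
    s = psubst (mark s χ) (fill (marked χ) (valAt (mark s χ) σ)) := by
  conv_lhs => rw [← h.subst_mark]
  exact subst_eq_fill _ h.subst_id

theorem Short.rtc (hrep : ∀ s ∈ Grow 𝕃 (Grow 𝕃 A), IsRep 𝕃 A s (χ s) (σ s)) {s t : L.Term V}
    (hs : s ∈ Grow 𝕃 (Grow 𝕃 A)) (h : Short R χ σ s t) : ReflTransGen R.Rel s t := by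
  obtain ⟨b, hb, rfl⟩ := h
  have := rtc_subst hb (σ s)
  rwa [(hrep s hs).subst_mark] at this

theorem Tall.rtc (hrep : ∀ s ∈ Grow 𝕃 (Grow 𝕃 A), IsRep 𝕃 A s (χ s) (σ s)) {s t : L.Term V}
    {n : ℕ} (hs : s ∈ Grow 𝕃 (Grow 𝕃 A)) (h : Tall R χ σ n s t) : ReflTransGen R.Rel s t := by
  obtain ⟨φ, h1, rfl, -⟩ := h
  conv_lhs => rw [(hrep s hs).eq_fill]
  refine rtc_psubst_fill fun p x hx hp => ?_
  rw [valAt_of_isVarPos hp]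
  exact h1 p x (((hrep s hs).isVarPos_mark_iff hx).1 hp)

/-- Every rewrite step is a short step or a tall step. -/
theorem RepSystem.short_or_tall (h𝕃 : IsVarRestrictedLayerSystem 𝕃)
    (hW : WeaklyLayered 𝕃 R) (H : RepSystem 𝕃 R A χ σ μ) {s t : L.Term V}
    (hs : s ∈ Grow 𝕃 (Grow 𝕃 A)) (h : R.Rel s t) :
    Short R χ σ s t ∨ ∃ n, Tall R χ σ n s t := by
  classical
  have hrep := H.rep s hs
  obtain ⟨ρ, hρ, p, h⟩ := h
  by_cases hp : IsFunPos (maxTop 𝕃 s) p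
  · left
    -- By (W) the left-hand side also matches the max-top, so no hole, and hence no mark, interferes
    -- with the redex pattern.
    obtain ⟨N, -, θ', hM, -⟩ := hW ρ hρ s t _ p (isMaxTop_maxTop h𝕃 s) hp h
    have hpre : ∀ q r, p = q ++ r → r ≠ [] → χ s q = none := by
      rintro q r rfl hr
      by_contra hq
      exact hr (hole_append (hrep.hole hq) hp.isPos.choose_spec)
    have hfun : ∀ q, IsFunPos ρ.1 q → χ s (p ++ q) = none := by
      intro q hq
      by_contra hq'
      obtain ⟨n, f, ts, hq⟩ := hq
      have h1 := hrep.hole hq'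
      rw [subtermAt_append_of_eq hM, subtermAt_subst hq] at h1
      exact func_ne_hole _ _ (Option.some.inj h1)
    obtain ⟨b', hb', hσ⟩ := hrep.step_mark hρ h hpre hfun (H.cons s hs ρ hρ p t h hp)
    exact ⟨b', .single ⟨ρ, hρ, p, hb'⟩, hσ⟩
  · obtain ⟨q, r, a, a', rfl, ha, haa', rfl⟩ := exists_alien_step hρ (maxTop_le h𝕃 s) hp h
    by_cases haA : a ∈ A
    · left
      have hnone : ∀ q' r₁ r₂, q' ++ r₁ = q ++ r₂ → χ s q' = none := by
        intro q' r₁ r₂ he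
        by_contra hq'
        have hh := hrep.hole hq'
        have : q' = q := by
          rcases List.append_eq_append_iff.1 he with ⟨c, rfl, -⟩ | ⟨c, rfl, -⟩
          · rw [hole_append hh ha.1, List.append_nil]
          · rw [hole_append ha.1 hh, List.append_nil]
        subst this
        obtain ⟨a₁, ha₁⟩ := (hrep.dom q').1 hq'
        have := ha₁.1.2.symm.trans ha.2
        cases this
        exact ha₁.2 haA
      obtain ⟨b', hb', hσ⟩ := hrep.step_mark hρ h
        (fun q₁ r₁ he _ => hnone q₁ r₁ r he.symm)
        (fun q₁ _ => hnone _ [] (r ++ q₁) (by simp)) (by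
          intro z q₁ q₂ r₁ _ _
          rw [hnone _ [] (r ++ (q₁ ++ r₁)) (by simp), hnone _ [] (r ++ (q₂ ++ r₁)) (by simp)])
      exact ⟨b', .single ⟨ρ, hρ, _, hb'⟩, hσ⟩
    · right
      obtain ⟨x, hx⟩ := Option.ne_none_iff_exists'.1 ((hrep.dom q).2 ⟨a, ha, haA⟩)
      have hxm : x ∈ marked (χ s) := ⟨q, hx⟩
      -- Only the occurrence at `q` changes, even if its mark is used elsewhere. For this reason
      -- tall steps are described by position and not by a substitution.
      refine ⟨_, fun p => if p = q then a' else valAt (mark s (χ s)) (σ s) p, ?_, ?_, rfl⟩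
      · intro p y hy
        have hym : y ∈ marked (χ s) := ⟨p, hy⟩
        dsimp only
        split_ifs with hpq
        · subst hpq
          rw [hx] at hy
          cases hy
          rw [hrep.subst_eq p x a hx ha.2]
          exact .single ⟨ρ, hρ, r, haa'⟩
        · rw [valAt_of_isVarPos ((hrep.isVarPos_mark_iff hym).2 hy)]
      · conv_lhs => rw [hrep.eq_fill]
        rw [replaceAt_psubst_var ((hrep.isVarPos_mark_iff hxm).2 hx)]
        refine psubst_congr fun p y hpy => ?_
        by_cases hpq : p = q
        · subst hpq
          obtain rfl := hpy.unique ((hrep.isVarPos_mark_iff hxm).2 hx)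
          simp [fill_of_mem hxm]
        · simp [fill, hpq]

/-- Rewriting the marked positions of a representation, by a tall and a short step. -/
theorem exists_tall_short [Nonempty V] (h𝕃 : IsVarRestrictedLayerSystem 𝕃)
    (hW : WeaklyLayered 𝕃 R) (hA : Good 𝕃 R A)
    (hrep : ∀ s ∈ Grow 𝕃 (Grow 𝕃 A), IsRep 𝕃 A s (χ s) (σ s)) {X : Set V} {b : L.Term V}
    (hb : b ∈ Grow 𝕃 (avoiding A X)) {ζ v : List ℕ → L.Term V}
    (hζ : ∀ p, ∀ x ∈ X, IsVarPos b x p → ζ p ∈ Grow 𝕃 A)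
    (hv : ∀ p, ∀ x ∈ X, IsVarPos b x p → ReflTransGen R.Rel (ζ p) (v p)) :
    ∃ w k, Tall R χ σ k (psubst b (fill X ζ)) w ∧ Short R χ σ w (psubst b (fill X v)) ∧
      k ≤ (v '' {p | ∃ x ∈ X, IsVarPos b x p}).ncard := by
  classical
  set z := psubst b (fill X ζ) with hz
  have hzG : z ∈ Grow 𝕃 (Grow 𝕃 A) := fill_mem_grow h𝕃 hb hζ
  have hrz := hrep z hzG
  have hmz := hrz.mark_fill h𝕃 hA hb hζ
  rw [← hz] at hmz
  have htall : ∀ p, χ z p ≠ none → ∃ x ∈ X, IsVarPos b x p := by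
    intro p hp
    obtain ⟨a, ha⟩ := (hrz.dom p).1 hp
    exact exists_isVarPos_of_isTallAt h𝕃 hA hb hζ ha
  have hzp : ∀ p, ∀ x ∈ X, IsVarPos b x p → subtermAt z p = some (ζ p) := by
    intro p x hx hp
    rw [hz, subtermAt_psubst_var hp, fill_of_mem hx]
  -- The tall step rewrites exactly the fillings that are tall aliens of `z`; the others are left
  -- for the short step.
  let ζ₁ : List ℕ → L.Term V := fun p => if χ z p = none then ζ p else v p
  have hζ₁ : ∀ p, ∀ x ∈ X, IsVarPos b x p → ζ₁ p ∈ Grow 𝕃 A := by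
    intro p x hx hp
    simp only [ζ₁]
    split_ifs
    · exact hζ p x hx hp
    · exact (hA.grow h𝕃 hW).closed_rtc (hζ p x hx hp) (hv p x hx hp)
  have hw : psubst (mark z (χ z)) (fill (marked (χ z)) v) = psubst b (fill X ζ₁) := by
    rw [hmz, psubst_psubst]
    refine psubst_congr fun p y hp => ?_
    by_cases hy : y ∈ X
    · rw [fill_of_mem hy, fill_of_mem hy]
      cases hχ : χ z p with
      | none =>
        simp only [Option.map_none, Option.getD_none, ζ₁, hχ, if_true]
        refine psubst_fill_eq_self (ψ := fun q => p ++ q) v fun y' hy' hm => hrz.fresh y' hm ?_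
        exact vars_subset_of_subtermAt (hzp p y hy hp) hy'
      | some x' =>
        have : x' ∈ marked (χ z) := ⟨p, hχ⟩
        simp [psubst, fill_of_mem this, ζ₁, hχ]
    · rw [fill_of_notMem hy, fill_of_notMem hy, psubst, fill_of_notMem]
      intro hm
      refine hrz.fresh y hm ⟨p, ?_⟩
      rw [IsVarPos, hz, subtermAt_psubst_var hp, fill_of_notMem hy]
  set w := psubst b (fill X ζ₁) with hwdef
  have hwG : w ∈ Grow 𝕃 (Grow 𝕃 A) := fill_mem_grow h𝕃 hb hζ₁
  have hrw := hrep w hwG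
  have hmw := hrw.mark_fill h𝕃 hA hb hζ₁
  rw [← hwdef] at hmw
  have hwp : ∀ p, ∀ x ∈ X, IsVarPos b x p → subtermAt w p = some (ζ₁ p) := by
    intro p x hx hp
    rw [hwdef, subtermAt_psubst_var hp, fill_of_mem hx]
  -- The tall step creates no new tall aliens: rewriting below holes leaves the max-top of `z` a top
  -- of `w`. So a filling that is a tall alien of `w`, but was not rewritten, sat below a hole of
  -- the max-top of `z` already, and that hole is at the same position. Hence the remaining
  -- rewriting to `v` takes place outside the marks of `w`.
  have hclaim : ∀ p, ∀ x ∈ X, IsVarPos b x p → χ w p ≠ none → χ z p ≠ none := by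
    intro p x hx hp hχw hχz
    obtain ⟨a, ha⟩ := (hrw.dom p).1 hχw
    have haζ : a = ζ p := by
      have := hwp p x hx hp
      rw [ha.1.2] at this
      simpa [ζ₁, hχz] using this
    have hle : maxTop 𝕃 z ≤ maxTop 𝕃 w := by
      refine le_maxTop h𝕃 (maxTop_mem h𝕃 z) ?_
      rw [← hw]
      refine le_toCtx_psubst_fill (hrz.le_toCtx_mark h𝕃) fun q y hy hq => ?_
      refine hrz.hole ?_
      rw [(hrz.isVarPos_mark_iff hy).1 hq]
      simp
    obtain ⟨q, r, rfl, hq⟩ := hole_above_of_hole hle ha.1.1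
    obtain ⟨M, hM, hf⟩ := hb
    have hpM := isVarPos_of_fits_avoiding hf hx hp
    have hle' : eraseVars X M ≤ maxTop 𝕃 z := le_maxTop h𝕃 (eraseVars_mem h𝕃 X hM)
      (hf.psubst_fill (subset_grow h𝕃 A) hζ).le
    obtain ⟨q₀, r₀, rfl, hq₀⟩ := hole_above_of_hole hle' hq
    have h3 := subtermAt_eraseVars (X := X) hpM
    rw [List.append_assoc] at h3
    have h4 := hole_append hq₀ h3
    obtain rfl : r = [] := (List.append_eq_nil_iff.1 h4).2
    rw [List.append_nil] at *
    exact (hrz.dom _).2 ⟨ζ (q₀ ++ r₀), ⟨hq, hzp _ x hx hp⟩, haζ ▸ ha.2⟩ hχz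
  refine ⟨w, _, ⟨v, ?_, hw.symm, rfl⟩, ⟨psubst b (fill X fun p =>
    ((χ w p).map Term.var).getD (v p)), ?_, ?_⟩, ?_⟩
  · intro p x' hx'
    obtain ⟨x, hx, hp⟩ := htall p (by simp [hx'])
    rw [hrz.subst_eq p x' _ hx' (hzp p x hx hp)]
    exact hv p x hx hp
  · rw [hmw]
    refine rtc_psubst_fill fun p x hx hp => ?_
    cases hχ : χ w p with
    | some x' => exact .refl
    | none =>
      simp only [Option.map_none, Option.getD_none, ζ₁]
      split_ifs
      · exact hv p x hx hp
      · exact .refl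
  · rw [subst_psubst]
    refine psubst_congr fun p y hp => ?_
    by_cases hy : y ∈ X
    · rw [fill_of_mem hy, fill_of_mem hy]
      cases hχ : χ w p with
      | some x' =>
        have h1 := hclaim p y hy hp (by simp [hχ])
        simp only [Option.map_some, Option.getD_some, Term.subst]
        rw [hrw.subst_eq p x' _ hχ (hwp p y hy hp)]
        simp [ζ₁, h1]
      | none =>
        simp only [Option.map_none, Option.getD_none]
        refine subst_eq_self fun y' hy' => hrw.subst_id y' fun hm => hrw.fresh y' hm ?_
        refine vars_subset_of_subtermAt (hwp p y hy hp) ?_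
        simp only [ζ₁]
        split_ifs
        · exact TRS.vars_subset_of_rtc (hv p y hy hp) hy'
        · exact hy'
    · rw [fill_of_notMem hy, fill_of_notMem hy, Term.subst]
      refine hrw.subst_id y fun hm => hrw.fresh y hm ⟨p, ?_⟩
      rw [IsVarPos, hwdef, subtermAt_psubst_var hp, fill_of_notMem hy]
  · refine Set.ncard_le_ncard (Set.image_mono fun p hp => htall p hp) ?_
    refine Set.Finite.image _ ((finite_positions b).subset ?_)
    rintro p ⟨x, -, hp⟩
    exact ⟨_, hp⟩

end Main

/-! ### The diagrams for short and tall steps -/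

section Diagrams

variable {Λ : Type*} [LinearOrder Λ] {χ : L.Term V → List ℕ → Option V}
  {σ : L.Term V → V → L.Term V} {μ : L.Term V → Λ}

/-- Short and tall steps, labelled. -/
def Labelled (𝕃 : Set (Ctx L V)) (R : TRS L V) (A : Set (L.Term V))
    (χ : L.Term V → List ℕ → Option V) (σ : L.Term V → V → L.Term V) (μ : L.Term V → Λ)
    (a : Λ ×ₗ ℕ) (s t : L.Term V) : Prop :=
  -- The shift to `n + 1` puts every tall step above the short steps of the same measure, including
  -- a tall step with no tall aliens.
  s ∈ Grow 𝕃 (Grow 𝕃 A) ∧ ((Short R χ σ s t ∧ a = toLex (μ s, 0)) ∨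
    ∃ n, Tall R χ σ n s t ∧ a = toLex (μ s, n + 1))

theorem toLex_lt_toLex_of_le {l m : Λ} {i j : ℕ} (h : l ≤ m) (hij : i < j) :
    toLex (l, i) < toLex (m, j) := by
  rw [Prod.Lex.toLex_lt_toLex]
  rcases h.lt_or_eq with h | h
  · exact Or.inl h
  · exact Or.inr ⟨h, hij⟩

theorem toLex_le_toLex_of_le {l m : Λ} {i j : ℕ} (h : l ≤ m) (hij : i ≤ j) :
    toLex (l, i) ≤ toLex (m, j) := by
  rw [Prod.Lex.toLex_le_toLex]
  rcases h.lt_or_eq with h | h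
  · exact Or.inl h
  · exact Or.inr ⟨h, hij⟩

theorem Labelled.rtc (H : RepSystem 𝕃 R A χ σ μ) {a : Λ ×ₗ ℕ} {s t : L.Term V}
    (h : Labelled 𝕃 R A χ σ μ a s t) : ReflTransGen R.Rel s t := by
  obtain ⟨hs, ⟨h, -⟩ | ⟨n, h, -⟩⟩ := h
  · exact h.rtc H.rep hs
  · exact h.rtc H.rep hs

theorem RepSystem.measure_le_of_short (H : RepSystem 𝕃 R A χ σ μ) {s t : L.Term V}
    (hs : s ∈ Grow 𝕃 (Grow 𝕃 A)) (h : Short R χ σ s t) : μ t ≤ μ s := by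
  obtain ⟨b, hb, rfl⟩ := h
  rw [subst_eq_fill b (H.rep s hs).subst_id]
  refine H.mono s hs b _ hb fun p x _ hp => ?_
  rw [valAt_of_isVarPos hp]

theorem RepSystem.measure_le_of_tall (H : RepSystem 𝕃 R A χ σ μ) {s t : L.Term V} {n : ℕ}
    (hs : s ∈ Grow 𝕃 (Grow 𝕃 A)) (h : Tall R χ σ n s t) : μ t ≤ μ s := by
  obtain ⟨φ, h1, rfl, -⟩ := h
  exact H.mono s hs _ _ .refl fun p x hx hp =>
    h1 p x (((H.rep s hs).isVarPos_mark_iff hx).1 hp)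

variable (h𝕃 : IsVarRestrictedLayerSystem 𝕃) (hW : WeaklyLayered 𝕃 R)
  (hA : Good 𝕃 R A) (H : RepSystem 𝕃 R A χ σ μ)
include h𝕃 hW H

theorem RepSystem.exists_labelled {s t : L.Term V} (hs : s ∈ Grow 𝕃 (Grow 𝕃 A))
    (h : R.Rel s t) : μ t ≤ μ s ∧ ∃ n, Labelled 𝕃 R A χ σ μ (toLex (μ s, n)) s t := by
  rcases H.short_or_tall h𝕃 hW hs h with h | ⟨n, h⟩
  · exact ⟨H.measure_le_of_short hs h, 0, hs, Or.inl ⟨h, rfl⟩⟩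
  · exact ⟨H.measure_le_of_tall hs h, n + 1, hs, Or.inr ⟨n, h, rfl⟩⟩

include hA

theorem RepSystem.measure_le_of_rtc [Nonempty V] {s t : L.Term V} (hs : s ∈ Grow 𝕃 (Grow 𝕃 A))
    (h : ReflTransGen R.Rel s t) : μ t ≤ μ s := by
  have hG := (hA.grow h𝕃 hW).grow h𝕃 hW
  induction h with
  | refl => exact le_rfl
  | tail h1 h2 ih => exact (H.exists_labelled h𝕃 hW (hG.closed_rtc hs h1) h2).1.trans ih

/-- The measure never increases along rewriting, so once it is below `l` every later step has a
label with a smaller first component, whatever its second component. -/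
theorem RepSystem.rtc_stepLT [Nonempty V] {s t : L.Term V} {l : Λ} (n : ℕ) (hs : s ∈ Grow 𝕃 (Grow 𝕃 A))
    (hl : μ s < l) (h : ReflTransGen R.Rel s t) :
    ReflTransGen (StepLT (Labelled 𝕃 R A χ σ μ) (toLex (l, n))) s t := by
  have hG := (hA.grow h𝕃 hW).grow h𝕃 hW
  induction h with
  | refl => exact .refl
  | tail h1 h2 ih =>
    have h3 := hG.closed_rtc hs h1
    obtain ⟨-, k, h4⟩ := H.exists_labelled h𝕃 hW h3 h2
    refine ih.tail ⟨_, ?_, h4⟩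
    rw [Prod.Lex.toLex_lt_toLex]
    exact Or.inl ((H.measure_le_of_rtc h𝕃 hW hA hs h1).trans_lt hl)

theorem RepSystem.stepThenLT_of_tall_short [Nonempty V] {s t z : L.Term V} {l : Λ} {k n : ℕ}
    (hs : s ∈ Grow 𝕃 (Grow 𝕃 A)) (hl : μ s ≤ l) (h1 : Tall R χ σ k s t)
    (h2 : Short R χ σ t z) (hk : k ≤ n) :
    StepThenLT (Labelled 𝕃 R A χ σ μ) (toLex (l, n + 1)) s z := by
  have hG := (hA.grow h𝕃 hW).grow h𝕃 hW
  have ht := hG.closed_rtc hs (h1.rtc H.rep hs)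
  refine ⟨t, Or.inr ⟨_, ?_, hs, Or.inr ⟨k, h1, rfl⟩⟩,
    .single ⟨_, ?_, ht, Or.inl ⟨h2, rfl⟩⟩⟩
  · exact toLex_le_toLex_of_le hl (Nat.succ_le_succ hk)
  · exact toLex_lt_toLex_of_le ((H.measure_le_of_tall hs h1).trans hl) n.succ_pos

theorem RepSystem.rtc_stepLT_of_tall_short [Nonempty V] {s t z : L.Term V} {l : Λ} {k n : ℕ}
    (hs : s ∈ Grow 𝕃 (Grow 𝕃 A)) (hl : μ s ≤ l) (h1 : Tall R χ σ k s t)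
    (h2 : Short R χ σ t z) (hk : k < n) :
    ReflTransGen (StepLT (Labelled 𝕃 R A χ σ μ) (toLex (l, n + 1))) s z := by
  have hG := (hA.grow h𝕃 hW).grow h𝕃 hW
  have ht := hG.closed_rtc hs (h1.rtc H.rep hs)
  refine .head ⟨_, ?_, hs, Or.inr ⟨k, h1, rfl⟩⟩ (.single ⟨_, ?_, ht, Or.inl ⟨h2, rfl⟩⟩)
  · exact toLex_lt_toLex_of_le hl (Nat.succ_lt_succ hk)
  · exact toLex_lt_toLex_of_le ((H.measure_le_of_tall hs h1).trans hl) n.succ_pos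

variable [Nonempty V] (hcr : CROn R.Rel (Grow 𝕃 A))
include hcr

/-- Confluence of the tall aliens gives a single map `v` that sends both versions of each alien to
the same reduct. Applying a map cannot increase the number of different terms, which bounds the new
labels by the old ones. -/
theorem RepSystem.tall_tall {s x y : L.Term V} {n m : ℕ} (hs : s ∈ Grow 𝕃 (Grow 𝕃 A))
    (hx : Tall R χ σ n s x) (hy : Tall R χ σ m s y) :
    ∃ z x' y' i j, i ≤ n ∧ i ≤ m ∧ j ≤ m ∧ Tall R χ σ i x x' ∧ Short R χ σ x' z ∧
      Tall R χ σ j y y' ∧ Short R χ σ y' z := by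
  classical
  obtain ⟨φ, h1, rfl, rfl⟩ := hx
  obtain ⟨ψ, h2, rfl, rfl⟩ := hy
  have hr := H.rep s hs
  have hGA := hA.grow h𝕃 hW
  have hP := hr.finite_dom
  have hpos : ∀ p, χ s p ≠ none → ∃ x ∈ marked (χ s), χ s p = some x := by
    intro p hp
    obtain ⟨x, hx⟩ := Option.ne_none_iff_exists'.1 hp
    exact ⟨x, ⟨p, hx⟩, hx⟩
  have hφG : ∀ p x, χ s p = some x → φ p ∈ Grow 𝕃 A := fun p x hx =>
    hGA.closed_rtc (hr.marked_alien_mem h𝕃 hW hA hs ⟨p, hx⟩) (h1 p x hx)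
  have hψG : ∀ p x, χ s p = some x → ψ p ∈ Grow 𝕃 A := fun p x hx =>
    hGA.closed_rtc (hr.marked_alien_mem h𝕃 hW hA hs ⟨p, hx⟩) (h2 p x hx)
  obtain ⟨v, hv, hvj⟩ := exists_common_reducts hcr
    ((hP.image φ).union (hP.image ψ)).toFinset (by
      intro a ha
      simp only [Set.Finite.coe_toFinset] at ha
      rcases ha with ⟨p, hp, rfl⟩ | ⟨p, hp, rfl⟩
      · obtain ⟨x, -, hx⟩ := hpos p hp
        exact hφG p x hx
      · obtain ⟨x, -, hx⟩ := hpos p hp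
        exact hψG p x hx)
  simp only [Set.Finite.mem_toFinset] at hv hvj
  have hvφ : ∀ p, χ s p ≠ none → ReflTransGen R.Rel (φ p) (v (φ p)) :=
    fun p hp => hv _ (Or.inl ⟨p, hp, rfl⟩)
  have hvψ : ∀ p, χ s p ≠ none → ReflTransGen R.Rel (ψ p) (v (ψ p)) :=
    fun p hp => hv _ (Or.inr ⟨p, hp, rfl⟩)
  have hveq : ∀ p, χ s p ≠ none → v (φ p) = v (ψ p) := by
    intro p hp
    obtain ⟨x, hxm, hx⟩ := hpos p hp
    obtain ⟨c, hc1, hc2⟩ := hcr _ (hr.marked_alien_mem h𝕃 hW hA hs hxm) _ _ (h1 p x hx) (h2 p x hx)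
    exact hvj _ (Or.inl ⟨p, hp, rfl⟩) _ (Or.inr ⟨p, hp, rfl⟩) ⟨c, hc1, hc2⟩
  have hQ : {p | ∃ x ∈ marked (χ s), IsVarPos (mark s (χ s)) x p} = {p | χ s p ≠ none} := by
    ext p
    constructor
    · rintro ⟨x, hx, hp⟩
      simp [(hr.isVarPos_mark_iff hx).1 hp]
    · intro hp
      obtain ⟨x, hxm, hx⟩ := hpos p hp
      exact ⟨x, hxm, (hr.isVarPos_mark_iff hxm).2 hx⟩
  obtain ⟨x', i, hx1, hx2, hi⟩ := exists_tall_short h𝕃 hW hA H.rep hr.mem (ζ := φ)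
    (v := fun p => v (φ p)) (fun p x hx hp => hφG p x ((hr.isVarPos_mark_iff hx).1 hp))
    (fun p x hx hp => hvφ p (by simp [(hr.isVarPos_mark_iff hx).1 hp]))
  obtain ⟨y', j, hy1, hy2, hj⟩ := exists_tall_short h𝕃 hW hA H.rep hr.mem (ζ := ψ)
    (v := fun p => v (ψ p)) (fun p x hx hp => hψG p x ((hr.isVarPos_mark_iff hx).1 hp))
    (fun p x hx hp => hvψ p (by simp [(hr.isVarPos_mark_iff hx).1 hp]))
  rw [hQ] at hi hj
  have hφle : ((fun p => v (φ p)) '' {p | χ s p ≠ none}).ncard ≤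
      (φ '' {p | χ s p ≠ none}).ncard := by
    rw [← Set.image_image v φ]
    exact Set.ncard_image_le (hP.image φ)
  have hψle : ((fun p => v (ψ p)) '' {p | χ s p ≠ none}).ncard ≤
      (ψ '' {p | χ s p ≠ none}).ncard := by
    rw [← Set.image_image v ψ]
    exact Set.ncard_image_le (hP.image ψ)
  have hφψ : (fun p => v (φ p)) '' {p | χ s p ≠ none} =
      (fun p => v (ψ p)) '' {p | χ s p ≠ none} :=
    Set.image_congr fun p hp => hveq p hp
  refine ⟨_, x', y', i, j, hi.trans hφle, ?_, hj.trans hψle, hx1, hx2, hy1, ?_⟩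
  · exact (hi.trans (hφψ ▸ le_rfl)).trans hψle
  · rwa [psubst_fill_congr fun p x hx hp =>
      hveq p (by simp [(hr.isVarPos_mark_iff hx).1 hp])]

/-- If equally marked aliens are rewritten equally, the tall step is a change of substitution `τ`,
and both sides meet in `b.subst τ`: one by replaying the sequence to `b`, the other by rewriting the
aliens below `b`. Otherwise the aliens are balanced first. -/
theorem RepSystem.tall_short {s x y : L.Term V} {n : ℕ} (hs : s ∈ Grow 𝕃 (Grow 𝕃 A))
    (hx : Tall R χ σ n s x) (hy : Short R χ σ s y) :
    ∃ z, ReflTransGen (StepLT (Labelled 𝕃 R A χ σ μ) (toLex (μ s, n + 1))) x z ∧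
      StepThenLT (Labelled 𝕃 R A χ σ μ) (toLex (μ s, n + 1)) y z := by
  classical
  have hxs := H.measure_le_of_tall hs hx
  have hys := H.measure_le_of_short hs hy
  have hG := (hA.grow h𝕃 hW).grow h𝕃 hW
  have hxG := hG.closed_rtc hs (hx.rtc H.rep hs)
  have hyG := hG.closed_rtc hs (hy.rtc H.rep hs)
  obtain ⟨φ, h1, rfl, rfl⟩ := hx
  obtain ⟨b, hb, rfl⟩ := hy
  have hr := H.rep s hs
  have hGA := hA.grow h𝕃 hW
  have hP := hr.finite_dom
  have hpos : ∀ p, χ s p ≠ none → ∃ x ∈ marked (χ s), χ s p = some x := by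
    intro p hp
    obtain ⟨x, hx⟩ := Option.ne_none_iff_exists'.1 hp
    exact ⟨x, ⟨p, hx⟩, hx⟩
  have hφG : ∀ p x, χ s p = some x → φ p ∈ Grow 𝕃 A := fun p x hx =>
    hGA.closed_rtc (hr.marked_alien_mem h𝕃 hW hA hs ⟨p, hx⟩) (h1 p x hx)
  have hbG : b ∈ Grow 𝕃 (avoiding A (marked (χ s))) :=
    ((hA.avoiding _).grow h𝕃 hW).closed_rtc hr.mem hb
  -- closing the diagram once the tall aliens agree
  have close : ∀ v : L.Term V → L.Term V,
      (∀ p, χ s p ≠ none → ReflTransGen R.Rel (φ p) (v (φ p))) →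
      (∀ p q, χ s p ≠ none → χ s p = χ s q → v (φ p) = v (φ q)) →
      ∃ τ : V → L.Term V, (mark s (χ s)).subst τ =
          psubst (mark s (χ s)) (fill (marked (χ s)) fun p => v (φ p)) ∧
        ReflTransGen (StepLT (Labelled 𝕃 R A χ σ μ)
          (toLex (μ s, (φ '' {p | χ s p ≠ none}).ncard + 1)))
          ((mark s (χ s)).subst τ) (b.subst τ) ∧
        StepThenLT (Labelled 𝕃 R A χ σ μ) (toLex (μ s, (φ '' {p | χ s p ≠ none}).ncard + 1))
          (b.subst (σ s)) (b.subst τ) := by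
    intro v hv hvv
    let τ : V → L.Term V := fun x => if h : x ∈ marked (χ s) then v (φ h.choose) else Term.var x
    have hτ : ∀ p x, χ s p = some x → τ x = v (φ p) := by
      intro p x hx
      have h : x ∈ marked (χ s) := ⟨p, hx⟩
      simp only [τ, dif_pos h]
      exact hvv _ _ (by simp [h.choose_spec]) (h.choose_spec.trans hx.symm)
    have hτid : ∀ y, y ∉ marked (χ s) → τ y = Term.var y := fun y hy => dif_neg hy
    have hτr : ∀ x ∈ marked (χ s), ReflTransGen R.Rel (σ s x) (τ x) := by
      rintro x ⟨p, hx⟩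
      rw [hτ p x hx]
      exact (h1 p x hx).trans (hv p (by simp [hx]))
    have heq : (mark s (χ s)).subst τ =
        psubst (mark s (χ s)) (fill (marked (χ s)) fun p => v (φ p)) := by
      rw [subst_eq_fill _ hτid]
      refine psubst_fill_congr fun p x hx hp => ?_
      rw [valAt_of_isVarPos hp, hτ p x ((hr.isVarPos_mark_iff hx).1 hp)]
    refine ⟨τ, heq, ?_, ?_⟩
    · have hrt : ReflTransGen R.Rel s ((mark s (χ s)).subst τ) := by
        conv_lhs => rw [← hr.subst_mark]
        refine rtc_subst_right _ fun y _ => ?_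
        by_cases hy : y ∈ marked (χ s)
        · exact hτr y hy
        · rw [hτid y hy, hr.subst_id y hy]
      have hG' := hG.closed_rtc hs hrt
      rcases H.lift s hs _ τ .refl hτr hτid with h | h
      · exact H.rtc_stepLT h𝕃 hW hA _ hG' h (rtc_subst hb τ)
      · exact .single ⟨_, toLex_lt_toLex_of_le (H.measure_le_of_rtc h𝕃 hW hA hs hrt)
          (Nat.succ_pos _), hG', Or.inl ⟨h b hb, rfl⟩⟩
    · obtain ⟨w, k, h2, h3, hk⟩ := exists_tall_short h𝕃 hW hA H.rep hbG (ζ := valAt b (σ s))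
        (v := valAt b τ)
        (fun p x hx hp => by
          rw [valAt_of_isVarPos hp]
          exact hr.marked_alien_mem h𝕃 hW hA hs hx)
        (fun p x hx hp => by
          rw [valAt_of_isVarPos hp, valAt_of_isVarPos hp]
          exact hτr x hx)
      rw [← subst_eq_fill b hr.subst_id] at h2
      rw [← subst_eq_fill b hτid] at h3
      refine H.stepThenLT_of_tall_short h𝕃 hW hA hyG hys h2 h3 (hk.trans ?_)
      have : valAt b τ '' {p | ∃ x ∈ marked (χ s), IsVarPos b x p} ⊆
          v '' (φ '' {p | χ s p ≠ none}) := by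
        rintro _ ⟨p, ⟨x, ⟨q, hq⟩, hp⟩, rfl⟩
        rw [valAt_of_isVarPos hp, hτ q x hq]
        exact ⟨_, ⟨q, by simp [hq], rfl⟩, rfl⟩
      exact (Set.ncard_le_ncard this ((hP.image φ).image v)).trans
        (Set.ncard_image_le (hP.image φ))
  -- If the tall step is balanced, it must not be followed by another tall step, as that could have
  -- an equally large label; `close` is used with the identity.
  by_cases hbal : ∀ p q, χ s p ≠ none → χ s p = χ s q → φ p = φ q
  · obtain ⟨τ, h2, h3, h4⟩ := close id (fun _ _ => .refl) hbal
    refine ⟨_, ?_, h4⟩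
    rwa [h2] at h3
  · push Not at hbal
    obtain ⟨p₀, q₀, hp₀, hpq, hne⟩ := hbal
    obtain ⟨v, hv, hvj⟩ := exists_common_reducts hcr (hP.image φ).toFinset (by
      intro a ha
      simp only [Set.Finite.coe_toFinset] at ha
      obtain ⟨p, hp, rfl⟩ := ha
      obtain ⟨x, -, hx⟩ := hpos p hp
      exact hφG p x hx)
    simp only [Set.Finite.mem_toFinset] at hv hvj
    have hveq : ∀ p q, χ s p ≠ none → χ s p = χ s q → v (φ p) = v (φ q) := by
      intro p q hp hpq
      obtain ⟨x, hxm, hx⟩ := hpos p hp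
      obtain ⟨c, hc1, hc2⟩ := hcr _ (hr.marked_alien_mem h𝕃 hW hA hs hxm) _ _ (h1 p x hx)
        (h1 q x (hpq ▸ hx))
      exact hvj _ ⟨p, hp, rfl⟩ _ ⟨q, fun h => hp (hpq.trans h), rfl⟩ ⟨c, hc1, hc2⟩
    have hvφ : ∀ p, χ s p ≠ none → ReflTransGen R.Rel (φ p) (v (φ p)) :=
      fun p hp => hv _ ⟨p, hp, rfl⟩
    obtain ⟨τ, h2, h3, h4⟩ := close v hvφ hveq
    refine ⟨_, ?_, h4⟩
    obtain ⟨x', i, hx1, hx2, hi⟩ := exists_tall_short h𝕃 hW hA H.rep hr.mem (ζ := φ)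
      (v := fun p => v (φ p)) (fun p x hx hp => hφG p x ((hr.isVarPos_mark_iff hx).1 hp))
      (fun p x hx hp => hvφ p (by simp [(hr.isVarPos_mark_iff hx).1 hp]))
    rw [← h2] at hx2
    refine (H.rtc_stepLT_of_tall_short h𝕃 hW hA hxG hxs hx1 hx2 (hi.trans_lt ?_)).trans h3
    have hsub : (fun p => v (φ p)) '' {p | ∃ x ∈ marked (χ s), IsVarPos (mark s (χ s)) x p} ⊆
        v '' (φ '' {p | χ s p ≠ none}) := by
      rintro _ ⟨p, ⟨x, hx, hp⟩, rfl⟩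
      exact ⟨_, ⟨p, by simp [(hr.isVarPos_mark_iff hx).1 hp], rfl⟩, rfl⟩
    refine (Set.ncard_le_ncard hsub ((hP.image φ).image v)).trans_lt ?_
    -- Balancing identifies the different terms `φ p₀` and `φ q₀`, so strictly fewer terms remain
    -- and the label really drops.
    refine lt_of_le_of_ne (Set.ncard_image_le (hP.image φ)) fun h => hne ?_
    exact (Set.injOn_of_ncard_image_eq h (hP.image φ)) ⟨p₀, hp₀, rfl⟩
      ⟨q₀, fun h => hp₀ (hpq.trans h), rfl⟩ (hveq p₀ q₀ hp₀ hpq)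

/-- The marked term lies in `Grow 𝕃 A` and is confluent. Completing its peak and putting the aliens
back requires the lifting property for both reducts, since these may have representations of their
own. -/
theorem RepSystem.short_short {s x y : L.Term V} (hs : s ∈ Grow 𝕃 (Grow 𝕃 A))
    (hx : Short R χ σ s x) (hy : Short R χ σ s y) :
    ∃ z, StepThenLT (Labelled 𝕃 R A χ σ μ) (toLex (μ s, 0)) x z ∧
      StepThenLT (Labelled 𝕃 R A χ σ μ) (toLex (μ s, 0)) y z := by
  have hG := (hA.grow h𝕃 hW).grow h𝕃 hW
  have hr := H.rep s hs
  obtain ⟨b, hb, hbx⟩ := id hx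
  obtain ⟨c, hc, hcy⟩ := id hy
  obtain ⟨d, hd1, hd2⟩ := hcr _ (grow_mono (fun _ h => h.1) hr.mem) b c hb hc
  have key : ∀ e, ReflTransGen R.Rel (mark s (χ s)) e → ReflTransGen R.Rel e d →
      Short R χ σ s (e.subst (σ s)) →
      StepThenLT (Labelled 𝕃 R A χ σ μ) (toLex (μ s, 0)) (e.subst (σ s)) (d.subst (σ s)) := by
    intro e he hed hse
    have heG := hG.closed_rtc hs (hse.rtc H.rep hs)
    rcases H.lift s hs e (σ s) he (fun _ _ => .refl) hr.subst_id with h | h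
    · exact .of_rtc (H.rtc_stepLT h𝕃 hW hA _ heG h (rtc_subst hed _))
    · exact ⟨_, Or.inr ⟨_, toLex_le_toLex_of_le (H.measure_le_of_short hs hse) le_rfl, heG,
        Or.inl ⟨h d hed, rfl⟩⟩, .refl⟩
  subst hbx hcy
  exact ⟨_, key b hb hd1 hx, key c hc hd2 hy⟩

/-- Confluence propagates to terms of greater rank if there is a system of representations. -/
theorem RepSystem.crOn [WellFoundedLT Λ] : CROn R.Rel (Grow 𝕃 (Grow 𝕃 A)) := by
  have hG := (hA.grow h𝕃 hW).grow h𝕃 hW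
  have hconf : Confluent fun s t => ∃ a, Labelled 𝕃 R A χ σ μ a s t := by
    refine confluent_of_decreasing _ ?_ ?_
    · rintro a b s x y hba ⟨hs, hx⟩ ⟨-, hy⟩
      rcases hx with ⟨hx, rfl⟩ | ⟨n, hx, rfl⟩ <;> rcases hy with ⟨hy, rfl⟩ | ⟨m, hy, rfl⟩
      · exact absurd hba (lt_irrefl _)
      · exact absurd hba (toLex_le_toLex_of_le le_rfl (Nat.zero_le _)).not_gt
      · exact H.tall_short h𝕃 hW hA hcr hs hx hy
      · have hmn : m < n := by
          rw [Prod.Lex.toLex_lt_toLex] at hba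
          rcases hba with h | ⟨-, h⟩
          · exact absurd h (lt_irrefl _)
          · exact Nat.lt_of_succ_lt_succ h
        obtain ⟨z, x', y', i, j, -, hi, hj, h1, h2, h3, h4⟩ :=
          H.tall_tall h𝕃 hW hA hcr hs hx hy
        exact ⟨z, H.rtc_stepLT_of_tall_short h𝕃 hW hA (hG.closed_rtc hs (hx.rtc H.rep hs))
          (H.measure_le_of_tall hs hx) h1 h2 (hi.trans_lt hmn),
          H.stepThenLT_of_tall_short h𝕃 hW hA (hG.closed_rtc hs (hy.rtc H.rep hs))
          (H.measure_le_of_tall hs hy) h3 h4 (hj.trans hmn.le)⟩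
    · rintro a s x y ⟨hs, hx⟩ ⟨-, hy⟩
      rcases hx with ⟨hx, rfl⟩ | ⟨n, hx, rfl⟩ <;> rcases hy with ⟨hy, he⟩ | ⟨m, hy, he⟩
      · exact H.short_short h𝕃 hW hA hcr hs hx hy
      · simp at he
      · simp at he
      · obtain rfl : n = m := by simpa using he
        obtain ⟨z, x', y', i, j, hi, -, hj, h1, h2, h3, h4⟩ :=
          H.tall_tall h𝕃 hW hA hcr hs hx hy
        exact ⟨z, H.stepThenLT_of_tall_short h𝕃 hW hA (hG.closed_rtc hs (hx.rtc H.rep hs))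
          (H.measure_le_of_tall hs hx) h1 h2 hi,
          H.stepThenLT_of_tall_short h𝕃 hW hA (hG.closed_rtc hs (hy.rtc H.rep hs))
          (H.measure_le_of_tall hs hy) h3 h4 hj⟩
  have lift : ∀ s t, s ∈ Grow 𝕃 (Grow 𝕃 A) → ReflTransGen R.Rel s t →
      ReflTransGen (fun s t => ∃ a, Labelled 𝕃 R A χ σ μ a s t) s t := by
    intro s t hs h
    induction h with
    | refl => exact .refl
    | tail h1 h2 ih =>
      obtain ⟨-, n, h⟩ := H.exists_labelled h𝕃 hW (hG.closed_rtc hs h1) h2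
      exact ih.tail ⟨_, h⟩
  have unlift : ∀ s t, ReflTransGen (fun s t => ∃ a, Labelled 𝕃 R A χ σ μ a s t) s t →
      ReflTransGen R.Rel s t := by
    intro s t h
    induction h with
    | refl => exact .refl
    | tail _ h ih =>
      obtain ⟨a, h⟩ := h
      exact ih.trans (h.rtc H)
  intro s hs t u ht hu
  obtain ⟨v, h1, h2⟩ := hconf s t u (lift s t hs ht) (lift s u hs hu)
  exact ⟨v, unlift _ _ h1, unlift _ _ h2⟩

end Diagrams

/-! ### Lifting rewrite sequences to representations -/

section Lift

open Classical in
/-- The marks of the term `b.subst τ` with respect to `b`. -/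
noncomputable def remark (X : Set V) (τ : V → L.Term V) (χ : List ℕ → Option V) (p : List ℕ)
    (y : V) : L.Term V := if y ∈ X then ((χ p).map Term.var).getD (τ y) else Term.var y

variable {X : Set V} {b : L.Term V} {τ : V → L.Term V}

theorem IsRep.mark_subst [Nonempty V] (h𝕃 : IsVarRestrictedLayerSystem 𝕃) (hA : Good 𝕃 R A)
    (hb : b ∈ Grow 𝕃 (avoiding A X)) (hτ : ∀ x ∈ X, τ x ∈ Grow 𝕃 A)
    (hτid : ∀ y, y ∉ X → τ y = Term.var y) {χ : List ℕ → Option V} {σ : V → L.Term V}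
    (h : IsRep 𝕃 A (b.subst τ) χ σ) :
    mark (b.subst τ) χ = psubst b (remark X τ χ) := by
  rw [subst_eq_fill b hτid] at h ⊢
  rw [h.mark_fill h𝕃 hA hb fun p x hx hp => by rw [valAt_of_isVarPos hp]; exact hτ x hx]
  refine psubst_congr fun p y hp => ?_
  by_cases hy : y ∈ X
  · rw [fill_of_mem hy, remark, if_pos hy, valAt_of_isVarPos hp]
  · rw [fill_of_notMem hy, remark, if_neg hy]

theorem IsRep.subst_remark (hτid : ∀ y, y ∉ X → τ y = Term.var y) {χ : List ℕ → Option V}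
    {σ : V → L.Term V} (h : IsRep 𝕃 A (b.subst τ) χ σ) {p : List ℕ} {y : V}
    (hp : IsVarPos b y p) : (remark X τ χ p y).subst σ = τ y := by
  have hZ : LayerSystems.subtermAt (b.subst τ) p = some (τ y) := subtermAt_subst hp τ
  by_cases hy : y ∈ X
  · rw [remark, if_pos hy]
    cases hχ : χ p with
    | some x => exact h.subst_eq p x _ hχ hZ
    | none =>
      refine subst_eq_self fun z hz => h.subst_id z fun hm => h.fresh z hm ?_
      exact vars_subset_of_subtermAt hZ hz
  · rw [remark, if_neg hy, hτid y hy]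
    refine h.subst_id y fun hm => h.fresh y hm ⟨p, ?_⟩
    rw [IsVarPos, hZ, hτid y hy]

variable {χ : L.Term V → List ℕ → Option V} {σ : L.Term V → V → L.Term V}

/-- If the marks of `b.subst τ` only depend on the variables of `b` then rewrite sequences of `b`
yield short steps. -/
theorem short_of_uniform [Nonempty V] (h𝕃 : IsVarRestrictedLayerSystem 𝕃) (hA : Good 𝕃 R A)
    (hb : b ∈ Grow 𝕃 (avoiding A X)) (hτ : ∀ x ∈ X, τ x ∈ Grow 𝕃 A)
    (hτid : ∀ y, y ∉ X → τ y = Term.var y)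
    (h : IsRep 𝕃 A (b.subst τ) (χ (b.subst τ)) (σ (b.subst τ)))
    (hu : ∀ x ∈ X, ∀ p q, IsVarPos b x p → IsVarPos b x q →
      χ (b.subst τ) p = χ (b.subst τ) q) {c : L.Term V} (hc : ReflTransGen R.Rel b c) :
    Short R χ σ (b.subst τ) (c.subst τ) := by
  classical
  let τ' : V → L.Term V := fun y => if hy : ∃ p, IsVarPos b y p then
    remark X τ (χ (b.subst τ)) hy.choose y else Term.var y
  have hτ' : ∀ p y, IsVarPos b y p → τ' y = remark X τ (χ (b.subst τ)) p y := by
    intro p y hp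
    have hy : ∃ p, IsVarPos b y p := ⟨p, hp⟩
    simp only [τ', dif_pos hy]
    by_cases hyX : y ∈ X
    · rw [remark, remark, if_pos hyX, if_pos hyX, hu y hyX _ p hy.choose_spec hp]
    · rw [remark, remark, if_neg hyX, if_neg hyX]
  refine ⟨c.subst τ', ?_, ?_⟩
  · rw [h.mark_subst h𝕃 hA hb hτ hτid, ← psubst_congr fun p y hp => hτ' p y hp,
      ← subst_eq_psubst]
    exact rtc_subst hc τ'
  · rw [psubst_psubst_subst]
    refine subst_congr fun y hy => ?_
    obtain ⟨p, hp⟩ := TRS.vars_subset_of_rtc hc hy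
    rw [hτ' p y hp, h.subst_remark hτid hp]

end Lift

/-! ### Left-linear rewriting of instances -/

/-- `IsInst P b e` says that `e` results from `b` by replacing each occurrence of a variable `y` by
some term `t` with `P y t`. -/
inductive IsInst (P : X → L.Term Y → Prop) : L.Term X → L.Term Y → Prop
  | var (y : X) (t : L.Term Y) (h : P y t) : IsInst P (Term.var y) t
  | func {n : ℕ} (f : L.Functions n) (ts : Fin n → L.Term X) (es : Fin n → L.Term Y)
      (h : ∀ i, IsInst P (ts i) (es i)) : IsInst P (Term.func f ts) (Term.func f es)

section Inst

variable {P : X → L.Term Y → Prop}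

theorem isInst_func {n : ℕ} {f : L.Functions n} {ts : Fin n → L.Term X} {e : L.Term Y} :
    IsInst P (Term.func f ts) e ↔
      ∃ es : Fin n → L.Term Y, e = Term.func f es ∧ ∀ i, IsInst P (ts i) (es i) := by
  constructor
  · rintro ⟨⟩
    exact ⟨_, rfl, by assumption⟩
  · rintro ⟨es, rfl, h⟩
    exact IsInst.func f ts es h

theorem isInst_psubst {b : L.Term X} {ψ : List ℕ → X → L.Term Y}
    (h : ∀ p y, IsVarPos b y p → P y (ψ p y)) : IsInst P b (psubst b ψ) := by
  induction b generalizing ψ with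
  | var y => exact IsInst.var y _ (h [] y (by simp [IsVarPos]))
  | func f ts ih => exact IsInst.func f _ _ fun i => ih i fun p y hp => h _ y (by simpa using hp)

theorem IsInst.subst_eq {b : L.Term X} {e : L.Term Y} (h : IsInst P b e) {τ : X → L.Term Z}
    {σ : Y → L.Term Z} (hP : ∀ y t, P y t → t.subst σ = τ y) : e.subst σ = b.subst τ := by
  induction h with
  | var y t h => exact hP y t h
  | func f ts es _ ih => exact congrArg _ (funext ih)

theorem IsInst.subterm {b c : L.Term X} {e : L.Term Y} {p : List ℕ} (h : IsInst P b e)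
    (hc : subtermAt b p = some c) : ∃ d, subtermAt e p = some d ∧ IsInst P c d := by
  induction p generalizing b e with
  | nil =>
    simp only [subtermAt_nil, Option.some.injEq] at hc
    subst hc
    exact ⟨e, by simp, h⟩
  | cons i p ih =>
    obtain ⟨n, f, ts, j, rfl, rfl, hc₁⟩ := subtermAt_cons_eq_some.1 hc
    obtain ⟨es, rfl, he⟩ := isInst_func.1 h
    simpa using ih (he j) hc₁

theorem IsInst.replace {b c : L.Term X} {e d : L.Term Y} {p : List ℕ} (h : IsInst P b e)
    (hp : IsPos b p) (hcd : IsInst P c d) :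
    IsInst P (replaceAt b p c) (replaceAt e p d) := by
  induction p generalizing b e with
  | nil => simpa using hcd
  | cons i p ih =>
    obtain ⟨u, hu⟩ := hp
    obtain ⟨n, f, ts, j, rfl, rfl, hu₁⟩ := subtermAt_cons_eq_some.1 hu
    obtain ⟨es, rfl, he⟩ := isInst_func.1 h
    rw [replaceAt_func_fin, replaceAt_func_fin]
    refine IsInst.func f _ _ fun i => ?_
    by_cases hij : i = j
    · subst hij
      simpa using ih (he i) ⟨u, hu₁⟩
    · simpa [hij] using he i

theorem isInst_subst {l : L.Term Z} {θ : Z → L.Term X} {θ' : Z → L.Term Y}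
    (h : ∀ z ∈ vars l, IsInst P (θ z) (θ' z)) : IsInst P (l.subst θ) (l.subst θ') := by
  induction l with
  | var z => exact h z (by simp)
  | func f ts ih =>
    exact IsInst.func f _ _ fun i => ih i fun z hz => h z (mem_vars_func.2 ⟨i, hz⟩)

/-- Different arguments of a linear term share no variables, so the substitutions found for them can
be glued together. For a non-linear term the occurrences of a variable might be replaced
differently. -/
theorem IsInst.of_linear {l : L.Term Z} (hl : IsLinear l) {θ : Z → L.Term X} {e : L.Term Y}
    (h : IsInst P (l.subst θ) e) :
    ∃ θ' : Z → L.Term Y, e = l.subst θ' ∧ ∀ z ∈ vars l, IsInst P (θ z) (θ' z) := by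
  classical
  induction l generalizing e with
  | var z =>
    refine ⟨fun _ => e, rfl, fun y hy => ?_⟩
    rw [mem_vars_var] at hy
    subst hy
    exact h
  | @func n f ts ih =>
    obtain ⟨es, rfl, he⟩ := isInst_func.1 h
    have hlin : ∀ i, IsLinear (ts i) := by
      intro i y p q hp hq
      have := hl y (i :: p) (i :: q) (by simpa using hp) (by simpa using hq)
      simpa using this
    choose θ' h1 h2 using fun i => ih i (hlin i) (he i)
    have hsep : ∀ i j z, z ∈ vars (ts i) → z ∈ vars (ts j) → i = j := by
      rintro i j z ⟨p, hp⟩ ⟨q, hq⟩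
      have := hl z (i :: p) (j :: q) (by simpa using hp) (by simpa using hq)
      simp only [List.cons.injEq] at this
      exact Fin.ext this.1
    let θ₁ : Z → L.Term Y := fun z =>
      if hz : ∃ i, z ∈ vars (ts i) then θ' hz.choose z else Term.func f es
    have hθ₁ : ∀ i, ∀ z ∈ vars (ts i), θ₁ z = θ' i z := by
      intro i z hz
      have h : ∃ i, z ∈ vars (ts i) := ⟨i, hz⟩
      simp only [θ₁, dif_pos h]
      rw [hsep _ _ z h.choose_spec hz]
    refine ⟨θ₁, congrArg _ (funext fun i => ?_), fun z hz => ?_⟩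
    · rw [h1 i]
      exact subst_congr fun z hz => (hθ₁ i z hz).symm
    · obtain ⟨i, hz⟩ := mem_vars_func.1 hz
      rw [hθ₁ i z hz]
      exact h2 i z hz

theorem IsInst.step {P : X → L.Term Y → Prop} (hR : R.IsLeftLinear) {b c : L.Term X}
    {e : L.Term Y} (h : IsInst P b e) (hbc : Step R.rules b c) :
    ∃ d, Step R.rules e d ∧ IsInst P c d := by
  obtain ⟨ρ, hρ, p, θ, hb, rfl⟩ := hbc
  obtain ⟨u, hu, hi⟩ := h.subterm hb
  obtain ⟨θ', rfl, hθ'⟩ := hi.of_linear (hR ρ hρ)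
  exact ⟨_, ⟨ρ, hρ, p, θ', hu, rfl⟩, h.replace ⟨_, hb⟩
    (isInst_subst fun z hz => hθ' z (R.vars_rhs_subset ρ hρ hz))⟩

theorem IsInst.rtc {P : X → L.Term Y → Prop} (hR : R.IsLeftLinear) {b c : L.Term X}
    {e : L.Term Y} (h : IsInst P b e) (hbc : ReflTransGen (Step R.rules) b c) :
    ∃ d, ReflTransGen (Step R.rules) e d ∧ IsInst P c d := by
  induction hbc with
  | refl => exact ⟨e, .refl, h⟩
  | tail _ h2 ih =>
    obtain ⟨d, hd, hcd⟩ := ih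
    obtain ⟨d', hd', hcd'⟩ := hcd.step hR h2
    exact ⟨d', hd.tail hd', hcd'⟩

end Inst

/-! ### Left-linear systems -/

theorem allowed_infinite (h𝕃 : IsVarRestrictedLayerSystem 𝕃) {M : Ctx L V} (hM : M ∈ 𝕃)
    {p : List ℕ} (hp : subtermAt M p = some hole) :
    {x : V | replaceAt M p (ctxVar x) ∈ 𝕃}.Infinite := by
  refine (h𝕃.l2' M p ⟨_, hp⟩).2 ?_
  rwa [replaceAt_self hp]

/-- The induction step for left-linear systems. -/
theorem CROn.grow_of_isLeftLinear [Nonempty V] (h𝕃 : IsVarRestrictedLayerSystem 𝕃)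
    (hW : WeaklyLayered 𝕃 R) (hR : R.IsLeftLinear) (hA : Good 𝕃 R A)
    (hcr : CROn R.Rel (Grow 𝕃 A)) : CROn R.Rel (Grow 𝕃 (Grow 𝕃 A)) := by
  -- With the position as key, different tall aliens never share a variable, and the measure can be
  -- trivial.
  choose χ σ hrep hkey using fun s => exists_isRep h𝕃 hA s (K := List ℕ) id
    (fun p => {x : V | replaceAt (maxTop 𝕃 s) p (ctxVar x) ∈ 𝕃})
    fun p a ha => ⟨allowed_infinite h𝕃 (maxTop_mem h𝕃 s) ha.1.1, fun x hx => hx⟩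
  have H : RepSystem 𝕃 R A χ σ fun _ => () := by
    refine ⟨fun s _ => hrep s, ?_, fun _ _ _ _ _ _ => le_rfl, ?_⟩
    · intro s _ ρ hρ p t _ _ z q₁ q₂ r h1 h2
      rw [hR ρ hρ z q₁ q₂ h1 h2]
    · intro s hs b τ hb hτ hτid
      refine Or.inr fun c hc => ?_
      have hr := hrep s
      have hbG : b ∈ Grow 𝕃 (avoiding A (marked (χ s))) :=
        ((hA.avoiding _).grow h𝕃 hW).closed_rtc hr.mem hb
      have hτG : ∀ x ∈ marked (χ s), τ x ∈ Grow 𝕃 A := fun x hx =>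
        (hA.grow h𝕃 hW).closed_rtc (hr.marked_alien_mem h𝕃 hW hA hs hx) (hτ x hx)
      have hz := hrep (b.subst τ)
      -- Occurrences of one variable of `b` may be marked by different variables or not be marked at
      -- all; all versions become `τ y` under the new substitution, which is all that left-linear
      -- rewriting needs.
      have hi : IsInst (fun y t => t.subst (σ (b.subst τ)) = τ y) b
          (mark (b.subst τ) (χ (b.subst τ))) := by
        rw [hz.mark_subst h𝕃 hA hbG hτG hτid]
        exact isInst_psubst fun p y hp => hz.subst_remark hτid hp
      obtain ⟨d, hd, hcd⟩ := hi.rtc hR hc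
      exact ⟨d, hd, hcd.subst_eq fun y t h => h⟩
  exact H.crOn h𝕃 hW hA hcr

/-- Confluence by induction on the rank. -/
theorem confluent_of_grow [Nonempty V] (h𝕃 : IsVarRestrictedLayerSystem 𝕃)
    (hW : WeaklyLayered 𝕃 R) (h1 : CROn R.Rel (rankLE 𝕃 1))
    (h : ∀ A, Good 𝕃 R A → CROn R.Rel (Grow 𝕃 A) → CROn R.Rel (Grow 𝕃 (Grow 𝕃 A))) :
    Confluent R.Rel := by
  have key : ∀ n, CROn R.Rel (rankLE 𝕃 (n + 1)) := by
    intro n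
    induction n with
    | zero => exact h1
    | succ n ih => exact h _ (good_rankLE h𝕃 hW n) ih
  intro s t u ht hu
  obtain ⟨n, hn⟩ := exists_mem_rankLE h𝕃 s
  exact key n s (rankLE_mono h𝕃 n.le_succ hn) t u ht hu

/-! ### Fusion -/

/-- The terms that fuse with the layer `N` when they are put into its hole at the position `i`. -/
def fusing (𝕃 : Set (Ctx L V)) (N : Ctx L V) (i : List ℕ) : Set (L.Term V) :=
  {t | ∃ D ≠ hole, D ≤ toCtx t ∧ replaceAt N i D ∈ 𝕃}

/-- Whether the max-top of `w` goes beyond the hole of `N` at `i` depends on `w` through its subterm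
`t` only: by (C2) the part of the max-top at `i` can be copied into `N`, and conversely a layer
`N[D]_i` below `w` lies below the max-top. -/
theorem maxTop_ne_hole_iff (h𝕃 : IsVarRestrictedLayerSystem 𝕃) (hC : C2 𝕃) {N : Ctx L V}
    {w t : L.Term V} {i : List ℕ} (hN : N ∈ 𝕃) (hw : N ≤ toCtx w)
    (hi : subtermAt N i = some hole) (ht : subtermAt w i = some t) :
    subtermAt (maxTop 𝕃 w) i ≠ some hole ↔ t ∈ fusing 𝕃 N i := by
  have hle := le_maxTop h𝕃 hN hw
  constructor
  · intro h
    obtain ⟨D, hD, -⟩ := subtermAt_mono hle hi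
    refine ⟨D, ?_, subtermAt_le_subtermAt (maxTop_le h𝕃 w) hD (subtermAt_toCtx ht),
      hC N hN _ (maxTop_mem h𝕃 w) hle i hi D hD⟩
    rintro rfl
    exact h hD
  · rintro ⟨D, hD, hDt, hmem⟩ h
    have h1 : replaceAt N i D ≤ toCtx w :=
      replaceAt_le ⟨_, hi⟩ ((replaceAt_hole_le ⟨_, hi⟩).trans hw) (subtermAt_toCtx ht) hDt
    have h2 := subtermAt_le_subtermAt (le_maxTop h𝕃 hmem h1) (subtermAt_replaceAt ⟨_, hi⟩ D) h
    exact hD (le_hole_iff.1 h2)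

/-- For any candidate `t`, both layers are tops of `w[t]_i`, and fusion of `t` with either of them
is decided by the same max-top. Thus the key of a hole does not depend on the layer used to compute
it. -/
theorem fusing_eq_fusing (h𝕃 : IsVarRestrictedLayerSystem 𝕃) (hC : C2 𝕃) {N N' : Ctx L V}
    {w : L.Term V} {i : List ℕ} (hN : N ∈ 𝕃) (hN' : N' ∈ 𝕃) (hw : N ≤ toCtx w)
    (hw' : N' ≤ toCtx w) (hi : subtermAt N i = some hole) (hi' : subtermAt N' i = some hole) :
    fusing 𝕃 N i = fusing 𝕃 N' i := by
  have hp : IsPos w i := isPos_toCtx.1 (IsPos.mono hw ⟨_, hi⟩)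
  ext t
  have key : ∀ K : Ctx L V, K ≤ toCtx w → subtermAt K i = some hole →
      K ≤ toCtx (replaceAt w i t) := by
    intro K hK hKi
    rw [toCtx_replaceAt hp]
    exact le_replaceAt_of_hole hK hKi _
  rw [← maxTop_ne_hole_iff h𝕃 hC hN (key N hw hi) hi (subtermAt_replaceAt hp t),
    ← maxTop_ne_hole_iff h𝕃 hC hN' (key N' hw' hi') hi' (subtermAt_replaceAt hp t)]

theorem eraseVars_le_toCtx_subst {M : Ctx L V} {b : L.Term V} (h : M ≤ toCtx b) {X : Set V}
    {υ : V → L.Term V} (hυ : ∀ y, y ∉ X → υ y = Term.var y) :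
    eraseVars X M ≤ toCtx (b.subst υ) := by
  induction b generalizing M with
  | var y =>
    rcases le_ctxVar_iff.1 h with rfl | rfl
    · rw [eraseVars_hole]
      exact hole_le _
    · by_cases hy : y ∈ X
      · rw [eraseVars_ctxVar_of_mem hy]
        exact hole_le _
      · rw [eraseVars_ctxVar_of_notMem hy, Term.subst, hυ y hy]
        exact le_rfl
  | func f ts ih =>
    rcases le_func_iff.1 h with rfl | ⟨Ms, rfl, hMs⟩
    · rw [eraseVars_hole]
      exact hole_le _
    · exact Ctx.Le.func f _ _ fun i => ih i (hMs i)

theorem eraseVars_le_toCtx {M : Ctx L V} {b : L.Term V} (h : M ≤ toCtx b) (X : Set V) :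
    eraseVars X M ≤ toCtx b := by
  have := eraseVars_le_toCtx_subst h (X := X) (υ := Term.var) fun _ _ => rfl
  rwa [subst_eq_self fun _ _ => rfl] at this

/-! ### The induction step for layered systems -/

section Layered

variable (h𝕃 : IsVarRestrictedLayerSystem 𝕃) (hR : Layered 𝕃 R)
include h𝕃 hR

/-- Subterms of the max-top that belong to the same variable of a redex are equal, and agree on
what they fuse with. -/
theorem Layered.uniform_redex {s t : L.Term V} {ρ : L.Term V × L.Term V} (hρ : ρ ∈ R.rules)
    {p : List ℕ} (hst : StepAt ρ p s t) (hp : IsFunPos (maxTop 𝕃 s) p) {z : V}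
    {q₁ q₂ r : List ℕ} (h1 : IsVarPos ρ.1 z q₁) (h2 : IsVarPos ρ.1 z q₂) :
    subtermAt s (p ++ (q₁ ++ r)) = subtermAt s (p ++ (q₂ ++ r)) ∧
    subtermAt (maxTop 𝕃 s) (p ++ (q₁ ++ r)) = subtermAt (maxTop 𝕃 s) (p ++ (q₂ ++ r)) ∧
    (subtermAt (maxTop 𝕃 s) (p ++ (q₁ ++ r)) = some hole →
      fusing 𝕃 (maxTop 𝕃 s) (p ++ (q₁ ++ r)) = fusing 𝕃 (maxTop 𝕃 s) (p ++ (q₂ ++ r))) := by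
  classical
  have same : ∀ {W : Type _} (e : L.Term W) (θ : V → L.Term W),
      subtermAt e p = some (ρ.1.subst θ) → ∀ q, IsVarPos ρ.1 z q →
        subtermAt e (p ++ (q ++ r)) = subtermAt (θ z) r := by
    intro W e θ he q hq
    rw [subtermAt_append_of_eq he]
    exact subtermAt_append_of_eq (subtermAt_subst hq θ) r
  obtain ⟨θ, hs, rfl⟩ := id hst
  obtain ⟨N, -, θ', hM, -⟩ := hR.weaklyLayered ρ hρ s _ _ p (isMaxTop_maxTop h𝕃 s) hp hst
  refine ⟨?_, ?_, fun hhole => ?_⟩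
  · rw [same s θ hs q₁ h1, same s θ hs q₂ h2]
  · rw [same _ θ' hM q₁ h1, same _ θ' hM q₂ h2]
  · have hθ' : subtermAt (θ' z) r = some hole := by rwa [same _ θ' hM q₁ h1] at hhole
    have hhole₂ : subtermAt (maxTop 𝕃 s) (p ++ (q₂ ++ r)) = some hole := by
      rw [same _ θ' hM q₂ h2, hθ']
    have hθ : ∀ y ∈ vars ρ.1, θ' y ≤ toCtx (θ y) := by
      have hle := subtermAt_le_subtermAt (maxTop_le h𝕃 s) hM (subtermAt_toCtx hs)
      rintro y ⟨q, hq⟩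
      exact subtermAt_le_subtermAt hle (subtermAt_subst hq θ')
        (subtermAt_toCtx (subtermAt_subst hq θ))
    have hz : z ∈ vars ρ.1 := ⟨q₁, h1⟩
    have hpos : IsPos (θ z) r := isPos_toCtx.1 (IsPos.mono (hθ z hz) ⟨_, hθ'⟩)
    ext u
    -- The candidate `u` is put into all occurrences of `z` at once, so that `s'` still has a redex
    -- at `p`.
    let η : V → L.Term V := Function.update θ z (replaceAt (θ z) r u)
    have hη : subtermAt (η z) r = some u := by
      simpa [η] using subtermAt_replaceAt hpos u
    have hηle : ∀ y ∈ vars ρ.1, θ' y ≤ toCtx (η y) := by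
      intro y hy
      by_cases hyz : y = z
      · subst hyz
        simp only [η, Function.update_self]
        rw [toCtx_replaceAt hpos]
        exact le_replaceAt_of_hole (hθ y hy) hθ' _
      · simpa [η, hyz] using hθ y hy
    let s' := replaceAt s p (ρ.1.subst η)
    have hs' : subtermAt s' p = some (ρ.1.subst η) := subtermAt_replaceAt ⟨_, hs⟩ _
    have hle : maxTop 𝕃 s ≤ toCtx s' := by
      rw [toCtx_replaceAt ⟨_, hs⟩]
      have h := replaceAt_mono (maxTop_le h𝕃 s) ⟨_, hM⟩
        (E := ρ.1.subst θ') (F := toCtx (ρ.1.subst η)) (by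
          rw [toCtx_subst, subst_eq_psubst, subst_eq_psubst]
          exact psubst_mono fun q y hq => hηle y ⟨q, hq⟩)
      rwa [replaceAt_self hM] at h
    -- By (W) the new max-top is an instance of the left-hand side, so its subterms at the two
    -- positions agree, and `u` fuses at both or at neither.
    obtain ⟨N', -, θ'', hM', -⟩ := hR.weaklyLayered ρ hρ s' _ _ p (isMaxTop_maxTop h𝕃 s')
      (hp.mono (le_maxTop h𝕃 (maxTop_mem h𝕃 s) hle)) ⟨η, hs', rfl⟩
    rw [← maxTop_ne_hole_iff h𝕃 hR.c2 (maxTop_mem h𝕃 s) hle hhole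
        (by rw [same s' η hs' q₁ h1, hη]),
      ← maxTop_ne_hole_iff h𝕃 hR.c2 (maxTop_mem h𝕃 s) hle hhole₂
        (by rw [same s' η hs' q₂ h2, hη]),
      same _ θ'' hM' q₁ h1, same _ θ'' hM' q₂ h2]

/-- What fuses at the marked positions only depends on the marks, and is preserved by rewriting. -/
theorem Layered.fusing_step (hA : Good 𝕃 R A) {X : Set V} {b b' : L.Term V}
    {κ : V → Set (L.Term V)} (hb : b ∈ Grow 𝕃 (avoiding A X)) (h : R.Rel b b')
    (hκ : ∀ x ∈ X, ∀ i, IsVarPos b x i →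
      i = [] ∨ fusing 𝕃 (eraseVars X (maxTop 𝕃 b)) i = κ x) :
    ∀ x ∈ X, ∀ i, IsVarPos b' x i →
      i = [] ∨ fusing 𝕃 (eraseVars X (maxTop 𝕃 b')) i = κ x := by
  classical
  have hgood := hA.avoiding X
  have hb'G := hgood.grow_closed h𝕃 hR.weaklyLayered hb h
  obtain ⟨ρ, hρ, p, hst⟩ := h
  have hf := hgood.fits_maxTop h𝕃 hb
  have hf' := hgood.fits_maxTop h𝕃 hb'G
  have hN := eraseVars_mem h𝕃 X (maxTop_mem h𝕃 b)
  have hN' := eraseVars_mem h𝕃 X (maxTop_mem h𝕃 b')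
  have hNb := eraseVars_le_toCtx (maxTop_le h𝕃 b) X
  have hNb' := eraseVars_le_toCtx (maxTop_le h𝕃 b') X
  have hole_of : ∀ {x i}, x ∈ X → IsVarPos b x i →
      subtermAt (eraseVars X (maxTop 𝕃 b)) i = some hole := by
    intro x i hx hi
    rw [subtermAt_eraseVars (isVarPos_of_fits_avoiding hf hx hi), eraseVars_ctxVar_of_mem hx]
  have hole_of' : ∀ {x i}, x ∈ X → IsVarPos b' x i →
      subtermAt (eraseVars X (maxTop 𝕃 b')) i = some hole := by
    intro x i hx hi
    rw [subtermAt_eraseVars (isVarPos_of_fits_avoiding hf' hx hi), eraseVars_ctxVar_of_mem hx]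
  have hne : ∀ {x i}, IsVarPos b x i → i ≠ [] := by
    rintro x i hi rfl
    have hb : b = Term.var x := by simpa [IsVarPos] using hi
    have := TRS.isFunPos_of_stepAt hρ hst
    rw [hb] at this
    exact not_isFunPos_var _ _ this
  intro x hx i hi
  by_cases hp : IsFunPos (maxTop 𝕃 b) p
  · by_cases hi0 : i = []
    · exact Or.inl hi0
    right
    ext t
    -- The term `t` is substituted for `x` to test whether it fuses at `i`.
    let υ : V → L.Term V := Function.update Term.var x t
    have hυ : ∀ y, y ∉ X → υ y = Term.var y := by
      intro y hy
      have : y ≠ x := by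
        rintro rfl
        exact hy hx
      simp [υ, this]
    have hυx : υ x = t := by simp [υ]
    have hlew := eraseVars_le_toCtx_subst (maxTop_le h𝕃 b) hυ
    have hlew' := eraseVars_le_toCtx_subst (maxTop_le h𝕃 b') hυ
    have hpw : IsFunPos (maxTop 𝕃 (b.subst υ)) p := by
      refine IsFunPos.mono (le_maxTop h𝕃 hN hlew) ?_
      obtain ⟨n, f, ts, h⟩ := hp
      exact ⟨n, f, _, subtermAt_eraseVars h⟩
    have hstw := hst.subst υ
    obtain ⟨N₁, hN₁, hN₁st⟩ := hR.weaklyLayered ρ hρ _ _ _ p (isMaxTop_maxTop h𝕃 _) hpw hstw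
    have hC1 := hR.c1 ρ hρ _ _ _ p (isMaxTop_maxTop h𝕃 _) hpw hstw N₁ hN₁ hN₁st
    -- the position of `x` in `b'` stems from a position in `b`
    obtain ⟨j, hj, hji⟩ : ∃ j, IsVarPos b x j ∧
        subtermAt N₁ i = subtermAt (maxTop 𝕃 (b.subst υ)) j := by
      obtain ⟨θ, hbp, rfl⟩ := hst
      obtain ⟨θ₁, hMp, rfl⟩ := hN₁st
      have hi' := isVarPos_toCtx.2 hi
      rw [toCtx_replaceAt ⟨_, hbp⟩] at hi'
      rcases subtermAt_replaceAt_of_var (isPos_toCtx.2 ⟨_, hbp⟩) hi' with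
        ⟨r, rfl, hr⟩ | ⟨hr, hr'⟩
      · obtain ⟨i₁, i₂, z, rfl, hz, hx₂⟩ := isVarPos_subst.1 (isVarPos_toCtx.1 hr)
        obtain ⟨k, hk⟩ := R.vars_rhs_subset ρ hρ ⟨i₁, hz⟩
        refine ⟨p ++ (k ++ i₂), ?_, ?_⟩
        · rw [isVarPos_append hbp]
          exact isVarPos_subst.2 ⟨k, i₂, z, rfl, hk, hx₂⟩
        · rw [subtermAt_replaceAt_append ⟨_, hMp⟩, subtermAt_append_of_eq hMp,
            subtermAt_append_of_eq (subtermAt_subst hz θ₁),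
            subtermAt_append_of_eq (subtermAt_subst hk θ₁)]
      · exact ⟨i, isVarPos_toCtx.1 hr, hr' _ _ ⟨_, hMp⟩⟩
    have hbj : subtermAt (b.subst υ) j = some t := by
      have := subtermAt_subst hj υ
      rwa [Term.subst, hυx] at this
    have hb'i : subtermAt (b'.subst υ) i = some t := by
      have := subtermAt_subst hi υ
      rwa [Term.subst, hυx] at this
    have hN₁i : IsPos N₁ i := by
      obtain ⟨D, hD, -⟩ := subtermAt_mono (le_maxTop h𝕃 hN hlew) (hole_of hx hj)
      exact ⟨D, hji.trans hD⟩
    -- (C1) makes the reduct of the max-top a max-top again. The exception `□` has no position other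
    -- than the root, whence the alternative `i = []`.
    have hmax : N₁ = maxTop 𝕃 (b'.subst υ) := by
      rcases hC1 with h | rfl
      · exact eq_maxTop h𝕃 h
      · obtain ⟨D, hD⟩ := hN₁i
        exact absurd (subtermAt_var_eq_some.1 hD).1 hi0
    rw [← maxTop_ne_hole_iff h𝕃 hR.c2 hN' hlew' (hole_of' hx hi) hb'i, ← hmax, hji,
      maxTop_ne_hole_iff h𝕃 hR.c2 hN hlew (hole_of hx hj) hbj,
      (hκ x hx j hj).resolve_left (hne hj)]
  · obtain ⟨q, r, a, a', rfl, ha, haa', rfl⟩ := exists_alien_step hρ hf.le hp hst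
    have haX := (fits_iff.1 hf).2 q a ha
    have ha'X := hgood.closed a a' haX ⟨ρ, hρ, r, haa'⟩
    have hib : IsVarPos b x i := by
      rcases subtermAt_replaceAt_of_var ⟨_, ha.2⟩ hi with ⟨r', rfl, hr'⟩ | ⟨h, -⟩
      · exact absurd ⟨r', hr'⟩ (ha'X.2 x hx)
      · exact h
    right
    rw [← (hκ x hx i hib).resolve_left (hne hib)]
    refine fusing_eq_fusing h𝕃 hR.c2 hN' hN hNb' ?_ (hole_of' hx hi) (hole_of hx hib)
    rw [toCtx_replaceAt ⟨_, ha.2⟩]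
    refine le_replaceAt_of_hole hNb ?_ _
    rw [subtermAt_eraseVars ha.1, eraseVars_hole]

/-- The induction step for layered systems. -/
theorem Layered.crOn_grow [Nonempty V] (hA : Good 𝕃 R A) (hcr : CROn R.Rel (Grow 𝕃 A)) :
    CROn R.Rel (Grow 𝕃 (Grow 𝕃 A)) := by
  classical
  have hW := hR.weaklyLayered
  -- The fusing set knows which variables a hole admits, so it can serve as the key; the second half
  -- of (L2') says that there are infinitely many.
  choose χ σ hrep hkey using fun s => exists_isRep h𝕃 hA s (K := Set (L.Term V))
    (fun p => fusing 𝕃 (maxTop 𝕃 s) p) (fun k => {x : V | Term.var x ∈ k}) (by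
      intro p a ha
      have hmem : ∀ x : V, Term.var x ∈ fusing 𝕃 (maxTop 𝕃 s) p ↔
          replaceAt (maxTop 𝕃 s) p (ctxVar x) ∈ 𝕃 := by
        intro x
        constructor
        · rintro ⟨D, hD, hDx, hmem⟩
          rcases le_ctxVar_iff.1 hDx with rfl | rfl
          · exact absurd rfl hD
          · exact hmem
        · exact fun h => ⟨ctxVar x, ctxVar_ne_hole x, le_rfl, h⟩
      refine ⟨?_, fun x hx => (hmem x).1 hx⟩
      simp only [hmem]
      exact allowed_infinite h𝕃 (maxTop_mem h𝕃 s) ha.1.1)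
  have heq : ∀ s p q, (∀ a, IsTallAt 𝕃 A s p a ↔ IsTallAt 𝕃 A s q a) →
      (∀ a, IsTallAt 𝕃 A s p a → fusing 𝕃 (maxTop 𝕃 s) p = fusing 𝕃 (maxTop 𝕃 s) q) →
      χ s p = χ s q := by
    intro s p q h1 h2
    by_cases h : ∃ a, IsTallAt 𝕃 A s p a
    · obtain ⟨a, ha⟩ := h
      exact (hkey s p q a a ha ((h1 a).1 ha)).2 ⟨rfl, h2 a ha⟩
    · have hp : χ s p = none := by
        by_contra hp
        exact h (((hrep s).dom p).1 hp)
      have hq : χ s q = none := by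
        by_contra hq
        obtain ⟨a, ha⟩ := ((hrep s).dom q).1 hq
        exact h ⟨a, (h1 a).2 ha⟩
      rw [hp, hq]
  have H : RepSystem 𝕃 R A χ σ fun _ => () := by
    refine ⟨fun s _ => hrep s, ?_, fun _ _ _ _ _ _ => le_rfl, ?_⟩
    · intro s _ ρ hρ p t hst hp z q₁ q₂ r h1 h2
      obtain ⟨e1, e2, e3⟩ := hR.uniform_redex h𝕃 hρ hst hp h1 h2 (r := r)
      refine heq s _ _ (fun a => ?_) fun a ha => e3 ha.1.1
      rw [IsTallAt, IsTallAt, IsAlienAt, IsAlienAt, e1, e2]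
    · intro s hs b τ hb hτ hτid
      refine Or.inr fun c hc => ?_
      have hr := hrep s
      have hgood := hA.avoiding (marked (χ s))
      have hbG : b ∈ Grow 𝕃 (avoiding A (marked (χ s))) :=
        (hgood.grow h𝕃 hW).closed_rtc hr.mem hb
      have hτG : ∀ x ∈ marked (χ s), τ x ∈ Grow 𝕃 A := fun x hx =>
        (hA.grow h𝕃 hW).closed_rtc (hr.marked_alien_mem h𝕃 hW hA hs hx) (hτ x hx)
      let κ : V → Set (L.Term V) := fun x => if h : x ∈ marked (χ s) then
        fusing 𝕃 (maxTop 𝕃 s) h.choose else ∅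
      have hκs : ∀ x i, χ s i = some x → fusing 𝕃 (maxTop 𝕃 s) i = κ x := by
        intro x i hi
        have hx : x ∈ marked (χ s) := ⟨i, hi⟩
        simp only [κ, dif_pos hx]
        obtain ⟨a, ha⟩ := (hr.dom i).1 (by simp [hi])
        obtain ⟨a', ha'⟩ := (hr.dom hx.choose).1 (by simp [hx.choose_spec])
        exact ((hkey s _ _ a a' ha ha').1 (hi.trans hx.choose_spec.symm)).2
      -- The fusing set attached to each mark is an invariant of the rewrite sequence from the
      -- marked term to `b`.
      have hκ : ∀ x ∈ marked (χ s), ∀ i, IsVarPos b x i →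
          i = [] ∨ fusing 𝕃 (eraseVars (marked (χ s)) (maxTop 𝕃 b)) i = κ x := by
        clear hbG hc
        induction hb with
        | refl =>
          intro x hx i hi
          right
          have hi' := (hr.isVarPos_mark_iff hx).1 hi
          rw [← hκs x i hi']
          refine fusing_eq_fusing h𝕃 hR.c2 (eraseVars_mem h𝕃 _ (maxTop_mem h𝕃 _))
            (maxTop_mem h𝕃 s) (eraseVars_le_toCtx (maxTop_le h𝕃 _) _)
            (hr.le_toCtx_mark h𝕃) ?_ (hr.hole (by simp [hi']))
          rw [subtermAt_eraseVars (isVarPos_of_fits_avoiding (hgood.fits_maxTop h𝕃 hr.mem) hx hi),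
            eraseVars_ctxVar_of_mem hx]
        | tail h1 h2 ih =>
          exact hR.fusing_step h𝕃 hA ((hgood.grow h𝕃 hW).closed_rtc hr.mem h1) h2 ih
      refine short_of_uniform h𝕃 hA hbG hτG hτid (hrep _) ?_ hc
      have hN := eraseVars_mem h𝕃 (marked (χ s)) (maxTop_mem h𝕃 b)
      have hNw := eraseVars_le_toCtx_subst (maxTop_le h𝕃 b) hτid
      have hNi : ∀ x ∈ marked (χ s), ∀ i, IsVarPos b x i →
          subtermAt (eraseVars (marked (χ s)) (maxTop 𝕃 b)) i = some hole := by
        intro x hx i hi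
        rw [subtermAt_eraseVars (isVarPos_of_fits_avoiding (hgood.fits_maxTop h𝕃 hbG) hx hi),
          eraseVars_ctxVar_of_mem hx]
      intro x hx p q hp hq
      by_cases hp0 : p = []
      · subst hp0
        rw [hp.eq_nil_of_append (q := q) hq]
      by_cases hq0 : q = []
      · subst hq0
        exact absurd (hq.eq_nil_of_append (q := p) hp) hp0
      have hpκ := (hκ x hx p hp).resolve_left hp0
      have hqκ := (hκ x hx q hq).resolve_left hq0
      have hZ : ∀ i, IsVarPos b x i → subtermAt (b.subst τ) i = some (τ x) :=
        fun i hi => subtermAt_subst hi τ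
      -- The same term `τ x` sits at `p` and `q`, and the fusing sets agree there, so either both
      -- occurrences have fused or both are still aliens.
      have hiff : subtermAt (maxTop 𝕃 (b.subst τ)) p ≠ some hole ↔
          subtermAt (maxTop 𝕃 (b.subst τ)) q ≠ some hole := by
        rw [maxTop_ne_hole_iff h𝕃 hR.c2 hN hNw (hNi x hx p hp) (hZ p hp),
          maxTop_ne_hole_iff h𝕃 hR.c2 hN hNw (hNi x hx q hq) (hZ q hq), hpκ, hqκ]
      refine heq _ _ _ (fun a => ?_) fun a ha => ?_
      · rw [IsTallAt, IsTallAt, IsAlienAt, IsAlienAt, hZ p hp, hZ q hq, not_iff_not.1 hiff]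
      · have hm : maxTop 𝕃 (b.subst τ) ∈ 𝕃 := maxTop_mem h𝕃 _
        rw [fusing_eq_fusing h𝕃 hR.c2 hm hN (maxTop_le h𝕃 _) hNw ha.1.1 (hNi x hx p hp),
          fusing_eq_fusing h𝕃 hR.c2 hm hN (maxTop_le h𝕃 _) hNw
            ((not_iff_not.1 hiff).1 ha.1.1) (hNi x hx q hq), hpκ, hqκ]
  exact H.crOn h𝕃 hW hA hcr

end Layered

/-! ### Renaming variables -/

theorem isFunPos_subst_var {t : L.Term X} (g : X → Y) {p : List ℕ} :
    IsFunPos (t.subst fun y => Term.var (g y)) p ↔ IsFunPos t p := by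
  constructor
  · rintro ⟨n, f, ts, h⟩
    rw [subst_eq_psubst] at h
    rcases subtermAt_psubst_eq_some h with h | ⟨q, r, z, -, -, h⟩
    · exact h
    · exact absurd (subtermAt_var_eq_some.1 h).2 (by simp)
  · rintro ⟨n, f, ts, h⟩
    exact ⟨n, f, _, subtermAt_subst h _⟩

/-- Renaming or erasing variables does not touch function symbols, so the pattern `l` is already
present in `c`. Repeated variables of `l` may be matched differently in `c`, hence a positional
substitution. -/
theorem exists_eq_psubst {l : L.Term Z} {c : L.Term X} {g : X → Y} {θ : Z → L.Term Y}
    (h : (c.subst fun y => Term.var (g y)) = l.subst θ) : ∃ ψ, c = psubst l ψ := by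
  induction l generalizing c with
  | var z => exact ⟨fun _ _ => c, rfl⟩
  | @func n f ts ih =>
    cases c with
    | var y => simp [Term.subst] at h
    | @func m f' cs =>
      simp only [Term.subst, Term.func.injEq] at h
      obtain ⟨rfl, hf, hts⟩ := h
      obtain rfl := eq_of_heq hf
      have hts := congrFun (eq_of_heq hts)
      choose ψ hψ using fun i => ih i (hts i)
      refine ⟨fun p => match p with
        | [] => fun _ => Term.func f' cs
        | i :: p => if hi : i < m then ψ ⟨i, hi⟩ p else fun _ => Term.func f' cs, ?_⟩
      rw [psubst]
      congr 1
      funext i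
      simpa using hψ i

theorem exists_psubst_eq_subst [Nonempty X] {l : L.Term Z} {ψ : List ℕ → Z → L.Term X}
    (h : ∀ z q₁ q₂, IsVarPos l z q₁ → IsVarPos l z q₂ → ψ q₁ z = ψ q₂ z) :
    ∃ θ, psubst l ψ = l.subst θ := by
  classical
  let θ : Z → L.Term X := fun z => if hz : ∃ q, IsVarPos l z q then ψ hz.choose z
    else Term.var (Classical.arbitrary X)
  refine ⟨θ, ?_⟩
  rw [subst_eq_psubst]
  refine psubst_congr fun q z hq => ?_
  have hz : ∃ q, IsVarPos l z q := ⟨q, hq⟩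
  simp only [θ, dif_pos hz]
  exact h z _ _ hq hz.choose_spec

theorem exists_var_ne {c d : L.Term X} {g : X → Y}
    (h : (c.subst fun y => (Term.var (g y) : L.Term Y)) = d.subst fun y => Term.var (g y))
    (hne : c ≠ d) : ∃ r y z, IsVarPos c y r ∧ IsVarPos d z r ∧ y ≠ z := by
  induction c generalizing d with
  | var y =>
    cases d with
    | var z =>
      exact ⟨[], y, z, by simp [IsVarPos], by simp [IsVarPos], fun h => hne (by rw [h])⟩
    | func f ds => simp [Term.subst] at h
  | func f cs ih =>
    cases d with
    | var z => simp [Term.subst] at h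
    | func f' ds =>
      simp only [Term.subst, Term.func.injEq] at h
      obtain ⟨rfl, hf, hts⟩ := h
      obtain rfl := eq_of_heq hf
      have hts := congrFun (eq_of_heq hts)
      have : ∃ i, cs i ≠ ds i := by
        by_contra! h
        exact hne (congrArg _ (funext h))
      obtain ⟨i, hi⟩ := this
      obtain ⟨r, y, z, h1, h2, h3⟩ := ih i (hts i) hi
      exact ⟨i :: r, y, z, by simpa using h1, by simpa using h2, h3⟩

/-! ### Layers without restrictions on the variables -/

/-- The context that results from replacing all variables of a term by holes. -/
def shape (t : L.Term X) : Ctx L V := t.subst fun _ => hole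

theorem shape_subst_var (t : L.Term X) (g : X → Y) :
    shape (V := V) (t.subst fun y => (Term.var (g y) : L.Term Y)) = shape t := by
  rw [shape, psubst_psubst_subst]
  rfl

@[simp] theorem shape_toCtx (t : L.Term V) : shape (V := V) (toCtx t) = shape t := by
  rw [toCtx_eq_subst]
  exact shape_subst_var t some

@[simp] theorem shape_shape (t : L.Term X) : shape (V := V) (shape t : Ctx L V) = shape t :=
  shape_subst_var t fun _ => (none : Option V)

theorem shape_le (C : Ctx L V) : shape C ≤ C := by
  induction C with
  | var o => exact hole_le _
  | func f ts ih => exact Ctx.Le.func f _ _ ih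

theorem shape_le_toCtx (t : L.Term V) : shape t ≤ toCtx t := by
  rw [← shape_toCtx]
  exact shape_le _

theorem shape_mono {C D : Ctx L V} (h : C ≤ D) : (shape C : Ctx L V) ≤ shape D := by
  induction h with
  | hole C => exact hole_le _
  | var y => exact le_rfl
  | func f Cs Ds _ ih => exact Ctx.Le.func f _ _ ih

theorem isFunPos_shape {t : L.Term X} {p : List ℕ} :
    IsFunPos (shape t : Ctx L V) p ↔ IsFunPos t p :=
  isFunPos_subst_var fun _ => (none : Option V)

theorem shape_replaceAt {t : L.Term X} {p : List ℕ} (h : IsPos t p) (s : L.Term X) :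
    (shape (replaceAt t p s) : Ctx L V) = replaceAt (shape t) p (shape s) :=
  subst_replaceAt h s _

theorem shape_mem (h𝕃 : IsVarRestrictedLayerSystem 𝕃) {C : Ctx L V} (hC : C ∈ 𝕃) :
    shape C ∈ 𝕃 := by
  rw [shape, subst_eq_psubst]
  exact psubst_erase_mem h𝕃 hC fun _ _ _ => Or.inl rfl

theorem replaceAt_shape_mem (h𝕃 : IsVarRestrictedLayerSystem 𝕃) {C : Ctx L V} (hC : C ∈ 𝕃)
    {y : V} {p : List ℕ} (hp : IsVarPos C (some y) p) :
    replaceAt (shape C) p (ctxVar y) ∈ 𝕃 := by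
  rw [shape, subst_eq_psubst, replaceAt_psubst_var hp]
  refine psubst_erase_mem h𝕃 hC fun q o hq => ?_
  by_cases hqp : q = p
  · subst hqp
    rw [hq.unique hp]
    exact Or.inr (if_pos rfl)
  · exact Or.inl (if_neg hqp)

theorem merge_mem (h𝕃 : IsVarRestrictedLayerSystem 𝕃) {C D E : Ctx L V} (hC : C ∈ 𝕃)
    (hD : D ∈ 𝕃) (h : Merge C D E) : E ∈ 𝕃 := by
  cases h with
  | hole_left => exact hD
  | hole_right => exact hC
  | var => exact hC
  | func f Cs Ds Es hs =>
    exact h𝕃.l3 _ hC _ hD [] (by simp) _ _ (by simp) (Merge.func f Cs Ds Es hs).isMerge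

theorem Merge.shape {C D E : Ctx L V} (h : Merge C D E) :
    Merge (shape C : Ctx L V) (LayerSystems.shape D) (LayerSystems.shape E) := by
  induction h with
  | hole_left D => exact Merge.hole_left _
  | hole_right C => exact Merge.hole_right _
  | var y => exact Merge.hole_left _
  | func f Cs Ds Es _ ih => exact Merge.func f _ _ _ ih

/-- The contexts that have the shape of a layer. -/
def unrestricted (𝕃 : Set (Ctx L V)) : Set (Ctx L V) := {C | shape C ∈ 𝕃}

theorem replaceAt_mem_unrestricted {C : Ctx L V} {p : List ℕ} (hp : IsPos C p) (o o' : Option V)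
    (h : replaceAt C p (Term.var o) ∈ unrestricted 𝕃) :
    replaceAt C p (Term.var o') ∈ unrestricted 𝕃 := by
  rw [unrestricted, Set.mem_ofPred_eq, shape_replaceAt hp] at h ⊢
  exact h

/-- Shapes do not see variables, which trivialises (L2'). For (L1) layers are closed under taking
shapes, and for (L3) merges commute with taking shapes. -/
theorem IsVarRestrictedLayerSystem.unrestricted [Infinite V]
    (h𝕃 : IsVarRestrictedLayerSystem 𝕃) : IsVarRestrictedLayerSystem (unrestricted 𝕃) where
  l1 t := by
    obtain ⟨T, ⟨hT, hle⟩, hne⟩ := h𝕃.l1 t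
    exact ⟨T, ⟨shape_mem h𝕃 hT, hle⟩, hne⟩
  l2' C p hp := by
    refine ⟨fun y h => replaceAt_mem_unrestricted hp _ _ h, fun h => ?_⟩
    convert Set.infinite_univ (α := V)
    exact Set.eq_univ_of_forall fun y => replaceAt_mem_unrestricted hp _ _ h
  l3 C hC N hN p hp D E hD hE := by
    rw [LayerSystems.unrestricted, Set.mem_ofPred_eq, shape_replaceAt ⟨_, hD⟩]
    exact h𝕃.l3 _ hC _ hN p (isFunPos_shape.2 hp) (shape D) _ (subtermAt_subst hD _)
      hE.merge.shape.isMerge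

/-- A context below `t` is determined by its shape except at the variables of `t`, where it may have
a variable or a hole; the last two hypotheses exclude the hole. -/
theorem eq_of_shape_eq {C D : Ctx L V} {t : L.Term V} (hC : C ≤ toCtx t) (hD : D ≤ toCtx t)
    (h : (shape C : Ctx L V) = shape D)
    (hC' : ∀ i y, IsVarPos t y i → subtermAt C i ≠ some hole)
    (hD' : ∀ i y, IsVarPos t y i → subtermAt D i ≠ some hole) : C = D := by
  induction t generalizing C D with
  | var y =>
    have h1 : C ≠ hole := by
      rintro rfl
      exact hC' [] y (by simp [IsVarPos]) (by simp)
    have h2 : D ≠ hole := by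
      rintro rfl
      exact hD' [] y (by simp [IsVarPos]) (by simp)
    rw [(le_ctxVar_iff.1 hC).resolve_left h1, (le_ctxVar_iff.1 hD).resolve_left h2]
  | func f ts ih =>
    rcases le_func_iff.1 hC with rfl | ⟨Cs, rfl, hCs⟩ <;>
      rcases le_func_iff.1 hD with rfl | ⟨Ds, rfl, hDs⟩
    · rfl
    · exact absurd h.symm (func_ne_hole _ _)
    · exact absurd h (func_ne_hole _ _)
    · simp only [shape, Term.subst, Term.func.injEq, heq_eq_eq, true_and] at h
      refine congrArg _ (funext fun i => ih i (hCs i) (hDs i) (congrFun h i) ?_ ?_)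
      · intro j y hj
        have := hC' (i :: j) y (by simpa using hj)
        simpa using this
      · intro j y hj
        have := hD' (i :: j) y (by simpa using hj)
        simpa using this

/-- The unrestricted max-top `M` has the shape of the original max-top, with all variables of `s`
filled in that it reaches. The redex found by (W) in the original max-top gives the function symbols
of the redex in `M`. Subterms of `M` for the same rule variable have equal shapes, lie below the
same term and have no holes at its variables, so they are equal, and the rule applies to `M` even if
it is not left-linear. -/
theorem WeaklyLayered.unrestricted [Infinite V] (h𝕃 : IsVarRestrictedLayerSystem 𝕃)
    (hW : WeaklyLayered 𝕃 R) : WeaklyLayered (unrestricted 𝕃) R := by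
  have h𝕃' := h𝕃.unrestricted
  intro ρ hρ s t M p hM hp hst
  obtain rfl := eq_maxTop h𝕃' hM
  set M := maxTop (LayerSystems.unrestricted 𝕃) s with hMdef
  have hMmem : shape M ∈ 𝕃 := maxTop_mem h𝕃' s
  have hMle : M ≤ toCtx s := maxTop_le h𝕃' s
  have h1 : shape M ≤ maxTop 𝕃 s := le_maxTop h𝕃 hMmem ((shape_le M).trans hMle)
  have h2 : maxTop 𝕃 s ≤ M := le_maxTop h𝕃' (shape_mem h𝕃 (maxTop_mem h𝕃 s)) (maxTop_le h𝕃 s)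
  have hshape : (shape M : Ctx L V) = shape (maxTop 𝕃 s) := by
    refine le_antisymm ?_ (shape_mono h2)
    have := shape_mono h1
    rwa [shape_shape] at this
  have hnohole : ∀ i y, IsVarPos s y i → subtermAt M i ≠ some hole := by
    intro i y hi h
    have h3 : replaceAt M i (ctxVar y) ∈ LayerSystems.unrestricted 𝕃 := by
      refine replaceAt_mem_unrestricted ⟨_, h⟩ none _ ?_
      have := replaceAt_self h
      rw [hole] at this
      rw [this]
      exact maxTop_mem h𝕃' s
    have h4 := le_maxTop h𝕃' h3 (replaceAt_le ⟨_, h⟩ ((replaceAt_hole_le ⟨_, h⟩).trans hMle)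
      (subtermAt_toCtx hi) le_rfl)
    have h5 := subtermAt_le_subtermAt h4 (subtermAt_replaceAt ⟨_, h⟩ _) h
    exact ctxVar_ne_hole y (le_hole_iff.1 h5)
  have hpM : IsFunPos (maxTop 𝕃 s) p := (isFunPos_shape.2 hp).mono h1
  obtain ⟨N, hN, θ, hθ, rfl⟩ := hW ρ hρ s t _ p (isMaxTop_maxTop h𝕃 s) hpM hst
  obtain ⟨θs, hs, rfl⟩ := hst
  obtain ⟨e, he⟩ := hp.isPos
  have hse : (shape e : Ctx L V) = ρ.1.subst fun z => shape (θ z) := by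
    have h3 : subtermAt (shape M : Ctx L V) p = some (shape e) := subtermAt_subst he _
    rw [hshape] at h3
    have h4 : subtermAt (shape (maxTop 𝕃 s) : Ctx L V) p = some (shape (ρ.1.subst θ)) :=
      subtermAt_subst hθ _
    rw [h3, Option.some.injEq] at h4
    rw [h4, shape, psubst_psubst_subst]
    rfl
  obtain ⟨ψ, rfl⟩ := exists_eq_psubst (g := fun _ => none) hse
  have hψ : ∀ q z, IsVarPos ρ.1 z q → (shape (ψ q z) : Ctx L V) = shape (θ z) := by
    intro q z hq
    have h3 : subtermAt (shape (psubst ρ.1 ψ) : Ctx L V) q = some (shape (ψ q z)) :=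
      subtermAt_subst (subtermAt_psubst_var hq ψ) _
    rw [hse, subtermAt_subst hq, Option.some.injEq] at h3
    exact h3.symm
  have hsq : ∀ q z, IsVarPos ρ.1 z q → subtermAt s (p ++ q) = some (θs z) := by
    intro q z hq
    rw [subtermAt_append_of_eq hs, subtermAt_subst hq]
    rfl
  have hMq : ∀ q z, IsVarPos ρ.1 z q → subtermAt M (p ++ q) = some (ψ q z) := by
    intro q z hq
    rw [subtermAt_append_of_eq he, subtermAt_psubst_var hq]
  obtain ⟨θ', hθ'⟩ := exists_psubst_eq_subst (l := ρ.1) (ψ := ψ) (by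
    intro z q₁ q₂ h3 h4
    have hcond : ∀ q, IsVarPos ρ.1 z q → ψ q z ≤ toCtx (θs z) ∧
        ∀ i y, IsVarPos (θs z) y i → subtermAt (ψ q z) i ≠ some hole := by
      intro q hq
      refine ⟨subtermAt_le_subtermAt hMle (hMq q z hq) (subtermAt_toCtx (hsq q z hq)), ?_⟩
      intro i y hi h
      refine hnohole (p ++ q ++ i) y ((isVarPos_append (hsq q z hq)).2 hi) ?_
      rw [subtermAt_append_of_eq (hMq q z hq), h]
    refine eq_of_shape_eq (hcond q₁ h3).1 (hcond q₂ h4).1 ?_ (hcond q₁ h3).2 (hcond q₂ h4).2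
    rw [hψ q₁ z h3, hψ q₂ z h4])
  have hθψ : ∀ q z, IsVarPos ρ.1 z q → θ' z = ψ q z := by
    intro q z hq
    rw [subst_eq_psubst] at hθ'
    exact (psubst_inj hθ' hq).symm
  rw [hθ'] at he
  refine ⟨_, ?_, θ', he, rfl⟩
  rw [LayerSystems.unrestricted, Set.mem_ofPred_eq, shape_replaceAt ⟨_, he⟩]
  have h6 := shape_mem h𝕃 hN
  rw [shape_replaceAt ⟨_, hθ⟩, ← hshape] at h6
  have h7 : (shape (ρ.2.subst θ') : Ctx L V) = shape (ρ.2.subst θ) := by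
    rw [shape, shape, psubst_psubst_subst, psubst_psubst_subst]
    refine subst_congr fun z hz => ?_
    obtain ⟨q, hq⟩ := R.vars_rhs_subset ρ hρ hz
    rw [hθψ q z hq]
    exact hψ q z hq
  rwa [h7]

/-! ### Terms with diamonds -/

/-- A term over the signature extended by `◇`. -/
def emb (t : L.Term X) : (L.sum diamondLang).Term X := LHom.sumInl.onTerm t

@[simp] theorem emb_var (y : X) : emb (Term.var y : L.Term X) = Term.var y := rfl

/-- A function symbol of the signature extended by `◇`. -/
def embFn {n : ℕ} (f : L.Functions n) : (L.sum diamondLang).Functions n := Sum.inl f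

@[simp] theorem emb_func {n : ℕ} (f : L.Functions n) (ts : Fin n → L.Term X) :
    emb (Term.func f ts) = Term.func (embFn f) fun i => emb (ts i) := rfl

theorem emb_psubst (t : L.Term X) (φ : List ℕ → X → L.Term Y) :
    emb (psubst t φ) = psubst (emb t) fun p y => emb (φ p y) := by
  induction t generalizing φ with
  | var y => rfl
  | func f ts ih => simp only [psubst, emb_func, ih]

theorem emb_subst (t : L.Term X) (σ : X → L.Term Y) :
    emb (t.subst σ) = (emb t).subst fun y => emb (σ y) := by
  rw [subst_eq_psubst, emb_psubst, subst_eq_psubst]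

theorem subtermAt_emb {t u : L.Term X} {p : List ℕ} (h : subtermAt t p = some u) :
    subtermAt (emb t) p = some (emb u) := by
  induction p generalizing t with
  | nil =>
    simp only [subtermAt_nil, Option.some.injEq] at h
    rw [h, subtermAt_nil]
  | cons i p ih =>
    obtain ⟨n, f, ts, j, rfl, rfl, h₁⟩ := subtermAt_cons_eq_some.1 h
    rw [emb_func, subtermAt_func_fin, ih h₁]

theorem emb_replaceAt (t s : L.Term X) (p : List ℕ) :
    emb (replaceAt t p s) = replaceAt (emb t) p (emb s) := by
  induction p generalizing t with
  | nil => simp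
  | cons i p ih =>
    cases t with
    | var y => rfl
    | func f ts =>
      simp only [replaceAt, emb_func]
      congr 1
      funext j
      split_ifs
      · exact ih _
      · rfl

theorem isVarPos_emb {t : L.Term X} {p : List ℕ} {y : X} (h : IsVarPos (emb t) y p) :
    IsVarPos t y p := by
  induction t generalizing p with
  | var z => exact isVarPos_var.2 (isVarPos_var.1 h)
  | func f ts ih =>
    cases p with
    | nil => simp at h
    | cons i p =>
      obtain ⟨n, g, us, j, hu, rfl, h₁⟩ := subtermAt_cons_eq_some.1 h
      rw [emb_func] at hu
      cases hu
      simpa using ih j h₁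

theorem Step.emb {s t : L.Term X} (h : Step R.rules s t) :
    Step R.rulesWithDiamond (emb s) (emb t) := by
  obtain ⟨ρ, hρ, p, θ, hs, rfl⟩ := h
  refine ⟨_, ⟨ρ, hρ, rfl⟩, p, fun y => LayerSystems.emb (θ y), ?_, ?_⟩
  · rw [subtermAt_emb hs, emb_subst]
    rfl
  · rw [emb_replaceAt, emb_subst]
    rfl

theorem rtc_emb {s t : L.Term X} (h : ReflTransGen (Step R.rules) s t) :
    ReflTransGen (Step R.rulesWithDiamond) (emb s) (emb t) := by
  induction h with
  | refl => exact .refl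
  | tail _ h ih => exact ih.tail h.emb

theorem step_diamond [Nonempty V] (t : (L.sum diamondLang).Term X) :
    Step (diamondRules L V) (diamond t) t :=
  ⟨_, ⟨Classical.arbitrary V, rfl⟩, [], fun _ => t, by simp; rfl, by simp⟩

theorem rtc_diamond_congr {S : Set ((L.sum diamondLang).Term V × (L.sum diamondLang).Term V)}
    {s t : (L.sum diamondLang).Term X} (h : ReflTransGen (Step S) s t) :
    ReflTransGen (Step S) (diamond s) (diamond t) :=
  rtc_func _ fun _ => h

/-! ### A measure for bounded duplicating systems -/

section Measure

variable (hR : R.IsBoundedDuplicating)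

/-- The rank of a term with respect to the relation that witnesses bounded duplication. -/
noncomputable def diamondRank (hR : R.IsBoundedDuplicating) (t : (L.sum diamondLang).Term V) :
    Ordinal := (WellFounded.apply hR t).rank

theorem diamondRank_lt_of_transGen {s t : (L.sum diamondLang).Term V}
    (h : TransGen (RelativeTo (Step (diamondRules L V)) (Step R.rulesWithDiamond)) s t) :
    diamondRank hR t < diamondRank hR s :=
  Acc.rank_lt_of_rel (WellFounded.apply hR s) h

theorem diamondRank_lt {s t : (L.sum diamondLang).Term V} (h : Step (diamondRules L V) s t) :
    diamondRank hR t < diamondRank hR s :=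
  diamondRank_lt_of_transGen hR (.single ⟨s, .refl, t, h, .refl⟩)

theorem diamondRank_le_of_rtc_diamond {s t : (L.sum diamondLang).Term V}
    (h : ReflTransGen (Step (diamondRules L V)) s t) : diamondRank hR t ≤ diamondRank hR s := by
  induction h with
  | refl => exact le_rfl
  | tail _ h ih => exact (diamondRank_lt hR h).le.trans ih

/-- Rewriting by `R` alone is no step of the terminating relation, but it can be prepended to one:
whatever `t` reaches, `s` reaches as well. -/
theorem diamondRank_le_of_rtc {s t : (L.sum diamondLang).Term V}
    (h : ReflTransGen (Step R.rulesWithDiamond) s t) : diamondRank hR t ≤ diamondRank hR s := by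
  rw [diamondRank, Acc.rank_eq]
  refine Ordinal.iSup_le fun ⟨w, hw⟩ => ?_
  refine Order.succ_le_of_lt (diamondRank_lt_of_transGen hR ?_)
  obtain ⟨u, ⟨a, h1, h2⟩, h3⟩ := TransGen.head'_iff.1 hw
  exact TransGen.head' ⟨a, h.trans h1, h2⟩ h3

theorem strictMono_diamondRank_replaceAt [Nonempty V] {s : (L.sum diamondLang).Term V}
    {p : List ℕ} (hp : IsPos s p) (t : (L.sum diamondLang).Term V) :
    StrictMono fun k => diamondRank hR (replaceAt s p (diamond^[k] t)) := by
  refine strictMono_nat_of_lt_succ fun k => diamondRank_lt hR ?_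
  rw [Function.iterate_succ_apply']
  have := (step_diamond (V := V) (diamond^[k] t)).replaceAt
    (subtermAt_replaceAt hp (diamond (diamond^[k] t)))
  rwa [replaceAt_replaceAt] at this

/-! ### Terms of rank one for unrestricted layers -/

/-- The term `b` with each variable replaced by a stack of diamonds that encodes it. -/
def encode (enc : V → ℕ) (x₀ : V) (b : L.Term V) : (L.sum diamondLang).Term V :=
  (emb b).subst fun x => diamond^[enc x] (Term.var x₀)

theorem encode_rtc {b c : L.Term V} (enc : V → ℕ) (x₀ : V) (h : ReflTransGen R.Rel b c) :
    diamondRank hR (encode enc x₀ c) ≤ diamondRank hR (encode enc x₀ b) :=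
  diamondRank_le_of_rtc hR (rtc_subst (rtc_emb h) _)

theorem encode_replaceAt_lt [Nonempty V] (enc : V → ℕ) (x₀ : V) {b : L.Term V} {x y : V}
    {p : List ℕ} (hp : IsVarPos b x p) (h : enc y < enc x) :
    diamondRank hR (encode enc x₀ (replaceAt b p (Term.var y))) <
      diamondRank hR (encode enc x₀ b) := by
  have hb : subtermAt (encode enc x₀ b) p = some (diamond^[enc x] (Term.var x₀)) :=
    subtermAt_subst (subtermAt_emb hp) _
  have h1 : encode enc x₀ (replaceAt b p (Term.var y)) =
      replaceAt (encode enc x₀ b) p (diamond^[enc y] (Term.var x₀)) := by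
    rw [encode, emb_replaceAt, subst_replaceAt ⟨_, subtermAt_emb hp⟩]
    rfl
  rw [h1]
  conv_rhs => rw [← replaceAt_self hb]
  exact strictMono_diamondRank_replaceAt hR ⟨_, hb⟩ _ h

/-- (L2') does not allow exchanging one admissible variable for another while the rest of the layer
keeps its variables. Instead `b[□]_p` and the variable-free layer with `y` at `p` are merged by
(L3). -/
theorem replaceAt_var_mem (h𝕃 : IsVarRestrictedLayerSystem 𝕃) {b : L.Term V}
    (hb : toCtx b ∈ 𝕃) {y : V} {p : List ℕ} (hp : IsPos b p)
    (h : replaceAt (shape b) p (ctxVar y) ∈ 𝕃) {x : V} (hx : IsVarPos b x p) :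
    toCtx (replaceAt b p (Term.var y)) ∈ 𝕃 := by
  have hp' := isPos_toCtx.2 hp
  have hK : replaceAt (toCtx b) p hole ∈ 𝕃 := by
    refine (h𝕃.l2' _ p hp').1 x ?_
    rwa [show replaceAt (toCtx b) p (ctxVar x) = toCtx b from
      replaceAt_self (subtermAt_toCtx hx)]
  rw [toCtx_replaceAt hp]
  have h1 : replaceAt (shape b) p (ctxVar y) ≤ replaceAt (toCtx b) p (ctxVar y) :=
    replaceAt_mono (shape_le_toCtx b) ⟨_, subtermAt_subst hx _⟩ le_rfl
  have h2 : replaceAt (toCtx b) p hole ≤ replaceAt (toCtx b) p (ctxVar y) :=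
    replaceAt_mono le_rfl hp' (hole_le _)
  obtain ⟨F, hF, hle⟩ := exists_merge h2 h1
  have hFmem := merge_mem h𝕃 hK h hF
  suffices F = replaceAt (toCtx b) p (ctxVar y) by rwa [toCtx_var, ← this]
  refine le_antisymm hle ?_
  have h3 := hF.isMerge.left
  have h4 := hF.isMerge.right
  obtain ⟨D, hD, hDle⟩ := subtermAt_mono h4 (subtermAt_replaceAt ⟨_, subtermAt_subst hx _⟩ _)
  exact replaceAt_le hp' h3 hD hDle

/-- A step of a renamed layer is a renamed step, or the layer may be replaced by a smaller one. -/
theorem step_or_encode_lt (h𝕃 : IsVarRestrictedLayerSystem 𝕃) (hW : WeaklyLayered 𝕃 R)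
    {enc : V → ℕ} (henc : Function.Injective enc) (x₀ : V) {b t : L.Term V} (hb : toCtx b ∈ 𝕃)
    {g : V → V} (h : R.Rel (b.subst fun y => Term.var (g y)) t) :
    (∃ c, R.Rel b c ∧ (c.subst fun y => Term.var (g y)) = t) ∨
      ∃ c, toCtx c ∈ 𝕃 ∧
        (c.subst fun y => (Term.var (g y) : L.Term V)) = b.subst (fun y => Term.var (g y)) ∧
        diamondRank hR (encode enc x₀ c) < diamondRank hR (encode enc x₀ b) := by
  classical
  have : Nonempty V := ⟨x₀⟩
  obtain ⟨ρ, hρ, p, hst⟩ := h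
  obtain ⟨θ, hs, rfl⟩ := id hst
  have hp : IsFunPos b p := (isFunPos_subst_var g).1 (TRS.isFunPos_of_stepAt hρ hst)
  obtain ⟨e, he⟩ := hp.isPos
  have hse : (e.subst fun y => Term.var (g y)) = ρ.1.subst θ := by
    have := subtermAt_subst he fun y => (Term.var (g y) : L.Term V)
    rw [hs] at this
    exact (Option.some.inj this).symm
  obtain ⟨ψ, rfl⟩ := exists_eq_psubst hse
  -- The step lifts to `b` unless the renaming `g` has identified variables that a non-linear rule
  -- compares.
  by_cases hcons : ∀ z q₁ q₂, IsVarPos ρ.1 z q₁ → IsVarPos ρ.1 z q₂ → ψ q₁ z = ψ q₂ z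
  · left
    obtain ⟨θ', hθ'⟩ := exists_psubst_eq_subst hcons
    rw [hθ'] at he hse
    refine ⟨_, ⟨ρ, hρ, p, θ', he, rfl⟩, ?_⟩
    rw [subst_replaceAt ⟨_, he⟩]
    congr 1
    rw [psubst_psubst_subst] at hse ⊢
    exact subst_congr fun z hz => subst_inj_on_vars hse (R.vars_rhs_subset ρ hρ hz)
  · right
    push Not at hcons
    obtain ⟨z, q₁, q₂, hq₁, hq₂, hne⟩ := hcons
    have hψ : ∀ q, IsVarPos ρ.1 z q → ((ψ q z).subst fun y => Term.var (g y)) = θ z := by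
      intro q hq
      rw [subst_psubst, subst_eq_psubst] at hse
      exact psubst_inj hse hq
    obtain ⟨r, x₁, x₂, h1, h2, hx⟩ := exists_var_ne ((hψ q₁ hq₁).trans (hψ q₂ hq₂).symm) hne
    have hbq : ∀ q, IsVarPos ρ.1 z q → ∀ y, IsVarPos (ψ q z) y r →
        IsVarPos b y (p ++ (q ++ r)) := by
      intro q hq y hy
      rw [isVarPos_append he, isVarPos_append (subtermAt_psubst_var hq ψ)]
      exact hy
    have hg : ∀ q, IsVarPos ρ.1 z q → ∀ y, IsVarPos (ψ q z) y r → IsVarPos (θ z) (g y) r := by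
      intro q hq y hy
      rw [← hψ q hq]
      exact isVarPos_subst.2 ⟨r, [], y, by simp, hy, by simp [IsVarPos]⟩
    have hgx : g x₁ = g x₂ := (hg q₁ hq₁ x₁ h1).unique (hg q₂ hq₂ x₂ h2)
    -- the layer with one variable replaced
    have key : ∀ q q' y y', IsVarPos ρ.1 z q → IsVarPos ρ.1 z q' → IsVarPos (ψ q z) y r →
        IsVarPos (ψ q' z) y' r → enc y' < enc y → g y = g y' →
        ∃ c, toCtx c ∈ 𝕃 ∧
          (c.subst fun y => (Term.var (g y) : L.Term V)) = b.subst (fun y => Term.var (g y)) ∧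
          diamondRank hR (encode enc x₀ c) < diamondRank hR (encode enc x₀ b) := by
      intro q q' y y' hq hq' hy hy' hlt hgy
      have hi := hbq q hq y hy
      have hj := hbq q' hq' y' hy'
      refine ⟨replaceAt b (p ++ (q ++ r)) (Term.var y'), ?_, ?_,
        encode_replaceAt_lt hR enc x₀ hi hlt⟩
      · refine replaceAt_var_mem h𝕃 hb ⟨_, hi⟩ ?_ hi
        -- All variables are identified with `y'`, which preserves the redex. The max-top of `w`
        -- contains `y'` at the position belonging to `q'`, and by (W) it is an instance of the
        -- left-hand side, so `y'` is admissible at the position belonging to `q` as well.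
        set w : L.Term V := b.subst fun _ => Term.var y' with hw
        have hw' : w = (b.subst fun y => (Term.var (g y) : L.Term V)).subst
            fun _ => Term.var y' := by
          rw [psubst_psubst_subst]
          rfl
        have hshape : (shape w : Ctx L V) = shape b := shape_subst_var b fun _ => y'
        have hwst := hst.subst fun _ => (Term.var y' : L.Term V)
        rw [← hw'] at hwst
        have hlew : (shape b : Ctx L V) ≤ toCtx w := by
          rw [← hshape]
          exact shape_le_toCtx w
        have hbS : (shape b : Ctx L V) ∈ 𝕃 := by
          rw [← shape_toCtx]
          exact shape_mem h𝕃 hb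
        have hlem := le_maxTop h𝕃 hbS hlew
        have hpw : IsFunPos (maxTop 𝕃 w) p := (isFunPos_shape.2 hp).mono hlem
        obtain ⟨N, -, θ', hM, -⟩ := hW ρ hρ w _ _ p (isMaxTop_maxTop h𝕃 w) hpw hwst
        have hM' : ∀ q, IsVarPos ρ.1 z q →
            subtermAt (maxTop 𝕃 w) (p ++ (q ++ r)) = subtermAt (θ' z) r := by
          intro q hq
          rw [subtermAt_append_of_eq hM]
          exact subtermAt_append_of_eq (subtermAt_subst hq θ') r
        have hjS : IsPos (shape b : Ctx L V) (p ++ (q' ++ r)) := ⟨_, subtermAt_subst hj _⟩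
        have hjmem : replaceAt (shape b) (p ++ (q' ++ r)) (ctxVar y') ∈ 𝕃 := by
          rw [← shape_toCtx]
          exact replaceAt_shape_mem h𝕃 hb (isVarPos_toCtx.2 hj)
        have hjle : replaceAt (shape b) (p ++ (q' ++ r)) (ctxVar y') ≤ toCtx w :=
          replaceAt_le hjS ((replaceAt_hole_le hjS).trans hlew)
            (subtermAt_toCtx (subtermAt_subst hj _)) le_rfl
        obtain ⟨D, hD, hDle⟩ := subtermAt_mono (le_maxTop h𝕃 hjmem hjle)
          (subtermAt_replaceAt hjS _)
        rw [ctxVar_le_iff.1 hDle, hM' q' hq', ← hM' q hq] at hD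
        have hSM : (shape (maxTop 𝕃 w) : Ctx L V) = shape b := by
          refine le_antisymm ?_ ?_
          · have := shape_mono (maxTop_le h𝕃 w)
            rwa [shape_toCtx, hshape] at this
          · have := shape_mono hlem
            rwa [shape_shape] at this
        rw [← hSM]
        exact replaceAt_shape_mem h𝕃 (maxTop_mem h𝕃 w) hD
      · rw [subst_replaceAt ⟨_, hi⟩]
        refine replaceAt_self ?_
        rw [subtermAt_subst hi, Term.subst, Term.subst, hgy]
    -- The variable with the larger code is replaced, so that a stack of diamonds shrinks.
    rcases lt_or_gt_of_ne (henc.ne hx) with h | h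
    · exact key q₂ q₁ x₂ x₁ hq₂ hq₁ h2 h1 h hgx.symm
    · exact key q₁ q₂ x₁ x₂ hq₁ hq₂ h1 h2 h hgx

/-- Every variable position gets its own variable that is admissible there. The max-top of the
resulting term contains its shape and each of these variables, hence everything, so the term itself
is a layer. -/
theorem exists_layer_of_shape_mem [Infinite V] (h𝕃 : IsVarRestrictedLayerSystem 𝕃)
    {t : L.Term V} (h : shape t ∈ 𝕃) :
    ∃ (b : L.Term V) (g : V → V), toCtx b ∈ 𝕃 ∧ (b.subst fun y => Term.var (g y)) = t := by
  classical
  have hhole : ∀ p y, IsVarPos t y p → subtermAt (shape t : Ctx L V) p = some hole :=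
    fun p y hp => subtermAt_subst hp _
  have hF : {p | ∃ y, IsVarPos t y p}.Finite :=
    (finite_positions t).subset fun p ⟨y, hp⟩ => ⟨_, hp⟩
  obtain ⟨ν, hν, hinj⟩ := exists_injOn_choice hF
    (fun p => {x : V | replaceAt (shape t) p (ctxVar x) ∈ 𝕃})
    (fun p ⟨y, hp⟩ => allowed_infinite h𝕃 h (hhole p y hp)) Set.finite_empty
  let g : V → V := fun x => if hx : ∃ p, (∃ y, IsVarPos t y p) ∧ ν p = x then
    hx.choose_spec.1.choose else x
  have hg : ∀ p y, IsVarPos t y p → g (ν p) = y := by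
    intro p y hp
    have hx : ∃ q, (∃ y, IsVarPos t y q) ∧ ν q = ν p := ⟨p, ⟨y, hp⟩, rfl⟩
    simp only [g, dif_pos hx]
    have hq := hinj hx.choose_spec.1 ⟨y, hp⟩ hx.choose_spec.2
    exact hx.choose_spec.1.choose_spec.unique (hq.symm ▸ hp)
  let b : L.Term V := psubst t fun p _ => Term.var (ν p)
  have hbt : (b.subst fun y => Term.var (g y)) = t := by
    rw [subst_psubst]
    conv_rhs => rw [← psubst_id t]
    exact psubst_congr fun p y hp => by rw [Term.subst, hg p y hp]
  have hshape : (shape b : Ctx L V) = shape t := by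
    rw [← hbt, shape_subst_var]
  have hle : shape t ≤ toCtx b := by
    rw [← hshape]
    exact shape_le_toCtx b
  refine ⟨b, g, ?_, hbt⟩
  have : maxTop 𝕃 b = toCtx b := by
    refine eq_of_shape_eq (maxTop_le h𝕃 b) le_rfl ?_ ?_ ?_
    · refine le_antisymm (shape_mono (maxTop_le h𝕃 b)) ?_
      have := shape_mono (le_maxTop h𝕃 h hle)
      rwa [shape_shape, ← hshape, ← shape_toCtx] at this
    · intro i y hi hh
      obtain ⟨q, r, x, rfl, hq, hr⟩ := isVarPos_psubst.1 hi
      obtain ⟨rfl, -⟩ := isVarPos_var.1 hr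
      rw [List.append_nil] at hi hh
      have hpos : IsPos (shape t : Ctx L V) q := ⟨_, hhole q x hq⟩
      have h1 : replaceAt (shape t) q (ctxVar (ν q)) ≤ toCtx b :=
        replaceAt_le hpos ((replaceAt_hole_le hpos).trans hle)
          (subtermAt_toCtx (subtermAt_psubst_var hq _)) le_rfl
      have h2 := subtermAt_le_subtermAt (le_maxTop h𝕃 (hν q ⟨x, hq⟩).1 h1)
        (subtermAt_replaceAt hpos _) hh
      exact ctxVar_ne_hole _ (le_hole_iff.1 h2)
    · intro i y _ hh
      obtain ⟨u, -, hu⟩ := subtermAt_toCtx_eq_some.1 hh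
      exact toCtx_ne_hole u hu.symm
  rw [← this]
  exact maxTop_mem h𝕃 b

include hR in
/-- Confluence of layers carries over to unrestricted layers. -/
theorem crOn_unrestricted [Countable V] [Infinite V] (h𝕃 : IsVarRestrictedLayerSystem 𝕃)
    (hW : WeaklyLayered 𝕃 R) (hcr : CROn R.Rel (rankLE 𝕃 1)) :
    CROn R.Rel (rankLE (unrestricted 𝕃) 1) := by
  obtain ⟨enc, henc⟩ := exists_injective_nat V
  let x₀ : V := Classical.arbitrary V
  -- The induction is on the measure of the layer `b`, not of its renamed instance, so replacing a
  -- variable by one with the same image is progress.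
  have key : ∀ (o : Ordinal) (b : L.Term V) (g : V → V), toCtx b ∈ 𝕃 →
      diamondRank hR (encode enc x₀ b) = o → ∀ t₁ t₂,
      ReflTransGen R.Rel (b.subst fun y => Term.var (g y)) t₁ →
      ReflTransGen R.Rel (b.subst fun y => Term.var (g y)) t₂ →
      ∃ v, ReflTransGen R.Rel t₁ v ∧ ReflTransGen R.Rel t₂ v := by
    intro o
    induction o using WellFoundedLT.induction with
    | ind o ih =>
    rintro b g hb rfl t₁ t₂ h₁ h₂
    have hgood := good_rankLE h𝕃 hW 1
    -- A sequence is followed in `b` as long as it lifts. Where it first fails to lift, the current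
    -- instance is also an instance of a layer with smaller measure, so the induction hypothesis
    -- makes it confluent.
    have lift : ∀ t, ReflTransGen R.Rel (b.subst fun y => Term.var (g y)) t →
        ∃ c, ReflTransGen R.Rel b c ∧ ReflTransGen R.Rel (c.subst fun y => Term.var (g y)) t ∧
          ((c.subst fun y => Term.var (g y)) = t ∨
            ∀ t₁ t₂, ReflTransGen R.Rel (c.subst fun y => Term.var (g y)) t₁ →
              ReflTransGen R.Rel (c.subst fun y => Term.var (g y)) t₂ →
              ∃ v, ReflTransGen R.Rel t₁ v ∧ ReflTransGen R.Rel t₂ v) := by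
      intro t ht
      induction ht with
      | refl => exact ⟨b, .refl, .refl, Or.inl rfl⟩
      | tail _ h2 ih' =>
        obtain ⟨c, hbc, hct, rfl | hc⟩ := ih'
        · have hcmem := mem_rankLE_one.1 (hgood.closed_rtc (mem_rankLE_one.2 hb) hbc)
          rcases step_or_encode_lt hR h𝕃 hW henc x₀ hcmem h2 with
            ⟨c', h3, h4⟩ | ⟨c', h3, h4, h5⟩
          · exact ⟨c', hbc.tail h3, h4 ▸ .refl, Or.inl h4⟩
          · refine ⟨c, hbc, .single h2, Or.inr ?_⟩
            rw [← h4]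
            exact ih _ (h5.trans_le (encode_rtc hR enc x₀ hbc)) c' g h3 rfl
        · exact ⟨c, hbc, hct.tail h2, Or.inr hc⟩
    have join : ∀ c t u : L.Term V, ReflTransGen R.Rel (c.subst fun y => Term.var (g y)) t →
        ((c.subst fun y => Term.var (g y)) = t ∨
            ∀ t₁ t₂, ReflTransGen R.Rel (c.subst fun y => Term.var (g y)) t₁ →
              ReflTransGen R.Rel (c.subst fun y => Term.var (g y)) t₂ →
              ∃ v, ReflTransGen R.Rel t₁ v ∧ ReflTransGen R.Rel t₂ v) →
        ReflTransGen R.Rel (c.subst fun y => Term.var (g y)) u →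
        ∃ v, ReflTransGen R.Rel t v ∧ ReflTransGen R.Rel u v := by
      rintro c t u h1 (rfl | h) h2
      · exact ⟨u, h2, .refl⟩
      · exact h t u h1 h2
    obtain ⟨c₁, hc₁, h1, h1'⟩ := lift t₁ h₁
    obtain ⟨c₂, hc₂, h2, h2'⟩ := lift t₂ h₂
    obtain ⟨d, hd₁, hd₂⟩ := hcr b (mem_rankLE_one.2 hb) c₁ c₂ hc₁ hc₂
    obtain ⟨v₁, h3, h4⟩ := join c₁ t₁ _ h1 h1' (rtc_subst hd₁ _)
    obtain ⟨v₂, h5, h6⟩ := join c₂ t₂ v₁ h2 h2' ((rtc_subst hd₂ _).trans h4)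
    exact ⟨v₂, h3.trans h6, h5⟩
  intro s hs t u ht hu
  have hs' : shape s ∈ 𝕃 := by
    have := mem_rankLE_one.1 hs
    rwa [unrestricted, Set.mem_ofPred_eq, shape_toCtx] at this
  obtain ⟨b, g, hb, rfl⟩ := exists_layer_of_shape_mem h𝕃 hs'
  exact key _ b g hb rfl t u ht hu

end Measure

/-! ### Bounded duplicating systems -/

open Classical in
/-- The positional substitution that fills in `φ p` for the variables from `X`, below a diamond
unless `c p` holds. -/
noncomputable def diamondFill (X : Set V) (c : List ℕ → Prop) (φ : List ℕ → L.Term V)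
    (p : List ℕ) (y : V) : (L.sum diamondLang).Term V :=
  if y ∈ X then if c p then emb (φ p) else diamond (emb (φ p)) else Term.var y

theorem rtc_diamondFill [Nonempty V] (t : (L.sum diamondLang).Term V) (X : Set V)
    {c d : List ℕ → Prop} (hcd : ∀ p, c p → d p) (φ : List ℕ → L.Term V) :
    ReflTransGen (Step (diamondRules L V)) (psubst t (diamondFill X c φ))
      (psubst t (diamondFill X d φ)) := by
  refine rtc_psubst t fun p y _ => ?_
  by_cases hy : y ∈ X
  · by_cases hc : c p
    · simp [diamondFill, hy, hc, hcd p hc, ReflTransGen.refl]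
    · by_cases hd : d p
      · simpa [diamondFill, hy, hc, hd] using ReflTransGen.single (step_diamond (V := V) _)
      · simp [diamondFill, hy, hc, hd, ReflTransGen.refl]
  · simp [diamondFill, hy, ReflTransGen.refl]

open Classical in
/-- The term `s` with a diamond on top of each tall alien. -/
noncomputable def markDiamond (χ : List ℕ → Option V) (σ : V → L.Term V) (s : L.Term V) :
    (L.sum diamondLang).Term V :=
  (emb (mark s χ)).subst fun x => if x ∈ marked χ then diamond (emb (σ x)) else Term.var x

/-- The diamonds stay on the copies of the tall aliens while layer and aliens are rewritten; this
includes diamonds on aliens that no longer deserve them. -/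
theorem rtc_markDiamond {χ : List ℕ → Option V} {σ : V → L.Term V} {s b : L.Term V}
    {ζ : List ℕ → L.Term V} (hb : ReflTransGen R.Rel (mark s χ) b)
    (hζ : ∀ p, ∀ x ∈ marked χ, IsVarPos b x p → ReflTransGen R.Rel (σ x) (ζ p)) :
    ReflTransGen (Step R.rulesWithDiamond) (markDiamond χ σ s)
      (psubst (emb b) (diamondFill (marked χ) (fun _ => False) ζ)) := by
  classical
  refine (rtc_subst (rtc_emb hb) _).trans ?_
  rw [subst_eq_psubst]
  refine rtc_psubst _ fun p y hp => ?_
  by_cases hy : y ∈ marked χ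
  · simpa [diamondFill, hy] using rtc_diamond_congr (rtc_emb (hζ p y hy (isVarPos_emb hp)))
  · simp [diamondFill, hy, ReflTransGen.refl]

theorem IsRep.markDiamond_eq [Nonempty V] (h𝕃 : IsVarRestrictedLayerSystem 𝕃)
    (hA : Good 𝕃 R A) {X : Set V} {b : L.Term V} {ζ : List ℕ → L.Term V}
    (hb : b ∈ Grow 𝕃 (avoiding A X))
    (hζ : ∀ p, ∀ x ∈ X, IsVarPos b x p → ζ p ∈ Grow 𝕃 A) {χ : List ℕ → Option V}
    {σ : V → L.Term V} (h : IsRep 𝕃 A (psubst b (fill X ζ)) χ σ) :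
    markDiamond χ σ (psubst b (fill X ζ)) =
      psubst (emb b) (diamondFill X (fun p => χ p = none) ζ) := by
  rw [markDiamond, h.mark_fill h𝕃 hA hb hζ, emb_psubst, subst_psubst]
  refine psubst_congr fun p y hp => ?_
  replace hp := isVarPos_emb hp
  have hZ := subtermAt_psubst_var hp (fill X ζ)
  by_cases hy : y ∈ X
  · rw [fill_of_mem hy] at hZ
    rw [fill_of_mem hy]
    cases hχ : χ p with
    | some x =>
      have hx : x ∈ marked χ := ⟨p, hχ⟩
      simp [diamondFill, hy, hχ, Term.subst, hx, h.subst_eq p x _ hχ hZ]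
    | none =>
      simp only [Option.map_none, Option.getD_none, diamondFill, hy, hχ, if_true]
      refine subst_eq_self fun z ⟨q, hz⟩ => if_neg fun hm => h.fresh z hm ?_
      exact vars_subset_of_subtermAt hZ ⟨q, isVarPos_emb hz⟩
  · rw [fill_of_notMem hy] at hZ
    rw [fill_of_notMem hy]
    simp only [diamondFill, hy, if_false, emb_var, Term.subst]
    exact if_neg fun hm => h.fresh y hm ⟨p, hZ⟩

/-! ### Loss of diamonds under short and tall rewriting -/

section Main

variable [Nonempty V] (h𝕃 : IsVarRestrictedLayerSystem 𝕃) (hA : Good 𝕃 R A)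
  (hR : R.IsBoundedDuplicating) {s b : L.Term V} {χ χ' : List ℕ → Option V}
  {σ σ' : V → L.Term V} {ζ : List ℕ → L.Term V} (hbG : b ∈ Grow 𝕃 (avoiding A (marked χ)))
  (hζG : ∀ p, ∀ x ∈ marked χ, IsVarPos b x p → ζ p ∈ Grow 𝕃 A)
  (h : IsRep 𝕃 A (psubst b (fill (marked χ) ζ)) χ' σ')
  (hb : ReflTransGen R.Rel (mark s χ) b)
  (hζ : ∀ p, ∀ x ∈ marked χ, IsVarPos b x p → ReflTransGen R.Rel (σ x) (ζ p))
include h𝕃 hA hbG hζG h hb hζ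

theorem diamondRank_markDiamond_le :
    diamondRank hR (markDiamond χ' σ' (psubst b (fill (marked χ) ζ))) ≤
      diamondRank hR (markDiamond χ σ s) := by
  rw [h.markDiamond_eq h𝕃 hA hbG hζG]
  exact (diamondRank_le_of_rtc_diamond hR (rtc_diamondFill _ _ (fun _ h => h.elim) ζ)).trans
    (diamondRank_le_of_rtc hR (rtc_markDiamond hb hζ))

/-- The rewritten term still has a diamond at `p`, while the marked form of the new term has none
there. Removing it is a genuine step of the terminating relation; any further diamonds are removed
for free. -/
theorem diamondRank_markDiamond_lt {p : List ℕ} {x : V} (hx : x ∈ marked χ)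
    (hp : IsVarPos b x p) (hχ : χ' p = none) :
    diamondRank hR (markDiamond χ' σ' (psubst b (fill (marked χ) ζ))) <
      diamondRank hR (markDiamond χ σ s) := by
  rw [h.markDiamond_eq h𝕃 hA hbG hζG]
  refine lt_of_lt_of_le ?_ (diamondRank_le_of_rtc hR (rtc_markDiamond hb hζ))
  have hp' : IsVarPos (emb b) x p := subtermAt_emb hp
  refine lt_of_le_of_lt (diamondRank_le_of_rtc_diamond hR
    (rtc_diamondFill (emb b) (marked χ) (c := fun q => q = p) (by rintro q rfl; exact hχ) ζ)) ?_
  refine diamondRank_lt hR ?_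
  have h1 := subtermAt_psubst_var hp' (diamondFill (marked χ) (fun _ => False) ζ)
  have h2 := (step_diamond (V := V) (emb (ζ p))).replaceAt
    (s := psubst (emb b) (diamondFill (marked χ) (fun _ => False) ζ)) (p := p)
    (by rw [h1]; simp [diamondFill, hx])
  rw [replaceAt_psubst_var hp'] at h2
  convert h2 using 1
  refine psubst_congr fun q y hq => ?_
  by_cases hqp : q = p
  · subst hqp
    obtain rfl := hq.unique hp'
    simp [diamondFill, hx]
  · simp [diamondFill, hqp]

end Main

/-- The induction step for bounded duplicating systems, if all variables are allowed in layers. -/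
theorem CROn.grow_of_isBoundedDuplicating [Infinite V] (h𝕃 : IsVarRestrictedLayerSystem 𝕃)
    (hfull : ∀ M ∈ 𝕃, ∀ p, subtermAt M p = some hole → ∀ x, replaceAt M p (ctxVar x) ∈ 𝕃)
    (hW : WeaklyLayered 𝕃 R) (hR : R.IsBoundedDuplicating) (hA : Good 𝕃 R A)
    (hcr : CROn R.Rel (Grow 𝕃 A)) : CROn R.Rel (Grow 𝕃 (Grow 𝕃 A)) := by
  -- Equal tall aliens share a variable regardless of position, which is possible because `hfull`
  -- admits every variable in every hole.
  choose χ σ hrep hkey using fun s => exists_isRep h𝕃 hA s (K := Unit) (fun _ => ())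
    (fun _ => Set.univ) fun p a ha =>
      ⟨Set.infinite_univ, fun x _ => hfull _ (maxTop_mem h𝕃 s) p ha.1.1 x⟩
  have hbG : ∀ s b, ReflTransGen R.Rel (mark s (χ s)) b →
      b ∈ Grow 𝕃 (avoiding A (marked (χ s))) := fun s b hb =>
    ((hA.avoiding _).grow h𝕃 hW).closed_rtc (hrep s).mem hb
  have H : RepSystem 𝕃 R A χ σ fun s => diamondRank hR (markDiamond (χ s) (σ s) s) := by
    refine ⟨fun s _ => hrep s, ?_, ?_, ?_⟩
    · intro s _ ρ hρ p t hst hp z q₁ q₂ r h1 h2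
      have same : ∀ {W : Type _} (e : L.Term W) (θ : V → L.Term W),
          subtermAt e p = some (ρ.1.subst θ) →
            subtermAt e (p ++ (q₁ ++ r)) = subtermAt e (p ++ (q₂ ++ r)) := by
        intro W e θ he
        rw [subtermAt_append_of_eq he, subtermAt_append_of_eq he,
          subtermAt_append_of_eq (subtermAt_subst h1 θ),
          subtermAt_append_of_eq (subtermAt_subst h2 θ)]
      obtain ⟨N, -, θ', hM, -⟩ := hW ρ hρ s t _ p (isMaxTop_maxTop h𝕃 s) hp hst
      obtain ⟨θ, hs, -⟩ := hst
      have htall : ∀ a, IsTallAt 𝕃 A s (p ++ (q₁ ++ r)) a ↔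
          IsTallAt 𝕃 A s (p ++ (q₂ ++ r)) a := by
        intro a
        rw [IsTallAt, IsTallAt, IsAlienAt, IsAlienAt, same _ θ hs, same _ θ' hM]
      by_cases h : ∃ a, IsTallAt 𝕃 A s (p ++ (q₁ ++ r)) a
      · obtain ⟨a, ha⟩ := h
        exact (hkey s _ _ a a ha ((htall a).1 ha)).2 ⟨rfl, rfl⟩
      · have hn₁ := not_not.1 fun h' => h (((hrep s).dom _).1 h')
        have hn₂ := not_not.1 fun h' => h (by simpa only [htall] using ((hrep s).dom _).1 h')
        rw [hn₁, hn₂]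
    · intro s hs b ζ hb hζ
      exact diamondRank_markDiamond_le h𝕃 hA hR (hbG s b hb) (fun p x hx hp =>
        (hA.grow h𝕃 hW).closed_rtc ((hrep s).marked_alien_mem h𝕃 hW hA hs hx) (hζ p x hx hp))
        (hrep _) hb hζ
    · intro s hs b τ hb hτ hτid
      have hτG : ∀ x ∈ marked (χ s), τ x ∈ Grow 𝕃 A := fun x hx =>
        (hA.grow h𝕃 hW).closed_rtc ((hrep s).marked_alien_mem h𝕃 hW hA hs hx) (hτ x hx)
      -- If all occurrences in `b` of marked variables are still tall after substitution, their
      -- marks depend only on the variable and the sequence can be replayed; otherwise a diamond is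
      -- lost and the measure drops.
      by_cases hall : ∀ p, ∀ x ∈ marked (χ s), IsVarPos b x p → χ (b.subst τ) p ≠ none
      · right
        intro c hc
        refine short_of_uniform h𝕃 hA (hbG s b hb) hτG hτid (hrep _) ?_ hc
        intro x hx p q hp hq
        have htall : ∀ i, IsVarPos b x i → IsTallAt 𝕃 A (b.subst τ) i (τ x) := by
          intro i hi
          obtain ⟨a, ha⟩ := ((hrep _).dom i).1 (hall i x hx hi)
          have h1 : subtermAt (b.subst τ) i = some (τ x) := subtermAt_subst hi τ
          rw [ha.1.2, Option.some.injEq] at h1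
          rwa [← h1]
        exact (hkey _ p q _ _ (htall p hp) (htall q hq)).2 ⟨rfl, rfl⟩
      · left
        push Not at hall
        obtain ⟨p, x, hx, hp, hχ⟩ := hall
        have hr := hrep (b.subst τ)
        rw [subst_eq_fill b hτid] at hχ hr ⊢
        exact diamondRank_markDiamond_lt h𝕃 hA hR (hbG s b hb)
          (fun p x hx hp => by
            rw [valAt_of_isVarPos hp]
            exact hτG x hx) hr hb
          (fun p x hx hp => by
            rw [valAt_of_isVarPos hp]
            exact hτ x hx) hx hp hχ
  exact H.crOn h𝕃 hW hA hcr

/-! ### Confluence -/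

section Confluence

variable [Infinite V] (h𝕃 : IsVarRestrictedLayerSystem 𝕃) (hcr : CROn R.Rel (rankLE 𝕃 1))
include h𝕃 hcr

theorem WeaklyLayered.confluent_of_isLeftLinear (hW : WeaklyLayered 𝕃 R)
    (hR : R.IsLeftLinear) : Confluent R.Rel :=
  confluent_of_grow h𝕃 hW hcr fun _ hA h => h.grow_of_isLeftLinear h𝕃 hW hR hA

theorem WeaklyLayered.confluent_of_isBoundedDuplicating [Countable V] (hW : WeaklyLayered 𝕃 R)
    (hR : R.IsBoundedDuplicating) : Confluent R.Rel := by
  -- Here the whole induction runs over the unrestricted layers, whose rank one is larger;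
  -- `crOn_unrestricted` supplies the base case.
  refine confluent_of_grow h𝕃.unrestricted (hW.unrestricted h𝕃)
    (crOn_unrestricted hR h𝕃 hW hcr) fun A hA h => h.grow_of_isBoundedDuplicating
      h𝕃.unrestricted ?_ (hW.unrestricted h𝕃) hR hA
  intro M hM p hp x
  refine replaceAt_mem_unrestricted ⟨_, hp⟩ none _ ?_
  have := replaceAt_self hp
  rw [hole] at this
  rwa [this]

theorem Layered.confluent (hR : Layered 𝕃 R) : Confluent R.Rel :=
  confluent_of_grow h𝕃 hR.weaklyLayered hcr fun _ hA h => hR.crOn_grow h𝕃 hA h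

end Confluence

end LayerSystems

theorem mainTheorem5 {L : FirstOrder.Language.{u, v}} {V : Type w} [Countable V]
    [Infinite V] (𝕃 : Set (LayerSystems.Ctx L V))
    (h𝕃 : LayerSystems.IsVarRestrictedLayerSystem 𝕃) (R : LayerSystems.TRS L V)
    (hR : LayerSystems.ConfluentOn R.Rel {t | LayerSystems.HasRank 𝕃 t 1}) :
    (LayerSystems.WeaklyLayered 𝕃 R → R.IsLeftLinear → LayerSystems.Confluent R.Rel) ∧
    (LayerSystems.WeaklyLayered 𝕃 R → R.IsBoundedDuplicating → LayerSystems.Confluent R.Rel) ∧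
    (LayerSystems.Layered 𝕃 R → LayerSystems.Confluent R.Rel) := by
  have hcr : LayerSystems.CROn R.Rel (LayerSystems.rankLE 𝕃 1) := hR.crOn fun t ht =>
    LayerSystems.hasRank_one_of_mem h𝕃 (LayerSystems.mem_rankLE_one.1 ht)
  exact ⟨fun hW => hW.confluent_of_isLeftLinear h𝕃 hcr,
    fun hW => hW.confluent_of_isBoundedDuplicating h𝕃 hcr, fun h => h.confluent h𝕃 hcr⟩
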